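/- **Setting.** Let $(M,g)$ be an $n$-dimensional smooth Riemannian manifold that is locally symmetric, $\nabla R=0$, where $[\nabla_\mu,\nabla_\nu]v^\alpha=R^\alpha{}_{\beta\mu\nu}v^\beta$. Let $x'\in M$, let $y=(y^a)$ be normal coordinates centred at $x'$ on a normal neighbourhood $\mathcal U$ of $x'$ (the image of a star-shaped open set under the exponential map, on which that map is a diffeomorphism), and let $e_a$ be the orthonormal frame on $\mathcal U$ obtained from $\partial/\partial y^a|_{x'}$ by parallel transport along the geodesics from $x'$; Latin indices $a,b,\dots$ refer to this frame. Write the curvature at $x'$ as $R_{abcd}=\beta_{ik}E^i{}_{ab}E^k{}_{cd}$ with $(\beta_{ik})$ a symmetric nondegenerate $p\times p$ matrix, inverse $(\beta^{ik})$, and $E^1,\dots,E^p$ linearly independent antisymmetric matrices. Put $D^a{}_{ib}=-\beta_{ik}E^k{}_{ab}$ (the generators $D_i$ of the holonomy algebra), $K^a{}_b=R^a{}_{cbd}y^cy^d$, $$P_a=\bigl(\sqrt K\cot\sqrt K\bigr)^b{}_a\frac{\partial}{\partial y^b},\qquad L_i=-D^b{}_{ia}\,y^a\frac{\partial}{\partial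 y^b},\qquad (\xi_A)=(P_a,L_i),\qquad (\gamma_{AB})=\mathrm{diag}(\delta_{ab},\beta_{ik}),$$ and $(\gamma^{AB})=(\gamma_{AB})^{-1}$ (the $\xi_A$ are Killing fields). Let $q$ be the orthogonal projection onto $\bigcap_i\ker D_i$ and $h=1-q$. Let $\Sigma_{ab}$ be the generators of a representation of $\mathfrak{so}(n)=\mathrm{Lie}(\mathrm{Spin}(n))$ on a finite-dimensional real or complex vector space $\Lambda$, defining the spin-tensor bundle $\mathcal T$, and let $\mathcal W$ be a vector bundle of finite rank with connection $\partial_\mu+\mathcal A_\mu$ whose curvature $\mathcal F$ is parallel, $\nabla_\lambda\mathcal F_{\mu\nu}=0$. The twisted spin-tensor bundle $\mathcal V=\mathcal T\otimes\mathcal W$ carries the connection $$\nabla_\mu=\partial_\mu+\tfrac12\omega^{ab}{}_\mu\Sigma_{ab}\otimes 1+1\otimes\mathcal A_\mu,$$ with $\omega$ the spin connection of the frame $e_a$, and the Laplacian $\Delta=g^{\mu\nu}\nabla_\mu\nabla_\nu$. Put $\mathcal B_{ab}=\mathcal F_{cd}q^c{}_aq^d{}_b$ and $\mathcal E_{ab}=\mathcal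 F_{cd}h^c{}_ah^d{}_b$. **Theorem.** There is an antisymmetric family $X_{ab}=-X_{ba}$ of endomorphisms of $\mathcal W|_{\mathcal U}$ with $\mathcal E_{ab}=\tfrac12R^{cd}{}_{ab}X_{cd}$. For every such family put $$G_{ab}=\Sigma_{ab}\otimes1+1\otimes X_{ab},\qquad \mathcal R_i=-\tfrac12D^a{}_{ib}G^b{}_a,\qquad \mathcal R^2=\beta^{ij}\mathcal R_i\mathcal R_j,$$ $$\mathcal L_A=\nabla_{\xi_A}+\tfrac12\,\xi_A{}^a{}_{;b}\,G^b{}_a,\qquad \mathcal L^2=\gamma^{AB}\mathcal L_A\mathcal L_B,\qquad \mathcal B_{AB}=\xi_A{}^a\xi_B{}^b\,\mathcal B_{ab}.$$ Then, on smooth sections of $\mathcal V$ over $\mathcal U$, $$\Delta=\mathcal L^2-\mathcal R^2,\qquad\text{and, for every }A,\qquad [\mathcal L_A,\Delta]=2\gamma^{BC}\mathcal B_{AB}\mathcal L_C .$$ -/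

import Mathlib

open scoped Manifold ContDiff Kronecker Matrix

noncomputable section

namespace SymSpace

/-- Coordinate space `ℝⁿ`; its points are the normal coordinates `y`. -/
abbrev Coord (n : ℕ) : Type := EuclideanSpace ℝ (Fin n)

section Calculus

variable {n : ℕ} {V : Type*} [NormedAddCommGroup V] [NormedSpace ℝ V]

/-- The partial derivative `∂_μ f` at `y`. -/
def pd (μ : Fin n) (f : Coord n → V) (y : Coord n) : V :=
  fderiv ℝ f y (EuclideanSpace.single μ 1)

/-- The entrywise partial derivative `∂_μ A` of a matrix-valued function. -/
def matPd {κ 𝕜 : Type*} [RCLike 𝕜] (μ : Fin n) (A : Coord n → Matrix κ κ 𝕜) (y : Coord n) :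
    Matrix κ κ 𝕜 :=
  Matrix.of fun r s => pd μ (fun z => A z r s) y

end Calculus

/-! ### Riemannian geometry in coordinates; `g y μ ν = g_{μν}(y)` -/

section Riemann

variable {n : ℕ} (g : Coord n → Matrix (Fin n) (Fin n) ℝ)

/-- The Christoffel symbol `Γ^l_{μν}` of the Levi-Civita connection. -/
def christoffel (l μ ν : Fin n) (y : Coord n) : ℝ :=
  (1 / 2) * ∑ k, (g y)⁻¹ l k *
    (pd μ (fun z => g z k ν) y + pd ν (fun z => g z k μ) y - pd k (fun z => g z μ ν) y)

/-- The curvature `R^α_{βμν}`, normalized by `[∇_μ, ∇_ν] v^α = R^α_{βμν} v^β`. -/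
def riemann (α β μ ν : Fin n) (y : Coord n) : ℝ :=
  pd μ (christoffel g α ν β) y - pd ν (christoffel g α μ β) y
    + ∑ k, (christoffel g α μ k y * christoffel g k ν β y
      - christoffel g α ν k y * christoffel g k μ β y)

/-- The covariant derivative `∇_l R^α_{βμν}` of the curvature. -/
def nablaRiemann (l α β μ ν : Fin n) (y : Coord n) : ℝ :=
  pd l (riemann g α β μ ν) y
    + ∑ k, (christoffel g α l k y * riemann g k β μ ν y
      - christoffel g k l β y * riemann g α k μ ν y
      - christoffel g k l μ y * riemann g α β k ν y
      - christoffel g k l ν y * riemann g α β μ k y)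

/-- `g` is written in normal coordinates on `U`, centred at the origin: `U` is star-shaped, the
coordinate basis is orthonormal at the origin, and the rays `t ↦ t y` are geodesics. -/
structure IsNormal (U : Set (Coord n)) : Prop where
  zero_mem : (0 : Coord n) ∈ U
  starConvex : StarConvex ℝ 0 U
  metric_zero : g 0 = 1
  geodesic : ∀ y ∈ U, ∀ l, ∑ μ, ∑ ν, christoffel g l μ ν y * y μ * y ν = 0

/-- `e y μ a = e_a^μ(y)` is the smooth orthonormal frame on `U` that is obtained from the coordinate
basis at the origin by parallel transport along the rays `t ↦ t y`. -/
structure IsRadialFrame (U : Set (Coord n)) (e : Coord n → Matrix (Fin n) (Fin n) ℝ) : Prop where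
  smooth : ∀ μ a, ContDiffOn ℝ ∞ (fun y => e y μ a) U
  orthonormal : ∀ y ∈ U, (e y)ᵀ * g y * e y = 1
  frame_zero : e 0 = 1
  parallel : ∀ y ∈ U, ∀ a ν,
    ∑ μ, y μ * (pd μ (fun z => e z ν a) y + ∑ l, christoffel g ν μ l y * e y l a) = 0

variable (e : Coord n → Matrix (Fin n) (Fin n) ℝ)

/-- The frame components `R^a_{bcd} = R_{abcd}` of the curvature (the coframe is `(e y)⁻¹`). -/
def frameRiemann (a b c d : Fin n) (y : Coord n) : ℝ :=
  ∑ α, ∑ β, ∑ μ, ∑ ν, (e y)⁻¹ a α * e y β b * e y μ c * e y ν d * riemann g α β μ ν y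

/-- The spin connection `ω^a_{b μ}`, defined by `∇_μ e_b = ω^a_{b μ} e_a`. -/
def spinConnection (μ a b : Fin n) (y : Coord n) : ℝ :=
  ∑ ν, (e y)⁻¹ a ν * (pd μ (fun z => e z ν b) y + ∑ l, christoffel g ν μ l y * e y l b)

/-- The frame components `v^a_{;b}` of the covariant derivative of a vector field `v = v^μ ∂_μ`. -/
def frameNabla (v : Coord n → Fin n → ℝ) (a b : Fin n) (y : Coord n) : ℝ :=
  ∑ μ, ∑ ν, (e y)⁻¹ a μ * e y ν b * (pd ν (fun z => v z μ) y + ∑ l, christoffel g μ ν l y * v y l)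

end Riemann

/-! ### Riemannian manifolds -/

section Manifold

variable {n : ℕ} {M : Type*} [TopologicalSpace M] [ChartedSpace (Coord n) M]
  [IsManifold (𝓡 n) ∞ M]

/-- The components `g_{μν}` of a Riemannian metric on `M` in the coordinates of a chart. -/
def chartMetric
    (g : Bundle.ContMDiffRiemannianMetric (𝓡 n) ∞ (Coord n) (fun x : M => TangentSpace (𝓡 n) x))
    (Φ : OpenPartialHomeomorph M (Coord n)) (y : Coord n) : Matrix (Fin n) (Fin n) ℝ :=
  Matrix.of fun μ ν => g.inner (Φ.symm y)
    (mfderiv (𝓡 n) (𝓡 n) Φ.symm y (EuclideanSpace.single μ 1))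
    (mfderiv (𝓡 n) (𝓡 n) Φ.symm y (EuclideanSpace.single ν 1))

/-- `M` is locally symmetric: the Riemann curvature is parallel, `∇R = 0`. -/
def IsLocallySymmetric
    (g : Bundle.ContMDiffRiemannianMetric (𝓡 n) ∞ (Coord n) (fun x : M => TangentSpace (𝓡 n) x)) :
    Prop :=
  ∀ Φ ∈ IsManifold.maximalAtlas (𝓡 n) ∞ M, ∀ y ∈ Φ.target, ∀ l α β μ ν,
    nablaRiemann (chartMetric g Φ) l α β μ ν y = 0

/-- `Φ` is a normal coordinate chart of `M` around `x₀`. -/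
structure IsNormalChart
    (g : Bundle.ContMDiffRiemannianMetric (𝓡 n) ∞ (Coord n) (fun x : M => TangentSpace (𝓡 n) x))
    (x₀ : M) (Φ : OpenPartialHomeomorph M (Coord n)) : Prop where
  mem_atlas : Φ ∈ IsManifold.maximalAtlas (𝓡 n) ∞ M
  mem_source : x₀ ∈ Φ.source
  map_center : Φ x₀ = 0
  normal : IsNormal (chartMetric g Φ) Φ.target

end Manifold

/-! ### The holonomy algebra and the Killing fields `ξ_A` -/

section Holonomy

variable {n p : ℕ} (β : Matrix (Fin p) (Fin p) ℝ) (E : Fin p → Matrix (Fin n) (Fin n) ℝ)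

/-- `R_{abcd} = β_{ik} E^i_{ab} E^k_{cd}` with `β` symmetric and nondegenerate and the `E^i`
antisymmetric and linearly independent. Here `R a b c d = R_{abcd}`. -/
structure IsCurvatureFactorization (R : Fin n → Fin n → Fin n → Fin n → ℝ) : Prop where
  symm : β.IsSymm
  nondegenerate : IsUnit β.det
  antisymm : ∀ i, (E i)ᵀ = -E i
  linearIndependent : LinearIndependent ℝ E
  factor : ∀ a b c d, R a b c d = ∑ i, ∑ k, β i k * E i a b * E k c d

/-- The constants `R_{abcd} = β_{ik} E^i_{ab} E^k_{cd}`. -/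
def curv (a b c d : Fin n) : ℝ := ∑ i, ∑ k, β i k * E i a b * E k c d

/-- The generators `D_i = (D^a_{ib})` of the holonomy algebra, `D^a_{ib} = -β_{ik} E^k_{ab}`. -/
def holGen (i : Fin p) : Matrix (Fin n) (Fin n) ℝ := -∑ k, β i k • E k

/-- The matrix `K^a_b = R^a_{cbd} y^c y^d`. -/
def matK (y : Coord n) : Matrix (Fin n) (Fin n) ℝ :=
  Matrix.of fun a b => ∑ c, ∑ d, curv β E a c b d * y c * y d

/-- `cos √K`, as the value of an entire function at `K`. -/
def cosSqrt (K : Matrix (Fin n) (Fin n) ℝ) : Matrix (Fin n) (Fin n) ℝ :=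
  ∑' m : ℕ, ((-1 : ℝ) ^ m / (2 * m).factorial) • K ^ m

/-- `sin √K / √K`, as the value of an entire function at `K`. -/
def sincSqrt (K : Matrix (Fin n) (Fin n) ℝ) : Matrix (Fin n) (Fin n) ℝ :=
  ∑' m : ℕ, ((-1 : ℝ) ^ m / (2 * m + 1).factorial) • K ^ m

/-- `√K cot √K`. -/
def sqrtCot (K : Matrix (Fin n) (Fin n) ℝ) : Matrix (Fin n) (Fin n) ℝ :=
  cosSqrt K * (sincSqrt K)⁻¹

/-- The vector fields `(ξ_A) = (P_a, L_i)`, by their components with respect to `∂/∂y^b`: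
`P_a = (√K cot √K)^b_a ∂/∂y^b` and `L_i = -D^b_{ia} y^a ∂/∂y^b`. -/
def killing (A : Fin n ⊕ Fin p) (y : Coord n) (b : Fin n) : ℝ :=
  match A with
  | .inl a => sqrtCot (matK β E y) b a
  | .inr i => -∑ a, holGen β E i b a * y a

/-- The matrix `(γ_{AB}) = diag(δ_{ab}, β_{ik})`. -/
def gam (n : ℕ) (β : Matrix (Fin p) (Fin p) ℝ) : Matrix (Fin n ⊕ Fin p) (Fin n ⊕ Fin p) ℝ :=
  Matrix.fromBlocks 1 0 0 β

/-- The flat subspace of the tangent space: the vectors annihilated by the holonomy algebra. -/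
def flatSubspace : Submodule ℝ (Coord n) :=
  ⨅ i, LinearMap.ker (Matrix.toEuclideanLin (holGen β E i))

/-- The orthogonal projection `q^a_b` to the flat subspace. -/
def projFlat (a b : Fin n) : ℝ :=
  (flatSubspace β E).starProjection (EuclideanSpace.single b (1 : ℝ)) a

/-- The orthogonal projection `h^a_b = δ^a_b - q^a_b` to the semisimple subspace. -/
def projSemi (a b : Fin n) : ℝ := (1 : Matrix (Fin n) (Fin n) ℝ) a b - projFlat β E a b

end Holonomy

/-! ### Twisted spin-tensor bundles

In the local frame, sections of the twisted spin-tensor bundle `𝓥 = 𝓣 ⊗ 𝓦` are functions with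
values in `𝕜^ι ⊗ 𝕜^κ = 𝕜^(ι × κ)`. -/

section Bundle

variable {n p : ℕ} {𝕜 ι κ : Type*} [RCLike 𝕜] [Fintype ι] [DecidableEq ι]
  [Fintype κ] [DecidableEq κ]

/-- `Σ_{ab}` are the generators, in some representation, of the Lie algebra `𝔰𝔬(n)` of `Spin(n)`:
they satisfy the relations of the matrices `e_a e_bᵀ - e_b e_aᵀ`. -/
structure IsSpinRep (Sg : Fin n → Fin n → Matrix ι ι 𝕜) : Prop where
  antisymm : ∀ a b, Sg a b = -Sg b a
  bracket : ∀ a b c d, Sg a b * Sg c d - Sg c d * Sg a b =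
    (1 : Matrix (Fin n) (Fin n) 𝕜) b c • Sg a d - (1 : Matrix (Fin n) (Fin n) 𝕜) a c • Sg b d
      - (1 : Matrix (Fin n) (Fin n) 𝕜) b d • Sg a c + (1 : Matrix (Fin n) (Fin n) 𝕜) a d • Sg b c

/-- The curvature `𝓕_{μν}` of the gauge connection `∇_μ = ∂_μ + 𝓐_μ` on `𝓦`. -/
def gaugeCurv (𝓐 : Fin n → Coord n → Matrix κ κ 𝕜) (μ ν : Fin n) (y : Coord n) : Matrix κ κ 𝕜 :=
  matPd μ (𝓐 ν) y - matPd ν (𝓐 μ) y + (𝓐 μ y * 𝓐 ν y - 𝓐 ν y * 𝓐 μ y)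

/-- The covariant derivative `∇_l 𝓕_{μν}`. -/
def nablaGaugeCurv (g : Coord n → Matrix (Fin n) (Fin n) ℝ) (𝓐 : Fin n → Coord n → Matrix κ κ 𝕜)
    (l μ ν : Fin n) (y : Coord n) : Matrix κ κ 𝕜 :=
  matPd l (gaugeCurv 𝓐 μ ν) y
    - ∑ k, (christoffel g k l μ y • gaugeCurv 𝓐 k ν y + christoffel g k l ν y • gaugeCurv 𝓐 μ k y)
    + (𝓐 l y * gaugeCurv 𝓐 μ ν y - gaugeCurv 𝓐 μ ν y * 𝓐 l y)

/-- The frame components `𝓕_{ab}`. -/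
def frameGaugeCurv (e : Coord n → Matrix (Fin n) (Fin n) ℝ)
    (𝓐 : Fin n → Coord n → Matrix κ κ 𝕜) (a b : Fin n) (y : Coord n) : Matrix κ κ 𝕜 :=
  ∑ μ, ∑ ν, (e y μ a * e y ν b) • gaugeCurv 𝓐 μ ν y

variable (g e : Coord n → Matrix (Fin n) (Fin n) ℝ)
  (β : Matrix (Fin p) (Fin p) ℝ) (E : Fin p → Matrix (Fin n) (Fin n) ℝ)
  (Sg : Fin n → Fin n → Matrix ι ι 𝕜)
  (𝓐 : Fin n → Coord n → Matrix κ κ 𝕜)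
  (X : Coord n → Fin n → Fin n → Matrix κ κ 𝕜)

/-- The flat part `𝓑_{ab} = 𝓕_{cd} q^c_a q^d_b` of the gauge curvature. -/
def flatCurv (a b : Fin n) (y : Coord n) : Matrix κ κ 𝕜 :=
  ∑ c, ∑ d, (projFlat β E c a * projFlat β E d b) • frameGaugeCurv e 𝓐 c d y

/-- The semisimple part `𝓔_{ab} = 𝓕_{cd} h^c_a h^d_b` of the gauge curvature. -/
def semiCurv (a b : Fin n) (y : Coord n) : Matrix κ κ 𝕜 :=
  ∑ c, ∑ d, (projSemi β E c a * projSemi β E d b) • frameGaugeCurv e 𝓐 c d y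

/-- `X_{ab}` is an antisymmetric family of endomorphisms of `𝓦` on `U` that generates the semisimple
part of the gauge curvature: `𝓔_{ab} = (1/2) R^{cd}_{ab} X_{cd}`. -/
structure IsGaugeGenerator (U : Set (Coord n)) : Prop where
  antisymm : ∀ y ∈ U, ∀ a b, X y a b = -X y b a
  semi : ∀ y ∈ U, ∀ a b,
    semiCurv e β E 𝓐 a b y = (1 / 2 : ℝ) • ∑ c, ∑ d, curv β E c d a b • X y c d

/-- `G_{ab} = Σ_{ab} ⊗ 1 + 1 ⊗ X_{ab}`, where `Σ_{ab}` (written `Sg a b`) are the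
generators of the representation of `𝔰𝔬(n)` that defines `𝓣`. -/
def genG (a b : Fin n) (y : Coord n) : Matrix (ι × κ) (ι × κ) 𝕜 :=
  Sg a b ⊗ₖ (1 : Matrix κ κ 𝕜) + (1 : Matrix ι ι 𝕜) ⊗ₖ X y a b

/-- The holonomy generators `𝓡_i = -(1/2) D^a_{ib} G^b_a` in the bundle representation. -/
def holRep (i : Fin p) (y : Coord n) : Matrix (ι × κ) (ι × κ) 𝕜 :=
  (-(1 / 2) : ℝ) • ∑ a, ∑ b, holGen β E i a b • genG Sg X b a y

/-- The Casimir operator `𝓡² = β^{ij} 𝓡_i 𝓡_j`. -/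
def holCasimir (y : Coord n) : Matrix (ι × κ) (ι × κ) 𝕜 :=
  ∑ i, ∑ j, β⁻¹ i j • (holRep β E Sg X i y * holRep β E Sg X j y)

/-- The connection form of `𝓥`: the connection induced by the spin connection on `𝓣`, twisted by the
gauge connection, `(1/2) ω^{ab}_μ Σ_{ab} ⊗ 1 + 1 ⊗ 𝓐_μ`. -/
def connForm (μ : Fin n) (y : Coord n) : Matrix (ι × κ) (ι × κ) 𝕜 :=
  ((1 / 2 : ℝ) • ∑ a, ∑ b, spinConnection g e μ a b y • Sg a b) ⊗ₖ (1 : Matrix κ κ 𝕜)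
    + (1 : Matrix ι ι 𝕜) ⊗ₖ 𝓐 μ y

/-- The covariant derivative `∇_μ φ` of a section. -/
def nabla (μ : Fin n) (φ : Coord n → ι × κ → 𝕜) (y : Coord n) : ι × κ → 𝕜 :=
  pd μ φ y + connForm g e Sg 𝓐 μ y *ᵥ φ y

/-- The Laplacian `Δ = g^{μν} ∇_μ ∇_ν` on sections of `𝓥`. -/
def laplacian (φ : Coord n → ι × κ → 𝕜) (y : Coord n) : ι × κ → 𝕜 :=
  ∑ μ, ∑ ν, (g y)⁻¹ μ ν •
    (nabla g e Sg 𝓐 μ (nabla g e Sg 𝓐 ν φ) y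
      - ∑ l, christoffel g l μ ν y • nabla g e Sg 𝓐 l φ y)

/-- `S_A = (1/2) ξ_A^a_{;b} G^b_a`. -/
def lieShift (A : Fin n ⊕ Fin p) (y : Coord n) : Matrix (ι × κ) (ι × κ) 𝕜 :=
  (1 / 2 : ℝ) • ∑ a, ∑ b, frameNabla g e (killing β E A) a b y • genG Sg X b a y

/-- The twisted Lie derivative `𝓛_A φ = ξ_A^μ ∇_μ φ + S_A φ`. -/
def twistedLie (A : Fin n ⊕ Fin p) (φ : Coord n → ι × κ → 𝕜) (y : Coord n) : ι × κ → 𝕜 :=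
  ∑ μ, killing β E A y μ • nabla g e Sg 𝓐 μ φ y + lieShift g e β E Sg X A y *ᵥ φ y

/-- The Casimir operator `𝓛² = γ^{AB} 𝓛_A 𝓛_B`. -/
def lieCasimir (φ : Coord n → ι × κ → 𝕜) (y : Coord n) : ι × κ → 𝕜 :=
  ∑ A, ∑ B, (gam n β)⁻¹ A B •
    twistedLie g e β E Sg 𝓐 X A (twistedLie g e β E Sg 𝓐 X B φ) y

/-- `𝓑_{AB} = ξ_A^a ξ_B^b 𝓑_{ab}`, with `ξ_A^a` the frame components, acting on `𝓥`. -/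
def flatCurvKilling (A B : Fin n ⊕ Fin p) (y : Coord n) : Matrix (ι × κ) (ι × κ) 𝕜 :=
  (1 : Matrix ι ι 𝕜) ⊗ₖ ∑ a, ∑ b,
    (((e y)⁻¹ *ᵥ killing β E A y) a * ((e y)⁻¹ *ᵥ killing β E B y) b) • flatCurv e β E 𝓐 a b y

end Bundle

end SymSpace

end

/-! In the radial frame the curvature of a locally symmetric metric has constant components, and the
coframe, the spin connection and the fields ξ_A obey first-order equations along the rays from the
origin. The theorem thereby reduces to uniqueness for ordinary differential equations and to linear
algebra in the holonomy algebra.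

Algebra. An element of the holonomy algebra is a coefficient vector `c`, with matrix D(c) = `holMap
β E c`; the coefficients of the curvature transformation R(u,v) are `curvCoef E u v`. These span,
because the E^i are independent, so a linear identity need only be checked on them. Parallel
curvature gives R(u,v)·R = 0, hence a bracket `holBr` and the ad-invariance of β.

Geometry. A pair (ξ, c) is transported by ∇_ν ξ = D(c)θ_ν, ∇_ν c = R(θ_ν, ξ), where θ_ν is the
coframe vector. The radial components of these equations imply all of them (`IsSymFrame.transport`).
The fields ξ_A are solutions because the coframe is sin √K / √K (`coframe_eq_sinc`). The pairing
ξ·ξ' + β(c,c') of two solutions is constant, so for ξ_A, ξ_B it is γ_AB, its value at the origin.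
Inverting this gives the completeness relations: the γ^{AB}-contractions of ξξ, ξc and cc are
δ^{ab}, 0 and β^{ij}.

Gauge curvature. Applying [∇,∇] to the parallel 𝓕 gives [𝓕(u,v), 𝓕(w,z)] = 𝓕(R(u,v)w, z) + 𝓕(w,
R(u,v)z). The left side changes sign when the two pairs are exchanged. For each real functional of 𝓕
this removes the mixed flat–semisimple components and puts the semisimple part into the holonomy
algebra (`semi_mem_holonomy`). The crucial point there is that the kernel of the Ricci tensor is
flat, since a suitable value of the Killing form of the transvection algebra is a sum of two
nonpositive traces. This yields X. On R(u,v) the map c ↦ ½ D(c)_{ab}X_{ab} is 𝓕(hu,hv) whatever X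
is, so it is a parallel representation.

Operators. Let ρ be the resulting representation on 𝓥. Then 𝓛_A = ∇_{ξ_A} − ρ(c_A), and the
completeness relations applied to 𝓛_A𝓛_B give Δ = 𝓛² − 𝓡². The same expansion gives [𝓛_A,𝓛_B] =
f_{AB}^C 𝓛_C + 𝓑_AB with constant f. In [𝓛_A,𝓛²] the f terms cancel by total antisymmetry, 𝓑_AB
commutes with every 𝓛_C, and 𝓡² is parallel and commutes with ρ; only twice the 𝓑 term survives. -/

open scoped Topology

noncomputable section

namespace SymSpace

attribute [local instance] Matrix.normedAddCommGroup Matrix.normedSpace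

/-! ### Directional derivatives of smooth functions on coordinate space -/

section Calculus

variable {n : ℕ} {E F G : Type*} [NormedAddCommGroup E] [NormedSpace ℝ E]
  [NormedAddCommGroup F] [NormedSpace ℝ F] [NormedAddCommGroup G] [NormedSpace ℝ G]

/-- The directional derivative of `f` at `y` in the direction `v`. -/
def dirD (v : Coord n) (f : Coord n → E) (y : Coord n) : E := fderiv ℝ f y v

/-- The coordinate vector `∂_μ`. -/
abbrev cv (μ : Fin n) : Coord n := EuclideanSpace.single μ 1

theorem pd_eq (μ : Fin n) (f : Coord n → E) (y : Coord n) : pd μ f y = dirD (cv μ) f y := rfl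

variable {f f' : Coord n → E} {h h' : Coord n → F} {v y : Coord n}

theorem dirD_congr {U : Set (Coord n)} (hU : IsOpen U) (hy : y ∈ U) (hf : ∀ z ∈ U, f z = f' z) :
    dirD v f y = dirD v f' y := by
  have : f =ᶠ[𝓝 y] f' := Filter.eventually_of_mem (hU.mem_nhds hy) hf
  rw [dirD, dirD, this.fderiv_eq]

theorem contDiffAt_congr {U : Set (Coord n)} (hU : IsOpen U) (hy : y ∈ U)
    (hf : ∀ z ∈ U, f z = f' z) (h : ContDiffAt ℝ ∞ f' y) : ContDiffAt ℝ ∞ f y :=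
  h.congr_of_eventuallyEq (Filter.eventually_of_mem (hU.mem_nhds hy) hf)

theorem cd_diff (hf : ContDiffAt ℝ ∞ f y) : DifferentiableAt ℝ f y :=
  hf.differentiableAt (by simp)

theorem dirD_const (x : E) : dirD v (fun _ => x) y = 0 := by simp [dirD]

theorem dirD_add (hf : ContDiffAt ℝ ∞ f y) (hf' : ContDiffAt ℝ ∞ f' y) :
    dirD v (fun z => f z + f' z) y = dirD v f y + dirD v f' y := by
  simp [dirD, fderiv_fun_add (cd_diff hf) (cd_diff hf')]

theorem dirD_sub (hf : ContDiffAt ℝ ∞ f y) (hf' : ContDiffAt ℝ ∞ f' y) :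
    dirD v (fun z => f z - f' z) y = dirD v f y - dirD v f' y := by
  simp [dirD, fderiv_fun_sub (cd_diff hf) (cd_diff hf')]

theorem dirD_neg : dirD v (fun z => - f z) y = - dirD v f y := by
  simp [dirD, fderiv_fun_neg]

theorem dirD_sum {ι : Type*} {s : Finset ι} {f : ι → Coord n → E}
    (hf : ∀ i ∈ s, ContDiffAt ℝ ∞ (f i) y) :
    dirD v (fun z => ∑ i ∈ s, f i z) y = ∑ i ∈ s, dirD v (f i) y := by
  simp [dirD, fderiv_fun_sum (fun i hi => cd_diff (hf i hi))]

theorem cd_lin [FiniteDimensional ℝ E] (L : E →ₗ[ℝ] F) (hf : ContDiffAt ℝ ∞ f y) :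
    ContDiffAt ℝ ∞ (fun z => L (f z)) y :=
  (LinearMap.toContinuousLinearMap L).contDiff.contDiffAt.comp y hf

theorem dirD_lin [FiniteDimensional ℝ E] (L : E →ₗ[ℝ] F) (hf : ContDiffAt ℝ ∞ f y) :
    dirD v (fun z => L (f z)) y = L (dirD v f y) := by
  have := ((LinearMap.toContinuousLinearMap L).hasFDerivAt.comp y (cd_diff hf).hasFDerivAt).fderiv
  have h2 := congrArg (fun T => T v) this
  simpa [dirD, Function.comp_def] using h2

theorem cd_bilin [FiniteDimensional ℝ E] [FiniteDimensional ℝ F] (B : E →ₗ[ℝ] F →ₗ[ℝ] G)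
    (hf : ContDiffAt ℝ ∞ f y) (hh : ContDiffAt ℝ ∞ h y) :
    ContDiffAt ℝ ∞ (fun z => B (f z) (h z)) y := by
  have := (B.toContinuousBilinearMap).isBoundedBilinearMap.contDiff.contDiffAt.comp y
    (n := ∞) (hf.prodMk hh)
  simpa [Function.comp_def] using this

theorem dirD_bilin [FiniteDimensional ℝ E] [FiniteDimensional ℝ F] (B : E →ₗ[ℝ] F →ₗ[ℝ] G)
    (hf : ContDiffAt ℝ ∞ f y) (hh : ContDiffAt ℝ ∞ h y) :
    dirD v (fun z => B (f z) (h z)) y = B (dirD v f y) (h y) + B (f y) (dirD v h y) := by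
  have := (B.toContinuousBilinearMap).fderiv_of_bilinear (cd_diff hf) (cd_diff hh)
  have h2 := congrArg (fun T => T v) this
  simp only [LinearMap.toContinuousBilinearMap_apply] at h2
  rw [dirD, h2]
  simp [dirD, add_comm]

theorem cd_dirD (hf : ContDiffAt ℝ ∞ f y) : ContDiffAt ℝ ∞ (dirD v f) y :=
  (hf.fderiv_right (m := ∞) (by simp)).clm_apply contDiffAt_const

theorem cd_pd {μ : Fin n} (hf : ContDiffAt ℝ ∞ f y) : ContDiffAt ℝ ∞ (pd μ f) y := cd_dirD hf

theorem dirD_comm {w : Coord n} (hf : ContDiffAt ℝ ∞ f y) :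
    dirD v (dirD w f) y = dirD w (dirD v f) y := by
  have hd : DifferentiableAt ℝ (fderiv ℝ f) y :=
    (hf.fderiv_right (m := ∞) (by simp)).differentiableAt (by simp)
  have key : ∀ a b : Coord n, dirD a (dirD b f) y = fderiv ℝ (fderiv ℝ f) y a b := by
    intro a b
    have := fderiv_clm_apply hd (differentiableAt_const b)
    have h2 := congrArg (fun T => T a) this
    change fderiv ℝ (fun z => fderiv ℝ f z b) y a = _
    simpa using h2
  rw [key, key]
  refine (hf.isSymmSndFDerivAt ?_) v w
  rw [minSmoothness_of_isRCLikeNormedField]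
  exact WithTop.coe_le_coe.2 le_top

/-- A derivative in the direction of the position vector is a sum of partial derivatives. -/
theorem dirD_self : dirD y f y = ∑ μ, y μ • pd μ f y := by
  have : y = ∑ μ, y μ • cv μ := by
    ext i; simp [Finset.sum_apply, cv, Pi.single_apply]
  conv_lhs => rw [dirD]; arg 2; rw [this]
  simp [pd]

/-- Product rule together with the symmetry of the second derivative. It turns a radial equation for
`f` into a radial equation for the derivatives of `f`. -/
theorem dirD_radial (hf : ContDiffAt ℝ ∞ f y) :
    dirD v (fun z => dirD z f z) y = dirD v f y + dirD y (dirD v f) y := by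
  have hd : DifferentiableAt ℝ (fderiv ℝ f) y :=
    (hf.fderiv_right (m := ∞) (by simp)).differentiableAt (by simp)
  have h1 : dirD v (fun z => dirD z f z) y = dirD v f y + fderiv ℝ (fderiv ℝ f) y v y := by
    have := fderiv_clm_apply hd (differentiableAt_id (𝕜 := ℝ) (x := y))
    have h2 := congrArg (fun T => T v) this
    simpa [dirD] using h2
  rw [h1, dirD_comm hf]
  congr 1
  have := fderiv_clm_apply hd (differentiableAt_const y)
  have h2 := congrArg (fun T => T v) this
  change _ = fderiv ℝ (fun z => fderiv ℝ f z y) y v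
  simpa using h2.symm

theorem cd_apply {ι : Type*} [Fintype ι] {f : Coord n → ι → E} (i : ι)
    (hf : ContDiffAt ℝ ∞ f y) : ContDiffAt ℝ ∞ (fun z => f z i) y :=
  contDiffAt_pi.1 hf i

theorem cd_pi {ι : Type*} [Fintype ι] {f : Coord n → ι → E}
    (hf : ∀ i, ContDiffAt ℝ ∞ (fun z => f z i) y) : ContDiffAt ℝ ∞ f y :=
  contDiffAt_pi.2 hf

theorem dirD_apply {ι : Type*} [Fintype ι] {f : Coord n → ι → E} (i : ι)
    (hf : ContDiffAt ℝ ∞ f y) : dirD v f y i = dirD v (fun z => f z i) y := by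
  have := fderiv_pi (fun i => cd_diff (cd_apply i hf))
  have h2 := congrArg (fun T => T v i) this
  simpa [dirD] using h2

variable {κ 𝕜 : Type*} [RCLike 𝕜] [Fintype κ] {A B : Coord n → Matrix κ κ 𝕜}

theorem cd_entry (r s : κ) (hA : ContDiffAt ℝ ∞ A y) : ContDiffAt ℝ ∞ (fun z => A z r s) y :=
  cd_apply s (cd_apply (f := fun z => A z) r hA)

theorem cd_matrix (hA : ∀ r s, ContDiffAt ℝ ∞ (fun z => A z r s) y) : ContDiffAt ℝ ∞ A y :=
  cd_pi fun r => cd_pi fun s => hA r s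

theorem dirD_entry (r s : κ) (hA : ContDiffAt ℝ ∞ A y) :
    dirD v A y r s = dirD v (fun z => A z r s) y := by
  have h1 := dirD_apply (v := v) (f := fun z => A z) r hA
  have h2 := dirD_apply (v := v) (f := fun z => A z r) s (cd_apply (f := fun z => A z) r hA)
  rw [← h2]; exact congrFun h1 s

theorem matPd_eq {μ : Fin n} (hA : ContDiffAt ℝ ∞ A y) : matPd μ A y = pd μ A y := by
  ext r s
  exact (dirD_entry r s hA).symm

theorem cd_mul (hA : ContDiffAt ℝ ∞ A y) (hB : ContDiffAt ℝ ∞ B y) :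
    ContDiffAt ℝ ∞ (fun z => A z * B z) y := by
  classical
  exact cd_bilin (LinearMap.mul ℝ (Matrix κ κ 𝕜)) hA hB

theorem dirD_mul (hA : ContDiffAt ℝ ∞ A y) (hB : ContDiffAt ℝ ∞ B y) :
    dirD v (fun z => A z * B z) y = dirD v A y * B y + A y * dirD v B y := by
  classical
  exact dirD_bilin (LinearMap.mul ℝ (Matrix κ κ 𝕜)) hA hB

/-- Matrix-vector multiplication as a real bilinear map. -/
def mulVecBilin (κ 𝕜 : Type*) [RCLike 𝕜] [Fintype κ] :
    Matrix κ κ 𝕜 →ₗ[ℝ] (κ → 𝕜) →ₗ[ℝ] (κ → 𝕜) :=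
  LinearMap.mk₂ ℝ (fun A x => A *ᵥ x) (fun _ _ _ => Matrix.add_mulVec _ _ _)
    (fun _ _ _ => Matrix.smul_mulVec _ _ _) (fun _ _ _ => Matrix.mulVec_add _ _ _)
    (fun _ _ _ => Matrix.mulVec_smul _ _ _)

variable {φ : Coord n → κ → 𝕜}

theorem cd_mulVec (hA : ContDiffAt ℝ ∞ A y) (hφ : ContDiffAt ℝ ∞ φ y) :
    ContDiffAt ℝ ∞ (fun z => A z *ᵥ φ z) y :=
  cd_bilin (mulVecBilin κ 𝕜) hA hφ

theorem dirD_mulVec (hA : ContDiffAt ℝ ∞ A y) (hφ : ContDiffAt ℝ ∞ φ y) :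
    dirD v (fun z => A z *ᵥ φ z) y = dirD v A y *ᵥ φ y + A y *ᵥ dirD v φ y :=
  dirD_bilin (mulVecBilin κ 𝕜) hA hφ

variable {c : Coord n → ℝ}

theorem cd_smul (hc : ContDiffAt ℝ ∞ c y) (hf : ContDiffAt ℝ ∞ f y) :
    ContDiffAt ℝ ∞ (fun z => c z • f z) y := hc.smul hf

theorem dirD_smul (hc : ContDiffAt ℝ ∞ c y) (hf : ContDiffAt ℝ ∞ f y) :
    dirD v (fun z => c z • f z) y = dirD v c y • f y + c y • dirD v f y := by
  simp [dirD, fderiv_fun_smul (cd_diff hc) (cd_diff hf), add_comm]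

theorem dirD_const_smul (a : ℝ) (hf : ContDiffAt ℝ ∞ f y) :
    dirD v (fun z => a • f z) y = a • dirD v f y := by
  simp [dirD, fderiv_fun_const_smul (cd_diff hf)]

theorem dirD_rmul {c' : Coord n → ℝ} (hc : ContDiffAt ℝ ∞ c y) (hc' : ContDiffAt ℝ ∞ c' y) :
    dirD v (fun z => c z * c' z) y = dirD v c y * c' y + c y * dirD v c' y := dirD_smul hc hc'

theorem cd_transpose {A : Coord n → Matrix κ κ ℝ} (hA : ContDiffAt ℝ ∞ A y) :
    ContDiffAt ℝ ∞ (fun z => (A z)ᵀ) y :=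
  cd_lin (Matrix.transposeLinearEquiv κ κ ℝ ℝ).toLinearMap hA

theorem dirD_transpose {A : Coord n → Matrix κ κ ℝ} (hA : ContDiffAt ℝ ∞ A y) :
    dirD v (fun z => (A z)ᵀ) y = (dirD v A y)ᵀ :=
  dirD_lin (Matrix.transposeLinearEquiv κ κ ℝ ℝ).toLinearMap hA

/-- Cramer's rule: the determinant and the adjugate are polynomials in the entries. -/
theorem cd_inv [DecidableEq κ] {A : Coord n → Matrix κ κ ℝ} (hA : ContDiffAt ℝ ∞ A y)
    (hdet : (A y).det ≠ 0) : ContDiffAt ℝ ∞ (fun z => (A z)⁻¹) y := by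
  have hd : ∀ B : Coord n → Matrix κ κ ℝ, ContDiffAt ℝ ∞ B y →
      ContDiffAt ℝ ∞ (fun z => (B z).det) y := by
    intro B hB
    simp only [Matrix.det_apply]
    refine ContDiffAt.sum fun σ _ => ?_
    refine ContDiffAt.const_smul _ ?_
    exact contDiffAt_prod fun i _ => cd_entry _ _ hB
  have hadj : ContDiffAt ℝ ∞ (fun z => (A z).adjugate) y := by
    refine cd_matrix fun r s => ?_
    simp only [Matrix.adjugate_apply]
    refine hd _ (cd_matrix fun i j => ?_)
    simp only [Matrix.updateRow_apply]
    split_ifs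
    · exact contDiffAt_const
    · exact cd_entry _ _ hA
  simp only [Matrix.inv_def, Ring.inverse_eq_inv']
  exact cd_smul ((hd A hA).inv hdet) hadj

theorem cd_ofLp : ContDiffAt ℝ ∞ (fun z : Coord n => (WithLp.ofLp z : Fin n → ℝ)) y :=
  cd_lin (WithLp.linearEquiv 2 ℝ (Fin n → ℝ)).toLinearMap contDiffAt_id

theorem dirD_ofLp : dirD v (fun z : Coord n => (WithLp.ofLp z : Fin n → ℝ)) y = v.ofLp := by
  have := dirD_lin (v := v) (WithLp.linearEquiv 2 ℝ (Fin n → ℝ)).toLinearMap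
    (contDiffAt_id (𝕜 := ℝ) (n := ∞) (x := y))
  simpa [dirD] using this

end Calculus

/-! ### Differential equations along rays -/

section Rays

variable {n : ℕ} {E : Type*} [NormedAddCommGroup E] [NormedSpace ℝ E]
  {U : Set (Coord n)}

theorem smul_mem_of_starConvex (hs : StarConvex ℝ 0 U) {y : Coord n} (hy : y ∈ U) {t : ℝ}
    (h0 : 0 ≤ t) (h1 : t ≤ 1) : t • y ∈ U := by
  have := hs hy (sub_nonneg.2 h1) h0 (by ring)
  simpa using this

theorem hasDerivAt_ray {f : Coord n → E} {y : Coord n} {t : ℝ}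
    (hf : ContDiffAt ℝ ∞ f (t • y)) :
    HasDerivAt (fun s : ℝ => f (s • y)) (dirD y f (t • y)) t := by
  have h1 : HasDerivAt (fun s : ℝ => s • y) y t := by
    simpa using (hasDerivAt_id t).smul_const y
  exact (cd_diff hf).hasFDerivAt.comp_hasDerivAt t h1

theorem dirD_smul_dir (f : Coord n → E) (y x : Coord n) (t : ℝ) :
    dirD (t • y) f x = t • dirD y f x := by simp [dirD]

/-- A function whose radial derivative vanishes on a star-shaped set is constant. -/
theorem eq_zero_value_of_radial (hs : StarConvex ℝ 0 U) {f : Coord n → E}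
    (hf : ∀ y ∈ U, ContDiffAt ℝ ∞ f y) (hr : ∀ y ∈ U, dirD y f y = 0) {y : Coord n} (hy : y ∈ U) :
    f y = f 0 := by
  have hm : ∀ t ∈ Set.Icc (0 : ℝ) 1, t • y ∈ U := fun t ht =>
    smul_mem_of_starConvex hs hy ht.1 ht.2
  have hd : ∀ t ∈ Set.Icc (0 : ℝ) 1,
      HasDerivAt (fun s : ℝ => f (s • y)) (dirD y f (t • y)) t :=
    fun t ht => hasDerivAt_ray (hf _ (hm t ht))
  have hz : ∀ t ∈ Set.Ioc (0 : ℝ) 1, dirD y f (t • y) = 0 := by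
    intro t ht
    have := hr _ (hm t ⟨ht.1.le, ht.2⟩)
    rw [dirD_smul_dir] at this
    exact (smul_eq_zero.1 this).resolve_left ht.1.ne'
  -- The hypothesis at `t • y` is `t` times the wanted statement and says nothing at `t = 0`; there
  -- the value is a limit from the right.
  have hz0 : dirD y f ((0 : ℝ) • y) = 0 := by
    have hc : ContinuousAt (fun t : ℝ => dirD y f (t • y)) 0 :=
      ContinuousAt.comp' (f := fun t : ℝ => t • y) (g := dirD y f)
        (cd_dirD (hf _ (hm 0 (by simp)))).continuousAt (by fun_prop)
    have h1 : Filter.Tendsto (fun t : ℝ => dirD y f (t • y)) (𝓝[>] 0)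
        (𝓝 (dirD y f ((0 : ℝ) • y))) := hc.tendsto.mono_left nhdsWithin_le_nhds
    refine tendsto_nhds_unique h1 (tendsto_const_nhds.congr' ?_)
    filter_upwards [Ioc_mem_nhdsGT (zero_lt_one (α := ℝ))] with t ht using (hz t ht).symm
  have := constant_of_has_deriv_right_zero (f := fun s : ℝ => f (s • y)) (a := 0) (b := 1)
    (fun t ht => (hd t ht).continuousAt.continuousWithinAt) (fun t ht => by
      have h2 := hd t ⟨ht.1, ht.2.le⟩
      have h3 : dirD y f (t • y) = 0 := by
        rcases ht.1.eq_or_lt with h | h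
        · rw [← h]; exact hz0
        · exact hz t ⟨h, ht.2.le⟩
      rw [h3] at h2
      exact h2.hasDerivWithinAt) 1 (by simp)
  simpa using this

/-- Uniqueness for linear differential equations with constant coefficients. -/
theorem linear_ode_zero {Z : ℝ → E} (N : E →L[ℝ] E)
    (hZ : ∀ t ∈ Set.Icc (0 : ℝ) 1, HasDerivAt Z (N (Z t)) t) (h0 : Z 0 = 0) : Z 1 = 0 := by
  have := ODE_solution_unique_of_mem_Icc_right (v := fun _ => N) (K := ‖N‖₊)
    (s := fun _ => Set.univ) (f := Z) (g := fun _ => 0) (a := 0) (b := 1)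
    (fun t _ => N.lipschitz.lipschitzOnWith)
    (fun t ht => (hZ t ht).continuousAt.continuousWithinAt)
    (fun t ht => (hZ t ⟨ht.1, ht.2.le⟩).hasDerivWithinAt) (fun _ _ => trivial)
    continuousOn_const (fun t _ => by simpa using hasDerivWithinAt_const t (Set.Ici t) (0 : E))
    (fun _ _ => trivial) h0
  exact this (by simp : (1 : ℝ) ∈ Set.Icc (0 : ℝ) 1)

/-- A solution of `y∂f = -f + N(y) f`, with `N` linear in `y`, that is smooth on a star-shaped set
vanishes. -/
theorem radial_ode_zero [FiniteDimensional ℝ E] (hs : StarConvex ℝ 0 U) {f : Coord n → E}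
    (hf : ∀ y ∈ U, ContDiffAt ℝ ∞ f y) (N : Coord n →ₗ[ℝ] E →ₗ[ℝ] E)
    (hr : ∀ y ∈ U, dirD y f y = - f y + N y (f y)) {y : Coord n} (hy : y ∈ U) :
    f y = 0 := by
  -- The factor `t` in `Z t = t • f (t • y)` absorbs the term `-f`, leaving Z' = N(y) Z. It also
  -- forces `Z 0 = 0`, so no initial value of `f` is needed.
  have := linear_ode_zero (Z := fun t => t • f (t • y)) (LinearMap.toContinuousLinearMap (N y))
    (fun t ht => by
      have hm := smul_mem_of_starConvex hs hy ht.1 ht.2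
      have h1 := (hasDerivAt_id t).smul (hasDerivAt_ray (hf _ hm))
      have h2 := hr _ hm
      rw [dirD_smul_dir] at h2
      convert h1 using 1
      · rfl
      · rw [id, h2]
        simp) (by simp)
  simpa using this

end Rays

end SymSpace

namespace SymSpace

/-! ### The holonomy algebra -/

theorem sum_rot {ι M : Type*} [Fintype ι] [AddCommMonoid M] (f : ι → ι → ι → M) :
    ∑ b, ∑ c, ∑ d, f b c d = ∑ b, ∑ c, ∑ d, f c d b := by
  rw [Finset.sum_comm (f := fun b c => ∑ d, f c d b)]
  exact Finset.sum_congr rfl fun b _ => Finset.sum_comm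

theorem sum_pair_comm {ι κ M : Type*} [Fintype ι] [Fintype κ] [AddCommMonoid M]
    (f : ι → ι → κ → κ → M) :
    ∑ c, ∑ d, ∑ i, ∑ k, f c d i k = ∑ i, ∑ k, ∑ c, ∑ d, f c d i k := by
  have h := Finset.sum_comm (s := Finset.univ) (t := Finset.univ)
    (f := fun (x : ι × ι) (z : κ × κ) => f x.1 x.2 z.1 z.2)
  simpa only [Fintype.sum_prod_type] using h

section Algebra

variable {n p : ℕ}

/-- The element `c^i D_i` of the holonomy algebra with coefficients `c`. -/
def holMap (β : Matrix (Fin p) (Fin p) ℝ) (E : Fin p → Matrix (Fin n) (Fin n) ℝ) :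
    (Fin p → ℝ) →ₗ[ℝ] Matrix (Fin n) (Fin n) ℝ :=
  Fintype.linearCombination ℝ (holGen β E)

/-- The coefficients of the curvature transformation `R(u, v)` in the holonomy algebra. -/
def curvCoef (E : Fin p → Matrix (Fin n) (Fin n) ℝ) :
    (Fin n → ℝ) →ₗ[ℝ] (Fin n → ℝ) →ₗ[ℝ] (Fin p → ℝ) :=
  LinearMap.mk₂ ℝ (fun u v k => -(u ⬝ᵥ E k *ᵥ v))
    (fun _ _ _ => by ext; simp [add_dotProduct]; ring)
    (fun _ _ _ => by ext; simp)
    (fun _ _ _ => by ext; simp [Matrix.mulVec_add, dotProduct_add]; ring)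
    (fun _ _ _ => by ext; simp [Matrix.mulVec_smul])

/-- The invariant form `β` on the holonomy algebra. -/
def holForm (β : Matrix (Fin p) (Fin p) ℝ) :
    (Fin p → ℝ) →ₗ[ℝ] (Fin p → ℝ) →ₗ[ℝ] ℝ := Matrix.toBilin' β

variable {β : Matrix (Fin p) (Fin p) ℝ} {E : Fin p → Matrix (Fin n) (Fin n) ℝ}

theorem holMap_apply (c : Fin p → ℝ) : holMap β E c = ∑ i, c i • holGen β E i := by
  simp [holMap, Fintype.linearCombination_apply]

theorem holMap_single (i : Fin p) : holMap β E (Pi.single i 1) = holGen β E i := by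
  simp [holMap_apply, Pi.single_apply]

theorem curvCoef_apply (u v : Fin n → ℝ) (k : Fin p) :
    curvCoef E u v k = -(u ⬝ᵥ E k *ᵥ v) := rfl

theorem curvCoef_single (a b : Fin n) (k : Fin p) :
    curvCoef E (Pi.single a 1) (Pi.single b 1) k = - E k a b := by
  simp [curvCoef_apply]

theorem holForm_apply (c c' : Fin p → ℝ) : holForm β c c' = c ⬝ᵥ β *ᵥ c' := by
  simp [holForm, Matrix.toBilin'_apply']

variable (β E) in
/-- The algebraic properties of the curvature of a symmetric space in factorized form. -/
structure IsHolonomy : Prop where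
  symm : β.IsSymm
  nondegenerate : IsUnit β.det
  antisymm : ∀ i, (E i)ᵀ = -E i
  linearIndependent : LinearIndependent ℝ E
  bianchi : ∀ a b c d, curv β E a b c d + curv β E a c d b + curv β E a d b c = 0
  invariant : ∀ u v w z : Fin n → ℝ,
    holMap β E (curvCoef E u v) * holMap β E (curvCoef E w z)
      - holMap β E (curvCoef E w z) * holMap β E (curvCoef E u v)
    = holMap β E (curvCoef E (holMap β E (curvCoef E u v) *ᵥ w) z)
      + holMap β E (curvCoef E w (holMap β E (curvCoef E u v) *ᵥ z))

/-- The signs in `holGen` and in `curvCoef` cancel, so `holMap β E (curvCoef E u v)` is the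
curvature transformation R(u,v). -/
theorem curv_sum (hβ : β.IsSymm) (u v : Fin n → ℝ) (a b : Fin n) :
    holMap β E (curvCoef E u v) a b = ∑ c, ∑ d, curv β E a b c d * u c * v d := by
  have h1 : ∀ k, curvCoef E u v k = - ∑ c, ∑ d, E k c d * u c * v d := by
    intro k
    simp only [curvCoef_apply, dotProduct, Matrix.mulVec, Finset.mul_sum]
    congr 1
    exact Finset.sum_congr rfl fun c _ => Finset.sum_congr rfl fun d _ => by ring
  have h2 : ∑ c, ∑ d, curv β E a b c d * u c * v d =
      ∑ i, ∑ k, β i k * E i a b * ∑ c, ∑ d, E k c d * u c * v d := by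
    simp only [curv, Finset.sum_mul, Finset.mul_sum]
    rw [sum_pair_comm]
    refine Finset.sum_congr rfl fun _ _ => Finset.sum_congr rfl fun _ _ =>
      Finset.sum_congr rfl fun _ _ => Finset.sum_congr rfl fun _ _ => by ring
  rw [h2, Finset.sum_comm]
  simp only [holMap_apply, Matrix.sum_apply, Matrix.smul_apply, h1, holGen, Matrix.neg_apply,
    smul_eq_mul, neg_mul_neg]
  refine Finset.sum_congr rfl fun i _ => ?_
  rw [Finset.mul_sum]
  refine Finset.sum_congr rfl fun k _ => ?_
  rw [hβ.apply i k]; ring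

namespace IsHolonomy

variable (H : IsHolonomy β E)
include H

theorem holGen_transpose (i : Fin p) : (holGen β E i)ᵀ = - holGen β E i := by
  simp [holGen, Matrix.transpose_sum, H.antisymm]

theorem holMap_transpose (c : Fin p → ℝ) : (holMap β E c)ᵀ = - holMap β E c := by
  simp [holMap_apply, Matrix.transpose_sum, H.holGen_transpose]

/-- The coefficients of D(c) with respect to the independent `E k` are -cβ, and β is invertible. -/
theorem holMap_injective : Function.Injective (holMap β E) := by
  rw [injective_iff_map_eq_zero]
  intro c hc
  have h1 : holMap β E c = Fintype.linearCombination ℝ E (-(c ᵥ* β)) := by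
    simp only [holMap_apply, holGen, Fintype.linearCombination_apply, Pi.neg_apply, Matrix.vecMul,
      dotProduct, smul_neg, neg_smul, Finset.sum_smul, Finset.smul_sum, smul_smul,
      Finset.sum_neg_distrib]
    rw [Finset.sum_comm]
  have h2 := H.linearIndependent.fintypeLinearCombination_injective
  rw [h1] at hc
  have h3 : -(c ᵥ* β) = 0 := h2 (by rw [hc, map_zero])
  have h4 : c ᵥ* β = 0 := by simpa using h3
  exact Matrix.eq_zero_of_vecMul_eq_zero H.nondegenerate.ne_zero h4

/-- The dual matrices are the values, on matrix units, of a linear left inverse of the combination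
map of the independent `E k`. -/
theorem exists_dual : ∃ M : Fin p → Matrix (Fin n) (Fin n) ℝ,
    ∀ j k, ∑ a, ∑ b, M j a b * E k a b = if j = k then 1 else 0 := by
  obtain ⟨L, hL⟩ := LinearMap.exists_leftInverse_of_injective (Fintype.linearCombination ℝ E)
    (LinearMap.ker_eq_bot.2 H.linearIndependent.fintypeLinearCombination_injective)
  refine ⟨fun j => Matrix.of fun a b => L (Matrix.single a b 1) j, fun j k => ?_⟩
  have h1 := congrFun (LinearMap.congr_fun hL (Pi.single k 1)) j
  simp only [LinearMap.comp_apply, LinearMap.id_apply] at h1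
  have h2 : Fintype.linearCombination ℝ E (Pi.single k 1) = E k := by
    simp [Fintype.linearCombination_apply, Pi.single_apply]
  rw [h2] at h1
  rw [Matrix.matrix_eq_sum_single (E k)] at h1
  simp only [map_sum, Finset.sum_apply] at h1
  rw [Pi.single_apply] at h1
  rw [← h1]
  refine Finset.sum_congr rfl fun a _ => Finset.sum_congr rfl fun b _ => ?_
  have : Matrix.single a b (E k a b) = E k a b • Matrix.single a b (1 : ℝ) := by simp
  rw [this, map_smul]
  simp [mul_comm]

/-- Contracting the curvature coefficients with the dual matrices produces every basis vector, so
the curvature transformations span the holonomy algebra. Linear identities in `c` are therefore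
checked on them. -/
theorem curvCoef_single_induction {P : (Fin p → ℝ) → Prop} (h0 : P 0)
    (hr : ∀ a b, P (curvCoef E (Pi.single a 1) (Pi.single b 1)))
    (ha : ∀ c c', P c → P c' → P (c + c')) (hs : ∀ (t : ℝ) c, P c → P (t • c)) (c : Fin p → ℝ) :
    P c := by
  obtain ⟨M, hM⟩ := H.exists_dual
  have hsum : ∀ {ι : Type} (s : Finset ι) (f : ι → Fin p → ℝ), (∀ i ∈ s, P (f i)) →
      P (∑ i ∈ s, f i) := fun s f hf => Finset.sum_induction f P ha h0 hf
  have h1 : ∀ j : Fin p, (Pi.single j 1 : Fin p → ℝ) =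
      ∑ a, ∑ b, (-(M j a b)) • curvCoef E (Pi.single a 1) (Pi.single b 1) := by
    intro j
    ext k
    simp only [Finset.sum_apply, Pi.smul_apply, curvCoef_single, smul_eq_mul, neg_mul_neg, hM,
      Pi.single_apply, eq_comm]
  have h2 : c = ∑ j, c j • (Pi.single j 1 : Fin p → ℝ) := by
    ext k; simp [Finset.sum_apply, Pi.single_apply]
  rw [h2]
  refine hsum _ _ fun j _ => hs _ _ ?_
  rw [h1]
  exact hsum _ _ fun a _ => hsum _ _ fun b _ => hs _ _ (hr _ _)

theorem curvCoef_induction {P : (Fin p → ℝ) → Prop} (hr : ∀ u v, P (curvCoef E u v))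
    (ha : ∀ c c', P c → P c' → P (c + c')) (hs : ∀ (t : ℝ) c, P c → P (t • c)) (c : Fin p → ℝ) :
    P c := H.curvCoef_single_induction (by simpa using hs 0 _ (hr 0 0)) (fun _ _ => hr _ _) ha hs c

/-- Both sides are linear in `c`, and for a curvature transformation this is the field `invariant`.
-/
theorem lie_curv (c : Fin p → ℝ) (w z : Fin n → ℝ) :
    holMap β E c * holMap β E (curvCoef E w z) - holMap β E (curvCoef E w z) * holMap β E c
    = holMap β E (curvCoef E (holMap β E c *ᵥ w) z + curvCoef E w (holMap β E c *ᵥ z)) := by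
  refine H.curvCoef_induction (P := fun c => holMap β E c * holMap β E (curvCoef E w z)
    - holMap β E (curvCoef E w z) * holMap β E c
    = holMap β E (curvCoef E (holMap β E c *ᵥ w) z + curvCoef E w (holMap β E c *ᵥ z)))
    (fun u v => ?_) (fun c c' h1 h2 => ?_) (fun t c h1 => ?_) c
  · rw [H.invariant, map_add]
  · simp only [map_add, Matrix.add_mulVec, add_mul, mul_add, LinearMap.add_apply] at h1 h2 ⊢
    rw [add_sub_add_comm, h1, h2]; abel
  · simp only [map_smul, map_add, Matrix.smul_mulVec, smul_mul_assoc, mul_smul_comm,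
      LinearMap.smul_apply] at h1 ⊢
    rw [← smul_sub, h1, smul_add]

end IsHolonomy

/-- A linear left inverse of `holMap` (zero if there is none). -/
def holCoef (β : Matrix (Fin p) (Fin p) ℝ) (E : Fin p → Matrix (Fin n) (Fin n) ℝ) :
    Matrix (Fin n) (Fin n) ℝ →ₗ[ℝ] (Fin p → ℝ) :=
  open Classical in
  if h : ∃ L : Matrix (Fin n) (Fin n) ℝ →ₗ[ℝ] (Fin p → ℝ), L ∘ₗ holMap β E = LinearMap.id
  then h.choose else 0

/-- The commutator of the holonomy algebra in terms of coefficients. -/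
def holBr (β : Matrix (Fin p) (Fin p) ℝ) (E : Fin p → Matrix (Fin n) (Fin n) ℝ) :
    (Fin p → ℝ) →ₗ[ℝ] (Fin p → ℝ) →ₗ[ℝ] (Fin p → ℝ) :=
  LinearMap.mk₂ ℝ (fun c c' => holCoef β E (holMap β E c * holMap β E c'
      - holMap β E c' * holMap β E c))
    (fun _ _ _ => by
      rw [← map_add (holCoef β E), map_add (holMap β E), add_mul, mul_add]; congr 1; abel)
    (fun _ _ _ => by rw [← map_smul]; simp only [map_smul, smul_mul_assoc, mul_smul_comm, smul_sub])
    (fun _ _ _ => by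
      rw [← map_add (holCoef β E), map_add (holMap β E), add_mul, mul_add]; congr 1; abel)
    (fun _ _ _ => by rw [← map_smul]; simp only [map_smul, smul_mul_assoc, mul_smul_comm, smul_sub])

namespace IsHolonomy

variable (H : IsHolonomy β E)
include H

theorem holCoef_holMap (c : Fin p → ℝ) : holCoef β E (holMap β E c) = c := by
  have h : ∃ L : Matrix (Fin n) (Fin n) ℝ →ₗ[ℝ] (Fin p → ℝ), L ∘ₗ holMap β E = LinearMap.id :=
    LinearMap.exists_leftInverse_of_injective _ (LinearMap.ker_eq_bot.2 H.holMap_injective)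
  rw [holCoef, dif_pos h]
  exact LinearMap.congr_fun h.choose_spec c

/-- By `lie_curv` a commutator with a curvature transformation is again in the range of `holMap`,
where the left inverse `holCoef` is exact. -/
theorem holMap_holBr (c c' : Fin p → ℝ) : holMap β E (holBr β E c c') =
    holMap β E c * holMap β E c' - holMap β E c' * holMap β E c := by
  have h : ∃ x, holMap β E x = holMap β E c * holMap β E c' - holMap β E c' * holMap β E c := by
    refine H.curvCoef_induction (P := fun c' => ∃ x, holMap β E x =
      holMap β E c * holMap β E c' - holMap β E c' * holMap β E c) (fun w z => ?_)
      (fun a b ha hb => ?_) (fun t a ha => ?_) c'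
    · exact ⟨_, (H.lie_curv c w z).symm⟩
    · obtain ⟨x, hx⟩ := ha
      obtain ⟨y, hy⟩ := hb
      exact ⟨x + y, by rw [map_add, hx, hy, map_add, mul_add, add_mul]; abel⟩
    · obtain ⟨x, hx⟩ := ha
      exact ⟨t • x, by rw [map_smul, hx, map_smul, smul_sub, smul_mul_assoc, mul_smul_comm]⟩
  obtain ⟨x, hx⟩ := h
  change holMap β E (holCoef β E _) = _
  rw [← hx, H.holCoef_holMap]

theorem holBr_curvCoef (c : Fin p → ℝ) (w z : Fin n → ℝ) :
    holBr β E c (curvCoef E w z) =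
      curvCoef E (holMap β E c *ᵥ w) z + curvCoef E w (holMap β E c *ᵥ z) :=
  H.holMap_injective (by rw [H.holMap_holBr, H.lie_curv])

theorem holBr_antisymm (c c' : Fin p → ℝ) : holBr β E c c' = - holBr β E c' c :=
  H.holMap_injective (by rw [map_neg, H.holMap_holBr, H.holMap_holBr]; abel)

theorem curvCoef_antisymm (u v : Fin n → ℝ) : curvCoef E u v = - curvCoef E v u := by
  ext k
  have : u ⬝ᵥ E k *ᵥ v = - (v ⬝ᵥ E k *ᵥ u) := by
    rw [Matrix.dotProduct_mulVec, ← Matrix.mulVec_transpose, H.antisymm, Matrix.neg_mulVec,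
      neg_dotProduct, dotProduct_comm]
  simp [curvCoef_apply, this]

theorem holMap_dot (c : Fin p → ℝ) (u v : Fin n → ℝ) :
    u ⬝ᵥ (holMap β E c *ᵥ v) = - ((holMap β E c *ᵥ u) ⬝ᵥ v) := by
  rw [Matrix.dotProduct_mulVec, ← Matrix.mulVec_transpose, H.holMap_transpose, Matrix.neg_mulVec,
      neg_dotProduct]

theorem holForm_symm (c c' : Fin p → ℝ) : holForm β c c' = holForm β c' c := by
  rw [holForm_apply, holForm_apply, Matrix.dotProduct_mulVec, ← Matrix.mulVec_transpose,
    H.symm, dotProduct_comm]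

/-- The factor β built into `holGen` is the one of the form, so β(R(u,v), c) is the two-form of D(c)
evaluated at (u,v). -/
theorem holForm_curvCoef (u v : Fin n → ℝ) (c : Fin p → ℝ) :
    holForm β (curvCoef E u v) c = u ⬝ᵥ (holMap β E c *ᵥ v) := by
  rw [holForm_symm H, holForm_apply]
  have h1 : u ⬝ᵥ (holMap β E c *ᵥ v) = ∑ i, c i * (∑ k, β i k * -(u ⬝ᵥ E k *ᵥ v)) := by
    simp only [holMap_apply, holGen, Matrix.sum_mulVec, Matrix.smul_mulVec, Matrix.neg_mulVec,
      dotProduct_sum, dotProduct_smul, dotProduct_neg, smul_eq_mul, mul_neg,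
      Finset.sum_neg_distrib, Finset.mul_sum]
  rw [h1]
  rfl

/-- Ad-invariance of β. For a curvature transformation in the second slot of the bracket it is the
antisymmetry of D(a), by `holBr_curvCoef` and `holForm_curvCoef`. -/
theorem holForm_holBr (a b c : Fin p → ℝ) :
    holForm β (holBr β E a b) c = - holForm β b (holBr β E a c) := by
  refine H.curvCoef_induction (P := fun b => holForm β (holBr β E a b) c =
    - holForm β b (holBr β E a c)) (fun u v => ?_) (fun x x' h1 h2 => ?_) (fun t x h1 => ?_) b
  · rw [H.holBr_curvCoef, map_add, LinearMap.add_apply, H.holForm_curvCoef, H.holForm_curvCoef,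
      H.holForm_curvCoef, H.holMap_holBr, Matrix.sub_mulVec, ← Matrix.mulVec_mulVec,
      ← Matrix.mulVec_mulVec, dotProduct_sub, H.holMap_dot a u]
    ring
  · simp only [map_add, LinearMap.add_apply, h1, h2]; ring
  · simp only [map_smul, LinearMap.smul_apply, h1, smul_neg]

theorem bianchi_vec (u v w : Fin n → ℝ) :
    holMap β E (curvCoef E u v) *ᵥ w + holMap β E (curvCoef E v w) *ᵥ u
      + holMap β E (curvCoef E w u) *ᵥ v = 0 := by
  have key : ∀ u v w : Fin n → ℝ, ∀ a, (holMap β E (curvCoef E u v) *ᵥ w) a =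
      ∑ b, ∑ c, ∑ d, curv β E a b c d * u c * v d * w b := by
    intro u v w a
    simp only [Matrix.mulVec, dotProduct, curv_sum H.symm, Finset.sum_mul]
  ext a
  simp only [Pi.add_apply, key, Pi.zero_apply]
  have e2 : ∑ b, ∑ c, ∑ d, curv β E a b c d * v c * w d * u b =
      ∑ b, ∑ c, ∑ d, curv β E a c d b * u c * v d * w b := by
    exact (sum_rot fun b c d => curv β E a b c d * v c * w d * u b).trans
      (Finset.sum_congr rfl fun b _ =>
        Finset.sum_congr rfl fun c _ => Finset.sum_congr rfl fun d _ => by ring)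
  have e3 : ∑ b, ∑ c, ∑ d, curv β E a b c d * w c * u d * v b =
      ∑ b, ∑ c, ∑ d, curv β E a d b c * u c * v d * w b := by
    exact ((sum_rot fun b c d => curv β E a b c d * w c * u d * v b).trans
      (sum_rot fun b c d => curv β E a c d b * w d * u b * v c)).trans
      (Finset.sum_congr rfl fun b _ =>
        Finset.sum_congr rfl fun c _ => Finset.sum_congr rfl fun d _ => by ring)
  rw [e2, e3]
  simp only [← Finset.sum_add_distrib]
  refine Finset.sum_eq_zero fun b _ => Finset.sum_eq_zero fun c _ => Finset.sum_eq_zero fun d _ => ?_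
  have := H.bianchi a b c d
  linear_combination (u c * v d * w b) * this

end IsHolonomy

end Algebra

end SymSpace

namespace SymSpace

/-! ### Casimir elements of the holonomy algebra and the Ricci tensor -/

section Casimir

variable {n p : ℕ} {β : Matrix (Fin p) (Fin p) ℝ} {E : Fin p → Matrix (Fin n) (Fin n) ℝ}

variable (β E) in
/-- The Casimir matrix `β^{ij} D_i D_j` of the holonomy algebra. -/
def casMatrix : Matrix (Fin n) (Fin n) ℝ :=
  ∑ i, ∑ j, β⁻¹ i j • (holGen β E i * holGen β E j)

theorem curv_pair_symm (hβ : β.IsSymm) (a b c d : Fin n) :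
    curv β E a b c d = curv β E c d a b := by
  rw [curv, curv, Finset.sum_comm]
  exact Finset.sum_congr rfl fun i _ => Finset.sum_congr rfl fun k _ => by
    rw [hβ.apply i k]; ring

namespace IsHolonomy

variable (H : IsHolonomy β E)
include H

theorem inv_symm (i j : Fin p) : β⁻¹ i j = β⁻¹ j i := by
  have : (β⁻¹)ᵀ = β⁻¹ := by rw [Matrix.transpose_nonsing_inv, H.symm]
  exact congrFun (congrFun this j) i |>.symm ▸ rfl

theorem curv_antisymm_left (a b c d : Fin n) : curv β E a b c d = - curv β E b a c d := by
  simp only [curv, ← Finset.sum_neg_distrib]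
  refine Finset.sum_congr rfl fun i _ => Finset.sum_congr rfl fun k _ => ?_
  have := congrFun (congrFun (H.antisymm i) b) a
  simp only [Matrix.transpose_apply, Matrix.neg_apply] at this
  rw [this]; ring

theorem curv_antisymm_right (a b c d : Fin n) : curv β E a b c d = - curv β E a b d c := by
  rw [curv_pair_symm H.symm, H.curv_antisymm_left, curv_pair_symm H.symm]

theorem sum_inv_holGen (i : Fin p) : ∑ j, β⁻¹ i j • holGen β E j = - E i := by
  simp only [holGen, smul_neg, Finset.sum_neg_distrib, Finset.smul_sum, smul_smul]
  rw [Finset.sum_comm]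
  simp only [← Finset.sum_smul]
  have : ∀ l, ∑ j, β⁻¹ i j * β j l = (1 : Matrix (Fin p) (Fin p) ℝ) i l := by
    intro l; rw [← Matrix.nonsing_inv_mul β H.nondegenerate]; rfl
  simp [this, Matrix.one_apply]

theorem coef_eq (x : Fin p → ℝ) (i : Fin p) :
    x i = ∑ j, β⁻¹ i j * holForm β x (Pi.single j 1) := by
  have h : ∀ j, holForm β x (Pi.single j 1) = (β *ᵥ x) j := by
    intro j
    rw [H.holForm_symm, holForm_apply]
    simp
  simp only [h]
  have : x = β⁻¹ *ᵥ (β *ᵥ x) := by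
    rw [Matrix.mulVec_mulVec, Matrix.nonsing_inv_mul β H.nondegenerate, Matrix.one_mulVec]
  conv_lhs => rw [this]
  rfl

/-- The tensor `β^{ij} D_i ⊗ D_j` is invariant under the adjoint action. -/
theorem casimir_invariant {W : Type*} [AddCommGroup W] [Module ℝ W]
    (T : (Fin p → ℝ) →ₗ[ℝ] (Fin p → ℝ) →ₗ[ℝ] W) (a : Fin p → ℝ) :
    ∑ i, ∑ j, β⁻¹ i j • (T (holBr β E a (Pi.single i 1)) (Pi.single j 1)
      + T (Pi.single i 1) (holBr β E a (Pi.single j 1))) = 0 := by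
  set m : Matrix (Fin p) (Fin p) ℝ := Matrix.of fun k i => holBr β E a (Pi.single i 1) k with hm
  have hbr : ∀ i, holBr β E a (Pi.single i 1) = ∑ k, m k i • (Pi.single k 1 : Fin p → ℝ) := by
    intro i; ext k; simp [hm, Finset.sum_apply, Pi.single_apply]
  have h1 : mᵀ * β + β * m = 0 := by
    ext i j
    have := H.holForm_holBr a (Pi.single i 1) (Pi.single j 1)
    rw [holForm_apply, holForm_apply] at this
    simp only [Matrix.add_apply, Matrix.zero_apply]
    have e1 : (mᵀ * β) i j = holBr β E a (Pi.single i 1) ⬝ᵥ β *ᵥ Pi.single j 1 := by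
      simp [Matrix.mul_apply, hm, dotProduct]
    have e2 : (β * m) i j = Pi.single i 1 ⬝ᵥ β *ᵥ holBr β E a (Pi.single j 1) := by
      rw [single_one_dotProduct]; rfl
    rw [e1, e2, this]; ring
  -- `m` is the matrix of ad(a), skew for β. Multiplying by β⁻¹ on both sides makes it skew for β⁻¹,
  -- which is the claim in coordinates.
  have h2 : m * β⁻¹ + β⁻¹ * mᵀ = 0 := by
    have : β⁻¹ * (mᵀ * β + β * m) * β⁻¹ = 0 := by rw [h1]; simp
    rw [mul_add, add_mul, mul_assoc, mul_assoc, Matrix.mul_nonsing_inv β H.nondegenerate,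
      ← mul_assoc β⁻¹ β m, Matrix.nonsing_inv_mul β H.nondegenerate, mul_one, one_mul] at this
    rw [add_comm]; exact this
  simp only [hbr, map_sum, map_smul, LinearMap.sum_apply, LinearMap.smul_apply, smul_add,
    Finset.sum_add_distrib, Finset.smul_sum, smul_smul]
  set t : Fin p → Fin p → W := fun i j => T (Pi.single i 1) (Pi.single j 1) with ht
  have e1 : ∑ i, ∑ j, ∑ k, (β⁻¹ i j * m k i) • t k j = ∑ k, ∑ j, (m * β⁻¹) k j • t k j := by
    rw [sum_rot]
    refine Finset.sum_congr rfl fun k _ => ?_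
    rw [Finset.sum_comm]
    refine Finset.sum_congr rfl fun j _ => ?_
    rw [Matrix.mul_apply, Finset.sum_smul]
    exact Finset.sum_congr rfl fun i _ => by rw [mul_comm]
  have e2 : ∑ i, ∑ j, ∑ k, (β⁻¹ i j * m k j) • t i k = ∑ k, ∑ j, (β⁻¹ * mᵀ) k j • t k j := by
    refine Finset.sum_congr rfl fun i _ => ?_
    rw [Finset.sum_comm]
    refine Finset.sum_congr rfl fun k _ => ?_
    rw [Matrix.mul_apply, Finset.sum_smul]
    rfl
  rw [e1, e2]
  simp only [← Finset.sum_add_distrib, ← add_smul, ← Matrix.add_apply, h2]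
  simp

/-- Since D_i contains β, the tensor β^{ij} D_i ⊗ D_j equals β_{ik} E^i ⊗ E^k, which is the
curvature. With `A = 1` it shows that `casMatrix` is minus the Ricci tensor R^c_{acb}. -/
theorem casimir_insert (A : Matrix (Fin n) (Fin n) ℝ) (a b : Fin n) :
    (∑ i, ∑ j, β⁻¹ i j • (holGen β E i * A * holGen β E j)) a b =
      ∑ c, ∑ d, curv β E a c d b * A c d := by
  have h1 : ∑ i, ∑ j, β⁻¹ i j • (holGen β E i * A * holGen β E j) =
      ∑ i, ∑ k, β k i • (E k * A * E i) := by
    refine Finset.sum_congr rfl fun i _ => ?_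
    have : ∑ j, β⁻¹ i j • (holGen β E i * A * holGen β E j) =
        holGen β E i * A * ∑ j, β⁻¹ i j • holGen β E j := by
      simp [Finset.mul_sum]
    rw [this, H.sum_inv_holGen, holGen]
    simp [Finset.sum_mul, H.symm.apply]
  rw [h1]
  simp only [Matrix.sum_apply, Matrix.smul_apply, Matrix.mul_apply, curv, smul_eq_mul,
    Finset.sum_mul, Finset.mul_sum]
  rw [sum_pair_comm, Finset.sum_comm]
  refine Finset.sum_congr rfl fun c _ => Finset.sum_congr rfl fun d _ => ?_
  rw [Finset.sum_comm]
  exact Finset.sum_congr rfl fun i _ => Finset.sum_congr rfl fun k _ => by ring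

/-- For antisymmetric `A` two of the three terms of the contracted Bianchi identity agree; hence the
factor one half. -/
theorem casimir_insert_antisymm {A : Matrix (Fin n) (Fin n) ℝ} (hA : Aᵀ = -A) (a b : Fin n) :
    (∑ i, ∑ j, β⁻¹ i j • (holGen β E i * A * holGen β E j)) a b =
      -(1 / 2) * ∑ c, ∑ d, curv β E a b c d * A c d := by
  rw [H.casimir_insert]
  have hA' : ∀ c d, A d c = - A c d := fun c d => congrFun (congrFun hA c) d
  have h1 : ∑ c, ∑ d, curv β E a c d b * A c d = ∑ c, ∑ d, curv β E a d b c * A c d := by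
    rw [Finset.sum_comm]
    refine Finset.sum_congr rfl fun c _ => Finset.sum_congr rfl fun d _ => ?_
    rw [hA' c d, H.curv_antisymm_right a d c b]; ring
  have h2 : ∑ c, ∑ d, curv β E a b c d * A c d + ∑ c, ∑ d, curv β E a c d b * A c d
      + ∑ c, ∑ d, curv β E a d b c * A c d = 0 := by
    simp only [← Finset.sum_add_distrib, ← add_mul, H.bianchi]
    simp
  linarith

theorem casMatrix_comm (a : Fin p → ℝ) :
    holMap β E a * casMatrix β E = casMatrix β E * holMap β E a := by
  have h := H.casimir_invariant
    (((LinearMap.mul ℝ (Matrix (Fin n) (Fin n) ℝ)).compl₁₂ (holMap β E) (holMap β E))) a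
  simp only [LinearMap.compl₁₂_apply, LinearMap.mul_apply', H.holMap_holBr, holMap_single] at h
  rw [← sub_eq_zero, ← h]
  simp only [casMatrix, Finset.mul_sum, Finset.sum_mul, ← Finset.sum_sub_distrib]
  refine Finset.sum_congr rfl fun i _ => Finset.sum_congr rfl fun j _ => ?_
  rw [mul_smul_comm, smul_mul_assoc, ← smul_sub]
  congr 1
  noncomm_ring

theorem casMatrix_transpose : (casMatrix β E)ᵀ = casMatrix β E := by
  simp only [casMatrix, Matrix.transpose_sum, Matrix.transpose_smul, Matrix.transpose_mul,
    H.holGen_transpose]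
  rw [Finset.sum_comm]
  exact Finset.sum_congr rfl fun i _ => Finset.sum_congr rfl fun j _ => by
    rw [H.inv_symm]; simp

/-- The Killing form of the transvection algebra on a curvature transformation. -/
theorem trace_curv_add (x y : Fin n → ℝ) (a : Fin p → ℝ) :
    (holMap β E (curvCoef E x y) * holMap β E a).trace
      + ∑ i, holBr β E (curvCoef E x y) (holBr β E a (Pi.single i 1)) i
    = 2 * (x ⬝ᵥ (casMatrix β E * holMap β E a) *ᵥ y) := by
  -- The trace over the algebra is written with β and β⁻¹; invariance of β then moves R(x,y) out of
  -- the bracket, where `holForm_curvCoef` evaluates it.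
  have h1 : ∑ i, holBr β E (curvCoef E x y) (holBr β E a (Pi.single i 1)) i =
      x ⬝ᵥ (∑ i, ∑ j, β⁻¹ i j • holMap β E (holBr β E (holBr β E a (Pi.single i 1))
        (Pi.single j 1))) *ᵥ y := by
    simp only [Matrix.sum_mulVec, Matrix.smul_mulVec, dotProduct_sum, dotProduct_smul]
    refine Finset.sum_congr rfl fun i _ => ?_
    refine (H.coef_eq _ i).trans (Finset.sum_congr rfl fun j _ => ?_)
    rw [smul_eq_mul, H.holBr_antisymm, map_neg, LinearMap.neg_apply, H.holForm_holBr, neg_neg,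
      H.holForm_curvCoef]
  have h2 : ∑ i, ∑ j, β⁻¹ i j • holMap β E (holBr β E (holBr β E a (Pi.single i 1))
        (Pi.single j 1)) = (2 : ℝ) • (casMatrix β E * holMap β E a)
        - (2 : ℝ) • ∑ i, ∑ j, β⁻¹ i j • (holGen β E i * holMap β E a * holGen β E j) := by
    have e1 : ∀ i j, holMap β E (holBr β E (holBr β E a (Pi.single i 1)) (Pi.single j 1)) =
        holMap β E a * (holGen β E i * holGen β E j) + (holGen β E j * holGen β E i) * holMap β E a
        - holGen β E i * holMap β E a * holGen β E j
        - holGen β E j * holMap β E a * holGen β E i := by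
      intro i j
      simp only [H.holMap_holBr, holMap_single]
      noncomm_ring
    have e2 : ∀ f : Fin p → Fin p → Matrix (Fin n) (Fin n) ℝ,
        ∑ i, ∑ j, β⁻¹ i j • f j i = ∑ i, ∑ j, β⁻¹ i j • f i j := by
      intro f
      rw [Finset.sum_comm]
      exact Finset.sum_congr rfl fun i _ => Finset.sum_congr rfl fun j _ => by rw [H.inv_symm]
    simp only [e1, smul_add, smul_sub, Finset.sum_add_distrib, Finset.sum_sub_distrib]
    rw [e2 fun i j => holGen β E i * holMap β E a * holGen β E j,
      e2 fun i j => (holGen β E i * holGen β E j) * holMap β E a]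
    have e3 : ∑ i, ∑ j, β⁻¹ i j • (holMap β E a * (holGen β E i * holGen β E j)) =
        casMatrix β E * holMap β E a := by
      rw [← H.casMatrix_comm a]; simp [casMatrix, Finset.mul_sum]
    have e4 : ∑ i, ∑ j, β⁻¹ i j • ((holGen β E i * holGen β E j) * holMap β E a) =
        casMatrix β E * holMap β E a := by
      simp [casMatrix, Finset.sum_mul]
    rw [e3, e4, two_smul, two_smul]
    abel
  -- By the Bianchi identity the sandwiched Casimir term is half of tr(R(x,y) D(a)); with its factor
  -- 2 it cancels the first trace of the statement.
  have h3 : x ⬝ᵥ (∑ i, ∑ j, β⁻¹ i j • (holGen β E i * holMap β E a * holGen β E j)) *ᵥ y =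
      (1 / 2) * (holMap β E (curvCoef E x y) * holMap β E a).trace := by
    have e1 : (holMap β E (curvCoef E x y) * holMap β E a).trace =
        - ∑ c, ∑ d, (∑ r, ∑ s, curv β E r s c d * holMap β E a r s) * x c * y d := by
      have ht : ∀ r s, holMap β E a s r = - holMap β E a r s := fun r s =>
        congrFun (congrFun (H.holMap_transpose a) r) s
      simp only [Matrix.trace, Matrix.diag, Matrix.mul_apply, curv_sum H.symm, Finset.sum_mul]
      rw [sum_pair_comm, ← Finset.sum_neg_distrib]
      refine Finset.sum_congr rfl fun c _ => ?_
      rw [← Finset.sum_neg_distrib]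
      refine Finset.sum_congr rfl fun d _ => ?_
      rw [← Finset.sum_neg_distrib]
      refine Finset.sum_congr rfl fun r _ => ?_
      rw [← Finset.sum_neg_distrib]
      refine Finset.sum_congr rfl fun s _ => ?_
      rw [ht r s]; ring
    rw [e1]
    simp only [dotProduct, Matrix.mulVec, H.casimir_insert_antisymm (H.holMap_transpose a),
      Finset.mul_sum, ← Finset.sum_neg_distrib]
    refine Finset.sum_congr rfl fun c _ => Finset.sum_congr rfl fun d _ => ?_
    simp only [Finset.sum_mul, Finset.mul_sum, ← Finset.sum_neg_distrib]
    refine Finset.sum_congr rfl fun r _ => Finset.sum_congr rfl fun s _ => ?_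
    rw [curv_pair_symm H.symm c d r s]; ring
  rw [h1, h2, Matrix.sub_mulVec, dotProduct_sub, Matrix.smul_mulVec, Matrix.smul_mulVec,
    dotProduct_smul, dotProduct_smul, h3]
  simp only [smul_eq_mul]
  ring

end IsHolonomy

end Casimir

end SymSpace

namespace SymSpace

/-! ### The flat subspace and the two-forms compatible with the curvature -/

section FlatPart

variable {n p : ℕ} {β : Matrix (Fin p) (Fin p) ℝ} {E : Fin p → Matrix (Fin n) (Fin n) ℝ}

/-- `m` is skew for the inner product `T`, so tr m² = -tr((Nm) T⁻¹ (Nm)ᵀ), the trace of a negative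
semidefinite matrix. -/
theorem trace_sq_nonpos {T m : Matrix (Fin p) (Fin p) ℝ} {N : Matrix (Fin n × Fin n) (Fin p) ℝ}
    (hN : T = Nᵀ * N) (hT : T.PosDef) (hm : mᵀ * T + T * m = 0) : (m * m).trace ≤ 0 := by
  have hu : IsUnit T.det := (Matrix.isUnit_iff_isUnit_det _).1 hT.isUnit
  have h1 : m = -(T⁻¹ * (mᵀ * T)) := by
    have : T⁻¹ * (mᵀ * T + T * m) = 0 := by rw [hm, mul_zero]
    rw [mul_add, ← mul_assoc T⁻¹ T m, Matrix.nonsing_inv_mul T hu, one_mul] at this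
    exact eq_neg_of_add_eq_zero_right this
  have h2 : (m * m).trace = -((N * m) * T⁻¹ * (N * m)ᵀ).trace := by
    have : m * m = -((T⁻¹ * (N * m)ᵀ) * (N * m)) := by
      refine (congrArg (· * m) h1).trans ?_
      simp only [hN, Matrix.transpose_mul, Matrix.mul_assoc, neg_mul]
    rw [this, Matrix.trace_neg, Matrix.trace_mul_comm]
    simp only [Matrix.mul_assoc]
  have h3 : ((N * m) * T⁻¹ * (N * m)ᵀ).PosSemidef := by
    have := hT.posSemidef.inv.mul_mul_conjTranspose_same (N * m)
    rwa [Matrix.conjTranspose_eq_transpose_of_trivial] at this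
  rw [h2]
  linarith [h3.trace_nonneg]

theorem sum_mul_eq_trace (A B : Matrix (Fin n) (Fin n) ℝ) :
    ∑ a, ∑ b, A a b * B a b = (Aᵀ * B).trace := by
  simp only [Matrix.trace, Matrix.diag, Matrix.mul_apply, Matrix.transpose_apply]
  exact Finset.sum_comm

theorem eq_zero_of_trace {A : Matrix (Fin n) (Fin n) ℝ} (h : (Aᵀ * A).trace = 0) : A = 0 := by
  have := (Matrix.trace_conjTranspose_mul_self_eq_zero_iff (A := A)).1
  rw [Matrix.conjTranspose_eq_transpose_of_trivial] at this
  exact this h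

variable (β E) in
/-- The generators of the holonomy algebra as the columns of a matrix. -/
def holColumns : Matrix (Fin n × Fin n) (Fin p) ℝ := Matrix.of fun x k => holGen β E k x.1 x.2

theorem holColumns_mulVec (c : Fin p → ℝ) (x : Fin n × Fin n) :
    (holColumns β E *ᵥ c) x = holMap β E c x.1 x.2 := by
  simp [holColumns, Matrix.mulVec, dotProduct, holMap_apply, Matrix.sum_apply, mul_comm]

variable (β E) in
/-- The Gram matrix of the generators of the holonomy algebra. -/
def holGram : Matrix (Fin p) (Fin p) ℝ := (holColumns β E)ᵀ * holColumns β E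

theorem holGram_dot (c c' : Fin p → ℝ) :
    c ⬝ᵥ holGram β E *ᵥ c' = ((holMap β E c)ᵀ * holMap β E c').trace := by
  rw [holGram, ← Matrix.mulVec_mulVec, Matrix.dotProduct_mulVec, ← Matrix.mulVec_transpose,
    Matrix.transpose_transpose, ← sum_mul_eq_trace]
  simp only [dotProduct, Fintype.sum_prod_type, holColumns_mulVec]

variable (β E) in
/-- The projection onto the flat subspace as a matrix. -/
def flatProj : Matrix (Fin n) (Fin n) ℝ := Matrix.of (projFlat β E)

theorem mem_flatSubspace {x : Coord n} :
    x ∈ flatSubspace β E ↔ ∀ i, holGen β E i *ᵥ x.ofLp = 0 := by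
  simp [flatSubspace, Submodule.mem_iInf, Matrix.toLpLin_apply]

theorem starProjection_flat (x : Coord n) :
    ((flatSubspace β E).starProjection x).ofLp = flatProj β E *ᵥ x.ofLp := by
  have h : x = ∑ b, x b • EuclideanSpace.single b (1 : ℝ) := by
    ext i; simp [Finset.sum_apply, Pi.single_apply]
  conv_lhs => rw [h]
  ext a
  simp [Matrix.mulVec, dotProduct, flatProj, projFlat, Finset.sum_apply, mul_comm]

theorem holGen_mul_flatProj (i : Fin p) : holGen β E i * flatProj β E = 0 := by
  ext a b
  have := mem_flatSubspace.1 ((flatSubspace β E).starProjection_apply_mem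
    (EuclideanSpace.single b (1 : ℝ))) i
  exact congrFun this a

theorem flatProj_transpose : (flatProj β E)ᵀ = flatProj β E := by
  ext a b
  have := (flatSubspace β E).inner_starProjection_left_eq_right
    (EuclideanSpace.single a (1 : ℝ)) (EuclideanSpace.single b (1 : ℝ))
  simpa [flatProj, projFlat, EuclideanSpace.inner_single_left, EuclideanSpace.inner_single_right]
    using this

theorem flatProj_mulVec {v : Fin n → ℝ} (hv : ∀ i, holGen β E i *ᵥ v = 0) :
    flatProj β E *ᵥ v = v := by
  have h := (Submodule.starProjection_eq_self_iff (K := flatSubspace β E)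
    (v := WithLp.toLp 2 v)).2 (mem_flatSubspace.2 hv)
  have h2 := starProjection_flat (β := β) (E := E) (WithLp.toLp 2 v)
  rw [h] at h2
  exact h2.symm

theorem flatProj_mul {A : Matrix (Fin n) (Fin n) ℝ} (hA : ∀ i, holGen β E i * A = 0) :
    flatProj β E * A = A := by
  ext a b
  have := flatProj_mulVec (β := β) (E := E) (v := fun r => A r b)
    (fun i => funext fun r => congrFun (congrFun (hA i) r) b)
  exact congrFun this a

theorem flatProj_idem : flatProj β E * flatProj β E = flatProj β E :=
  flatProj_mul holGen_mul_flatProj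

theorem holMap_mul_flatProj (c : Fin p → ℝ) : holMap β E c * flatProj β E = 0 := by
  simp [holMap_apply, Finset.sum_mul, holGen_mul_flatProj]

namespace IsHolonomy

variable (H : IsHolonomy β E)
include H

theorem flatProj_mul_holMap (c : Fin p → ℝ) : flatProj β E * holMap β E c = 0 := by
  have := congrArg Matrix.transpose (holMap_mul_flatProj (β := β) (E := E) c)
  rw [Matrix.transpose_mul, H.holMap_transpose, flatProj_transpose] at this
  simpa using this

theorem holGram_posDef : (holGram β E).PosDef := by
  have h := Matrix.PosDef.conjTranspose_mul_self (holColumns β E) (by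
    intro c c' h
    refine H.holMap_injective ?_
    ext a b
    rw [← holColumns_mulVec c (a, b), ← holColumns_mulVec c' (a, b)]
    exact congrFun h (a, b))
  rwa [Matrix.conjTranspose_eq_transpose_of_trivial] at h

omit H in
theorem holGen_mulVec_eq_zero (x : Fin n → ℝ) (h : ∀ k, E k *ᵥ x = 0) (i : Fin p) :
    holGen β E i *ᵥ x = 0 := by
  simp [holGen, Matrix.neg_mulVec, Matrix.sum_mulVec, Matrix.smul_mulVec, h]

/-- A vector in the kernel of the Ricci tensor is annihilated by the holonomy algebra. -/
theorem holGen_mulVec_of_casMatrix {x : Fin n → ℝ} (hx : casMatrix β E *ᵥ x = 0) (i : Fin p) :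
    holGen β E i *ᵥ x = 0 := by
  -- For c = R(x,y) the right side of `trace_curv_add` with a = c vanishes, because `casMatrix` is
  -- symmetric and kills `x`. Both traces on the left are nonpositive: D(c) is antisymmetric, and
  -- ad(c) is skew for the Gram form tr(DᵀD). Hence tr D(c)² = 0 and c = 0.
  have key : ∀ y : Fin n → ℝ, curvCoef E x y = 0 := by
    intro y
    set c := curvCoef E x y with hc
    set m : Matrix (Fin p) (Fin p) ℝ := Matrix.of fun k i => holBr β E c (Pi.single i 1) k with hm
    have hbr : ∀ v, holBr β E c v = m *ᵥ v := by
      intro v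
      have : v = ∑ k, v k • (Pi.single k 1 : Fin p → ℝ) := by
        ext k; simp [Finset.sum_apply, Pi.single_apply]
      conv_lhs => rw [this]
      ext k
      simp [hm, Matrix.mulVec, dotProduct, Finset.sum_apply, mul_comm]
    have h1 := H.trace_curv_add x y c
    rw [← hc] at h1
    have h2 : x ⬝ᵥ (casMatrix β E * holMap β E c) *ᵥ y = 0 := by
      rw [← Matrix.mulVec_mulVec, Matrix.dotProduct_mulVec, ← Matrix.mulVec_transpose,
        H.casMatrix_transpose, hx, zero_dotProduct]
    have h3 : ∑ i, holBr β E c (holBr β E c (Pi.single i 1)) i = (m * m).trace := by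
      simp only [Matrix.trace, Matrix.diag]
      refine Finset.sum_congr rfl fun i _ => ?_
      rw [hbr, hbr, Matrix.mulVec_mulVec]
      simp
    have h4 : (m * m).trace ≤ 0 := by
      refine trace_sq_nonpos (T := holGram β E) rfl H.holGram_posDef ?_
      have e : ∀ u v, (u : Fin p → ℝ) ⬝ᵥ (mᵀ * holGram β E + holGram β E * m) *ᵥ v = 0 := by
        intro u v
        rw [Matrix.add_mulVec, dotProduct_add, ← Matrix.mulVec_mulVec, ← Matrix.mulVec_mulVec,
          Matrix.dotProduct_mulVec _ mᵀ, Matrix.vecMul_transpose, holGram_dot, ← hbr, ← hbr,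
          holGram_dot, H.holMap_holBr, H.holMap_holBr]
        simp only [Matrix.transpose_sub, Matrix.transpose_mul, H.holMap_transpose,
          sub_mul, mul_sub, Matrix.trace_sub, neg_mul, mul_neg, Matrix.trace_neg, ← mul_assoc]
        rw [Matrix.trace_mul_cycle (holMap β E u) (holMap β E v) (holMap β E c)]
        ring
      ext i j
      simpa using e (Pi.single i 1) (Pi.single j 1)
    have h5 : (holMap β E c * holMap β E c).trace = 
        - ((holMap β E c)ᵀ * holMap β E c).trace := by
      rw [H.holMap_transpose, neg_mul, Matrix.trace_neg, neg_neg]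
    have h6 : 0 ≤ ((holMap β E c)ᵀ * holMap β E c).trace := by
      rw [← sum_mul_eq_trace]
      exact Finset.sum_nonneg fun _ _ => Finset.sum_nonneg fun _ _ => mul_self_nonneg _
    have h7 : ((holMap β E c)ᵀ * holMap β E c).trace = 0 := by
      rw [h2, h3, h5] at h1; linarith
    have h8 := eq_zero_of_trace h7
    exact H.holMap_injective (by rw [h8, map_zero])
  refine holGen_mulVec_eq_zero x (fun k => ?_) i
  ext a
  have := congrFun (key (Pi.single a 1)) k
  rw [H.curvCoef_antisymm] at this
  simpa [curvCoef_apply] using this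

theorem gen_eq (k : Fin p) : E k = holMap β E (fun j => - β⁻¹ k j) := by
  simp [holMap_apply, H.sum_inv_holGen]

/-- By `gen_eq` the matrices `E k` themselves lie in the holonomy algebra, which q annihilates. -/
theorem curvCoef_flatProj (u v : Fin n → ℝ) : curvCoef E (flatProj β E *ᵥ u) v = 0 := by
  ext k
  have h1 : flatProj β E * E k = 0 := by rw [H.gen_eq, H.flatProj_mul_holMap]
  rw [curvCoef_apply, ← flatProj_transpose, ← Matrix.vecMul_transpose, Matrix.transpose_transpose,
    ← Matrix.dotProduct_mulVec, Matrix.mulVec_mulVec, h1]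
  simp

theorem sum_curvCoef (Z : Matrix (Fin n) (Fin n) ℝ)
    (hZ : ∀ c, (Zᵀ * holMap β E c).trace = 0) :
    ∑ a, ∑ b, Z a b • curvCoef E (Pi.single a 1) (Pi.single b 1) = 0 := by
  ext k
  simp only [Finset.sum_apply, Pi.smul_apply, curvCoef_single, smul_eq_mul, mul_neg,
    Finset.sum_neg_distrib, Pi.zero_apply]
  rw [sum_mul_eq_trace, H.gen_eq, hZ, neg_zero]

/-! ### Two-forms whose commutators with the curvature are odd under exchange of index pairs -/

section Parallel

variable {f : Matrix (Fin n) (Fin n) ℝ}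
  (hf : ∀ a b c d,
    (f * holMap β E (curvCoef E (Pi.single c 1) (Pi.single d 1))
      - holMap β E (curvCoef E (Pi.single c 1) (Pi.single d 1)) * f) a b
    + (f * holMap β E (curvCoef E (Pi.single a 1) (Pi.single b 1))
      - holMap β E (curvCoef E (Pi.single a 1) (Pi.single b 1)) * f) c d = 0)
include hf

omit H in
-- `hf` exchanges the free index pair with the pair of the curvature, so a contraction of the
-- commutator over its matrix indices becomes a commutator with the contracted curvature.
theorem contract_parallel (Z : Matrix (Fin n) (Fin n) ℝ) (c d : Fin n) :
    ∑ a, ∑ b, Z a b * (f * holMap β E (curvCoef E (Pi.single c 1) (Pi.single d 1))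
      - holMap β E (curvCoef E (Pi.single c 1) (Pi.single d 1)) * f) a b
    = - (f * holMap β E (∑ a, ∑ b, Z a b • curvCoef E (Pi.single a 1) (Pi.single b 1))
      - holMap β E (∑ a, ∑ b, Z a b • curvCoef E (Pi.single a 1) (Pi.single b 1)) * f) c d := by
  have h1 : f * holMap β E (∑ a, ∑ b, Z a b • curvCoef E (Pi.single a 1) (Pi.single b 1))
      - holMap β E (∑ a, ∑ b, Z a b • curvCoef E (Pi.single a 1) (Pi.single b 1)) * f
      = ∑ a, ∑ b, Z a b • (f * holMap β E (curvCoef E (Pi.single a 1) (Pi.single b 1))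
      - holMap β E (curvCoef E (Pi.single a 1) (Pi.single b 1)) * f) := by
    simp only [map_sum, map_smul, Finset.mul_sum, Finset.sum_mul, smul_mul_assoc, mul_smul_comm,
      smul_sub, Finset.sum_sub_distrib]
  rw [h1]
  simp only [Matrix.sum_apply, Matrix.smul_apply, smul_eq_mul, ← Finset.sum_neg_distrib]
  refine Finset.sum_congr rfl fun a _ => Finset.sum_congr rfl fun b _ => ?_
  rw [eq_neg_of_add_eq_zero_left (hf a b c d)]; ring

/-- Contract `hf` with q in one index: the exchanged side contains R(q·,·) = 0, and half of the
commutator dies because q D = 0. -/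
theorem flatProj_mul_parallel (c : Fin p → ℝ) : flatProj β E * f * holMap β E c = 0 := by
  refine H.curvCoef_single_induction (P := fun c => flatProj β E * f * holMap β E c = 0)
    (by simp) (fun r s => ?_) (fun c c' h1 h2 => ?_) (fun t c h1 => ?_) c
  · have h : flatProj β E * (f * holMap β E (curvCoef E (Pi.single r 1) (Pi.single s 1))
      - holMap β E (curvCoef E (Pi.single r 1) (Pi.single s 1)) * f) = 0 := by
      ext x b
      have := contract_parallel hf
        (Matrix.of fun a b' => if b' = b then flatProj β E x a else 0) r s
      simp only [Matrix.of_apply, ite_mul, zero_mul, ite_smul, zero_smul, Finset.sum_ite_eq',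
        Finset.mem_univ, if_true] at this
      have e : ∑ a, flatProj β E x a • curvCoef E (Pi.single a 1) (Pi.single b 1) = 0 := by
        have e2 : flatProj β E *ᵥ (Pi.single x 1) =
            ∑ a, flatProj β E x a • (Pi.single a 1 : Fin n → ℝ) := by
          ext a
          have := congrFun (congrFun (flatProj_transpose (β := β) (E := E)) x) a
          simp only [Matrix.transpose_apply] at this
          simp [Finset.sum_apply, Pi.single_apply, this]
        have e3 := H.curvCoef_flatProj (Pi.single x 1) (Pi.single b 1)
        rw [e2] at e3
        simpa using e3
      rw [e] at this
      simpa [Matrix.mul_apply] using this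
    rw [mul_sub, ← mul_assoc, ← mul_assoc, H.flatProj_mul_holMap, zero_mul, sub_zero] at h
    exact h
  · rw [map_add, mul_add, h1, h2, add_zero]
  · rw [map_smul, mul_smul_comm, h1, smul_zero]

/-- A `Z` orthogonal to the holonomy algebra contracts the curvature to zero, so by `hf` it is
orthogonal to all commutators of `f` with that algebra. -/
theorem trace_parallel (Z : Matrix (Fin n) (Fin n) ℝ)
    (hZ : ∀ c, (Zᵀ * holMap β E c).trace = 0) (c : Fin p → ℝ) :
    (Zᵀ * (f * holMap β E c - holMap β E c * f)).trace = 0 := by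
  refine H.curvCoef_single_induction (P := fun c =>
    (Zᵀ * (f * holMap β E c - holMap β E c * f)).trace = 0)
    (by simp) (fun r s => ?_) (fun c c' h1 h2 => ?_) (fun t c h1 => ?_) c
  · rw [← sum_mul_eq_trace, contract_parallel hf, H.sum_curvCoef Z hZ]
    simp
  · rw [map_add, mul_add, add_mul, add_sub_add_comm, mul_add, Matrix.trace_add, h1, h2, add_zero]
  · rw [map_smul, mul_smul_comm, smul_mul_assoc, ← smul_sub, mul_smul_comm, Matrix.trace_smul, h1,
      smul_zero]

/-- The rows of q f are annihilated by the holonomy algebra, hence fixed by q: the mixed block q f h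
vanishes. -/
theorem flatProj_mul_eq : flatProj β E * f = flatProj β E * f * flatProj β E := by
  have h1 : ∀ i, holGen β E i * (flatProj β E * f)ᵀ = 0 := by
    intro i
    have := congrArg Matrix.transpose (H.flatProj_mul_parallel hf (Pi.single i 1))
    rw [Matrix.transpose_mul, H.holMap_transpose, holMap_single] at this
    simpa using this
  have h2 := congrArg Matrix.transpose (flatProj_mul h1)
  rw [Matrix.transpose_mul, Matrix.transpose_transpose, flatProj_transpose] at h2
  exact h2.symm

/-- The semisimple part of a two-form that is compatible with a parallel curvature is in the
holonomy algebra. -/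
theorem semi_mem_holonomy (hfa : fᵀ = -f) :
    ∃ c, (1 - flatProj β E) * f * (1 - flatProj β E) = holMap β E c := by
  set Q := flatProj β E with hQ
  have hQt : Qᵀ = Q := flatProj_transpose
  have hQf := H.flatProj_mul_eq hf
  have hfQ : f * Q = Q * f * Q := by
    have := congrArg Matrix.transpose hQf
    rw [← hQ] at this
    simp only [Matrix.transpose_mul, hfa, hQt] at this
    simpa [mul_assoc] using this
  set f1 := (1 - Q) * f * (1 - Q) with hf1
  have hf1' : f1 = f - Q * f * Q := by
    rw [hf1, sub_mul, one_mul, mul_sub, mul_one, sub_mul, hfQ]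
    rw [← hQ] at hQf
    rw [← hQf]; abel
  have hu : IsUnit (holGram β E).det :=
    (Matrix.isUnit_iff_isUnit_det _).1 H.holGram_posDef.isUnit
  -- `c0` solves the normal equations of the Gram matrix, so `P` is the component of h f h
  -- orthogonal to the holonomy algebra in the trace inner product. It remains to show P = 0.
  set b : Fin p → ℝ := fun k => (f1ᵀ * holGen β E k).trace with hb
  set c0 := b ᵥ* (holGram β E)⁻¹ with hc0
  set P := f1 - holMap β E c0 with hP
  have hPt : ∀ c, (Pᵀ * holMap β E c).trace = 0 := by
    intro c
    have e1 : (f1ᵀ * holMap β E c).trace = b ⬝ᵥ c := by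
      simp [holMap_apply, Finset.mul_sum, Matrix.trace_sum, hb, dotProduct, mul_comm]
    have e2 : ((holMap β E c0)ᵀ * holMap β E c).trace = b ⬝ᵥ c := by
      rw [← holGram_dot, Matrix.dotProduct_mulVec, hc0, Matrix.vecMul_vecMul,
        Matrix.nonsing_inv_mul _ hu, Matrix.vecMul_one]
    rw [hP, Matrix.transpose_sub, sub_mul, Matrix.trace_sub, e1, e2, sub_self]
  have hPa : Pᵀ = -P := by
    rw [hP, Matrix.transpose_sub, H.holMap_transpose, hf1']
    simp only [Matrix.transpose_sub, Matrix.transpose_mul, hfa, hQ, flatProj_transpose]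
    rw [mul_assoc]
    simp only [mul_neg, neg_mul]; abel
  -- Z = [P, D(j)] is again orthogonal to the holonomy algebra, while [f, D(j)] - Z lies in it.
  -- Pairing `Z` with [f, D(j)], which gives zero by `trace_parallel`, leaves |Z|² = 0.
  have hcomm : ∀ j, P * holMap β E j = holMap β E j * P := by
    intro j
    set Z := P * holMap β E j - holMap β E j * P with hZ
    have hZt : Zᵀ = -Z := by
      rw [hZ, Matrix.transpose_sub, Matrix.transpose_mul, Matrix.transpose_mul, hPa,
        H.holMap_transpose]
      noncomm_ring
    have hZo : ∀ c, (Zᵀ * holMap β E c).trace = 0 := by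
      intro c
      have e := hPt (holBr β E j c)
      rw [hPa, H.holMap_holBr, neg_mul, Matrix.trace_neg, mul_sub, Matrix.trace_sub] at e
      rw [hZt, hZ, neg_mul, Matrix.trace_neg, sub_mul, Matrix.trace_sub,
        Matrix.trace_mul_cycle (holMap β E j) P, Matrix.trace_mul_cycle (holMap β E c),
        mul_assoc, mul_assoc]
      exact e
    have h1 := H.trace_parallel hf Z hZo j
    have h2 : f * holMap β E j - holMap β E j * f = Z + holMap β E (holBr β E c0 j) := by
      have e : f = P + holMap β E c0 + Q * f * Q := by rw [hP, hf1']; abel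
      rw [H.holMap_holBr, hZ]
      conv_lhs => rw [e]
      have e3 : Q * f * Q * holMap β E j = 0 := by
        rw [mul_assoc, H.flatProj_mul_holMap, mul_zero]
      have e4 : holMap β E j * (Q * f * Q) = 0 := by
        rw [mul_assoc, ← mul_assoc, holMap_mul_flatProj, zero_mul]
      rw [add_mul, mul_add, e3, e4]
      noncomm_ring
    rw [h2, mul_add, Matrix.trace_add, hZo, add_zero] at h1
    exact sub_eq_zero.1 (eq_zero_of_trace h1)
  -- Because `P` commutes with the D_i, this product is β^{ij} D_i P D_j = -½ R(P), which is zero by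
  -- orthogonality.
  have hcas : casMatrix β E * P = 0 := by
    have e1 : ∑ i, ∑ j, β⁻¹ i j • (holGen β E i * P * holGen β E j) = casMatrix β E * P := by
      simp only [casMatrix, Finset.sum_mul, smul_mul_assoc]
      refine Finset.sum_congr rfl fun i _ => Finset.sum_congr rfl fun j _ => ?_
      have := hcomm (Pi.single j 1)
      rw [holMap_single] at this
      rw [mul_assoc, this, mul_assoc]
    rw [← e1]
    ext a d
    rw [H.casimir_insert_antisymm hPa]
    have e2 : ∑ r, ∑ s, curv β E a d r s * P r s = 0 := by
      have := hPt (curvCoef E (Pi.single a 1) (Pi.single d 1))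
      rw [← sum_mul_eq_trace] at this
      rw [← this]
      refine Finset.sum_congr rfl fun r _ => Finset.sum_congr rfl fun s _ => ?_
      rw [curv_sum H.symm, curv_pair_symm H.symm]
      simp [Pi.single_apply, mul_comm]
    rw [e2]; simp
  -- The columns of `P` lie in the kernel of the Ricci tensor, hence are flat and q P = P. But `P`
  -- is built from h f h and the holonomy algebra, so q P = 0.
  have hDP : ∀ i, holGen β E i * P = 0 := by
    intro i
    ext a d
    have := H.holGen_mulVec_of_casMatrix (x := fun r => P r d)
      (funext fun r => congrFun (congrFun hcas r) d) i
    exact congrFun this a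
  have hQP : Q * P = P := flatProj_mul hDP
  have hQP0 : Q * P = 0 := by
    rw [hP, hf1', mul_sub, mul_sub, H.flatProj_mul_holMap, ← mul_assoc, ← mul_assoc, hQ,
      flatProj_idem, ← H.flatProj_mul_eq hf]
    simp
  refine ⟨c0, ?_⟩
  have : P = 0 := by rw [← hQP, hQP0]
  rw [hP] at this
  exact sub_eq_zero.1 this

end Parallel

end IsHolonomy

end FlatPart

end SymSpace

namespace SymSpace

attribute [local instance] Matrix.normedAddCommGroup Matrix.normedSpace

/-! ### The geometry of the radial frame -/

section Frame

variable {n : ℕ}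

/-- The matrix `(Γ_μ)^ν_l = Γ^ν_{μl}` of the Levi-Civita connection. -/
def chrMat (g : Coord n → Matrix (Fin n) (Fin n) ℝ) (μ : Fin n) (y : Coord n) :
    Matrix (Fin n) (Fin n) ℝ := Matrix.of fun ν l => christoffel g ν μ l y

/-- The matrix `ω_μ = (ω^a_{bμ})` of the spin connection. -/
def spinMat (g e : Coord n → Matrix (Fin n) (Fin n) ℝ) (μ : Fin n) (y : Coord n) :
    Matrix (Fin n) (Fin n) ℝ := Matrix.of fun a b => spinConnection g e μ a b y

/-- The matrix `R_{μν} = (R^α_{βμν})` of the curvature. -/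
def riemMat (g : Coord n → Matrix (Fin n) (Fin n) ℝ) (μ ν : Fin n) (y : Coord n) :
    Matrix (Fin n) (Fin n) ℝ := Matrix.of fun α β => riemann g α β μ ν y

/-- A smooth orthonormal frame on an open set. -/
structure IsOrthoFrame (U : Set (Coord n)) (g e : Coord n → Matrix (Fin n) (Fin n) ℝ) : Prop where
  isOpen : IsOpen U
  smooth : ∀ y ∈ U, ContDiffAt ℝ ∞ e y
  orthonormal : ∀ y ∈ U, (e y)ᵀ * g y * e y = 1

namespace IsOrthoFrame

variable {U : Set (Coord n)} {g e : Coord n → Matrix (Fin n) (Fin n) ℝ} (S : IsOrthoFrame U g e)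
  {y : Coord n} (hy : y ∈ U)
include S hy

theorem isUnit_det : IsUnit (e y).det := by
  have h := congrArg Matrix.det (S.orthonormal y hy)
  rw [Matrix.det_mul, Matrix.det_one] at h
  exact IsUnit.of_mul_eq_one_right _ h

theorem inv_mul : (e y)⁻¹ * e y = 1 := Matrix.nonsing_inv_mul _ (S.isUnit_det hy)

theorem mul_inv : e y * (e y)⁻¹ = 1 := Matrix.mul_nonsing_inv _ (S.isUnit_det hy)

theorem metric_eq : g y = ((e y)⁻¹)ᵀ * (e y)⁻¹ := by
  have h1 : ((e y)⁻¹)ᵀ * (e y)ᵀ = 1 := by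
    rw [← Matrix.transpose_mul, S.mul_inv hy, Matrix.transpose_one]
  calc g y = (((e y)⁻¹)ᵀ * (e y)ᵀ) * g y * (e y * (e y)⁻¹) := by
        rw [h1, S.mul_inv hy, one_mul, mul_one]
    _ = ((e y)⁻¹)ᵀ * ((e y)ᵀ * g y * e y) * (e y)⁻¹ := by simp only [mul_assoc]
    _ = _ := by rw [S.orthonormal y hy, mul_one]

theorem metric_inv : (g y)⁻¹ = e y * (e y)ᵀ := by
  refine Matrix.inv_eq_right_inv ?_
  have h1 : ((e y)⁻¹)ᵀ * (e y)ᵀ = 1 := by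
    rw [← Matrix.transpose_mul, S.mul_inv hy, Matrix.transpose_one]
  rw [S.metric_eq hy, mul_assoc, ← mul_assoc (e y)⁻¹, S.inv_mul hy, one_mul, h1]

theorem metric_mul_inv : g y * (g y)⁻¹ = 1 := by
  rw [S.metric_inv hy, ← mul_assoc]
  have := S.orthonormal y hy
  have h2 : (e y)ᵀ * (g y * e y) = 1 := by rw [← mul_assoc]; exact this
  exact mul_eq_one_comm.1 h2

theorem metric_symm (μ ν : Fin n) : g y μ ν = g y ν μ := by
  have : (g y)ᵀ = g y := by rw [S.metric_eq hy]; simp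
  exact congrFun (congrFun this ν) μ

theorem cd_coframe : ContDiffAt ℝ ∞ (fun z => (e z)⁻¹) y :=
  cd_inv (S.smooth y hy) (S.isUnit_det hy).ne_zero

/-- The metric inherits its smoothness from the frame, since g = θᵀθ with θ the coframe. -/
theorem cd_metric : ContDiffAt ℝ ∞ g y :=
  contDiffAt_congr S.isOpen hy (fun _ hz => S.metric_eq hz)
    (cd_mul (cd_transpose (S.cd_coframe hy)) (S.cd_coframe hy))

theorem cd_metric_inv : ContDiffAt ℝ ∞ (fun z => (g z)⁻¹) y :=
  contDiffAt_congr S.isOpen hy (fun _ hz => S.metric_inv hz)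
    (cd_mul (S.smooth y hy) (cd_transpose (S.smooth y hy)))

theorem cd_christoffel (l μ ν : Fin n) : ContDiffAt ℝ ∞ (christoffel g l μ ν) y := by
  unfold christoffel
  have hg : ∀ r s t, ContDiffAt ℝ ∞ (fun z => pd t (fun z => g z r s) z) y := fun r s t =>
    cd_pd (cd_entry r s (S.cd_metric hy))
  refine contDiffAt_const.mul (ContDiffAt.sum fun k _ => ?_)
  exact (cd_entry _ _ (S.cd_metric_inv hy)).mul (((hg _ _ _).add (hg _ _ _)).sub (hg _ _ _))

theorem cd_chrMat (μ : Fin n) : ContDiffAt ℝ ∞ (chrMat g μ) y :=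
  cd_matrix fun _ _ => S.cd_christoffel hy _ _ _

theorem cd_riemMat (μ ν : Fin n) : ContDiffAt ℝ ∞ (riemMat g μ ν) y := by
  refine cd_matrix fun α b => ?_
  change ContDiffAt ℝ ∞ (riemann g α b μ ν) y
  unfold riemann
  refine ((cd_pd (S.cd_christoffel hy _ _ _)).sub (cd_pd (S.cd_christoffel hy _ _ _))).add
    (ContDiffAt.sum fun k _ => ?_)
  exact ((S.cd_christoffel hy _ _ _).mul (S.cd_christoffel hy _ _ _)).sub
    ((S.cd_christoffel hy _ _ _).mul (S.cd_christoffel hy _ _ _))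

theorem christoffel_symm (l μ ν : Fin n) : christoffel g l μ ν y = christoffel g l ν μ y := by
  unfold christoffel
  congr 1
  refine Finset.sum_congr rfl fun k _ => ?_
  have : pd k (fun z => g z μ ν) y = pd k (fun z => g z ν μ) y :=
    dirD_congr S.isOpen hy fun z hz => S.metric_symm hz μ ν
  rw [this]; ring

theorem metric_mul_chrMat (μ k ν : Fin n) : (g y * chrMat g μ y) k ν =
    (1 / 2) * (pd μ (fun z => g z k ν) y + pd ν (fun z => g z k μ) y
      - pd k (fun z => g z μ ν) y) := by
  have h : chrMat g μ y = (g y)⁻¹ * Matrix.of fun k ν =>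
      (1 / 2) * (pd μ (fun z => g z k ν) y + pd ν (fun z => g z k μ) y
      - pd k (fun z => g z μ ν) y) := by
    ext l ν
    simp only [chrMat, christoffel, Matrix.mul_apply, Matrix.of_apply, Finset.mul_sum]
    exact Finset.sum_congr rfl fun k _ => by ring
  rw [h, ← mul_assoc, S.metric_mul_inv hy, one_mul]
  rfl

theorem metric_compat (μ : Fin n) :
    pd μ g y = (chrMat g μ y)ᵀ * g y + g y * chrMat g μ y := by
  have h1 : (chrMat g μ y)ᵀ * g y = (g y * chrMat g μ y)ᵀ := by
    have : (g y)ᵀ = g y := by rw [S.metric_eq hy]; simp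
    rw [Matrix.transpose_mul, this]
  ext k ν
  have hs : ∀ r s t, pd t (fun z => g z r s) y = pd t (fun z => g z s r) y := fun r s t =>
    dirD_congr S.isOpen hy fun z hz => S.metric_symm hz r s
  rw [h1, Matrix.add_apply, Matrix.transpose_apply, S.metric_mul_chrMat hy,
    S.metric_mul_chrMat hy, pd_eq, dirD_entry k ν (S.cd_metric hy), ← pd_eq, hs μ k ν, hs μ ν k,
    hs ν k μ, hs ν μ k]
  ring

theorem spinMat_eq (μ : Fin n) :
    spinMat g e μ y = (e y)⁻¹ * (pd μ e y + chrMat g μ y * e y) := by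
  ext a b
  simp only [spinMat, spinConnection, Matrix.of_apply, Matrix.mul_apply, Matrix.add_apply]
  refine Finset.sum_congr rfl fun ν _ => ?_
  rw [pd_eq, pd_eq, dirD_entry ν b (S.smooth y hy)]
  rfl

theorem pd_frame (μ : Fin n) : pd μ e y = e y * spinMat g e μ y - chrMat g μ y * e y := by
  rw [S.spinMat_eq hy, ← mul_assoc, S.mul_inv hy, one_mul]; abel

theorem pd_coframe (μ : Fin n) : pd μ (fun z => (e z)⁻¹) y =
    (e y)⁻¹ * chrMat g μ y - spinMat g e μ y * (e y)⁻¹ := by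
  have h1 : dirD (cv μ) (fun z => (e z)⁻¹ * e z) y = 0 := by
    rw [dirD_congr S.isOpen hy (f' := fun _ => 1) (fun z hz => S.inv_mul hz), dirD_const]
  rw [dirD_mul (S.cd_coframe hy) (S.smooth y hy), ← pd_eq, ← pd_eq, S.pd_frame hy] at h1
  have h2 := congrArg (· * (e y)⁻¹) h1
  simp only [zero_mul, add_mul, mul_assoc, S.mul_inv hy, mul_one, mul_sub, sub_mul] at h2
  rw [← mul_assoc (e y)⁻¹ (e y), S.inv_mul hy, one_mul] at h2
  rw [eq_neg_of_add_eq_zero_left h2]; abel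

theorem cd_spinMat (μ : Fin n) : ContDiffAt ℝ ∞ (spinMat g e μ) y :=
  contDiffAt_congr S.isOpen hy (fun _ hz => S.spinMat_eq hz μ)
    (cd_mul (S.cd_coframe hy) ((cd_pd (S.smooth y hy)).add
      (cd_mul (S.cd_chrMat hy μ) (S.smooth y hy))))

/-- Compare metric compatibility with the derivative of g = θᵀθ: the Christoffel terms cancel and
θᵀ(ωᵀ + ω)θ = 0 remains. -/
theorem spinMat_transpose (μ : Fin n) : (spinMat g e μ y)ᵀ = - spinMat g e μ y := by
  have h1 : pd μ g y = ((pd μ (fun z => (e z)⁻¹) y)ᵀ * (e y)⁻¹)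
      + ((e y)⁻¹)ᵀ * pd μ (fun z => (e z)⁻¹) y := by
    rw [pd_eq, dirD_congr S.isOpen hy (fun z hz => S.metric_eq hz),
      dirD_mul (cd_transpose (S.cd_coframe hy)) (S.cd_coframe hy),
      dirD_transpose (S.cd_coframe hy)]
    rfl
  rw [S.metric_compat hy, S.pd_coframe hy, S.metric_eq hy] at h1
  set θ := (e y)⁻¹
  set w := spinMat g e μ y
  set Γ := chrMat g μ y
  have h2 : θᵀ * (wᵀ + w) * θ = 0 := by
    simp only [Matrix.transpose_sub, Matrix.transpose_mul] at h1
    have h3 : θᵀ * (wᵀ + w) * θ = (Γᵀ * (θᵀ * θ) + θᵀ * θ * Γ) -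
      ((Γᵀ * θᵀ - θᵀ * wᵀ) * θ + θᵀ * (θ * Γ - w * θ)) := by noncomm_ring
    rw [h3, ← h1, sub_self]
  have h4 : (e y)ᵀ * (θᵀ * (wᵀ + w) * θ) * e y = wᵀ + w := by
    have e1 : (e y)ᵀ * θᵀ = 1 := by
      rw [← Matrix.transpose_mul, S.inv_mul hy, Matrix.transpose_one]
    rw [← mul_assoc, ← mul_assoc, e1, one_mul, mul_assoc, S.inv_mul hy, mul_one]
  rw [h2] at h4
  simp only [mul_zero, zero_mul] at h4
  exact eq_neg_of_add_eq_zero_left h4.symm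

theorem riemMat_eq (μ ν : Fin n) : riemMat g μ ν y =
    pd μ (chrMat g ν) y - pd ν (chrMat g μ) y
      + (chrMat g μ y * chrMat g ν y - chrMat g ν y * chrMat g μ y) := by
  ext α b
  simp only [riemMat, riemann, Matrix.of_apply, Matrix.add_apply, Matrix.sub_apply,
    Matrix.mul_apply, ← Finset.sum_sub_distrib]
  rw [pd_eq, pd_eq, pd_eq, pd_eq, dirD_entry α b (S.cd_chrMat hy ν),
    dirD_entry α b (S.cd_chrMat hy μ)]
  rfl

/-- The curvature of the spin connection. -/
theorem spin_curvature (μ ν : Fin n) :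
    pd μ (spinMat g e ν) y - pd ν (spinMat g e μ) y
      + (spinMat g e μ y * spinMat g e ν y - spinMat g e ν y * spinMat g e μ y)
    = (e y)⁻¹ * riemMat g μ ν y * e y := by
  have hd : ∀ μ ν, pd μ (spinMat g e ν) y =
      pd μ (fun z => (e z)⁻¹) y * (pd ν e y + chrMat g ν y * e y)
      + (e y)⁻¹ * (pd μ (pd ν e) y + (pd μ (chrMat g ν) y * e y + chrMat g ν y * pd μ e y)) := by
    intro μ ν
    rw [pd_eq, dirD_congr S.isOpen hy (fun z hz => S.spinMat_eq hz ν),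
      dirD_mul (S.cd_coframe hy) ((cd_pd (S.smooth y hy)).add
        (cd_mul (S.cd_chrMat hy ν) (S.smooth y hy))),
      dirD_add (cd_pd (S.smooth y hy)) (cd_mul (S.cd_chrMat hy ν) (S.smooth y hy)),
      dirD_mul (S.cd_chrMat hy ν) (S.smooth y hy)]
    rfl
  have hc : pd μ (pd ν e) y = pd ν (pd μ e) y := dirD_comm (S.smooth y hy)
  rw [hd, hd, hc, S.riemMat_eq hy, S.pd_coframe hy, S.pd_coframe hy, S.pd_frame hy, S.pd_frame hy]
  have h1 := S.inv_mul hy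
  set θ := (e y)⁻¹
  set f := e y
  set w := spinMat g e μ y
  set w' := spinMat g e ν y
  set Γ := chrMat g μ y
  set Γ' := chrMat g ν y
  have k1 : ∀ A, θ * (f * A) = A := fun A => by rw [← mul_assoc, h1, one_mul]
  simp only [mul_add, mul_sub, add_mul, sub_mul, mul_assoc, k1]
  abel

end IsOrthoFrame

end Frame

end SymSpace

namespace SymSpace

attribute [local instance] Matrix.normedAddCommGroup Matrix.normedSpace

/-! ### Vector-valued bilinear forms and covariantly constant two-forms -/

section TwoForms

variable {n : ℕ} {W : Type*} [AddCommGroup W] [Module ℝ W]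

/-- The value `T_{μν} u^μ v^ν` of a two-tensor on two vectors. -/
def biForm (T : Fin n → Fin n → W) : (Fin n → ℝ) →ₗ[ℝ] (Fin n → ℝ) →ₗ[ℝ] W :=
  LinearMap.mk₂ ℝ (fun u v => ∑ μ, ∑ ν, (u μ * v ν) • T μ ν)
    (fun _ _ _ => by simp [add_mul, add_smul, Finset.sum_add_distrib])
    (fun _ _ _ => by simp [mul_assoc, mul_smul, Finset.smul_sum])
    (fun _ _ _ => by simp [mul_add, add_smul, Finset.sum_add_distrib])
    (fun _ _ _ => by simp [mul_left_comm, mul_smul, Finset.smul_sum])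

theorem biForm_apply (T : Fin n → Fin n → W) (u v : Fin n → ℝ) :
    biForm T u v = ∑ μ, ∑ ν, (u μ * v ν) • T μ ν := rfl

theorem biForm_single (T : Fin n → Fin n → W) (a b : Fin n) :
    biForm T (Pi.single a 1) (Pi.single b 1) = T a b := by
  simp [biForm_apply, Pi.single_apply]

theorem biForm_eq_of_single {S T : (Fin n → ℝ) →ₗ[ℝ] (Fin n → ℝ) →ₗ[ℝ] W}
    (h : ∀ a b, S (Pi.single a 1) (Pi.single b 1) = T (Pi.single a 1) (Pi.single b 1)) : S = T := by
  refine (Pi.basisFun ℝ (Fin n)).ext fun a => (Pi.basisFun ℝ (Fin n)).ext fun b => ?_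
  simpa using h a b

theorem biForm_mulVec_left (T : Fin n → Fin n → W) (A : Matrix (Fin n) (Fin n) ℝ)
    (u v : Fin n → ℝ) :
    biForm T (A *ᵥ u) v = biForm (fun μ ν => ∑ k, A k μ • T k ν) u v := by
  simp only [biForm_apply, Matrix.mulVec, dotProduct, Finset.sum_mul, Finset.sum_smul,
    Finset.smul_sum, smul_smul]
  rw [sum_rot]
  refine Finset.sum_congr rfl fun μ _ => ?_
  rw [Finset.sum_comm]
  refine Finset.sum_congr rfl fun ν _ => Finset.sum_congr rfl fun k _ => ?_
  congr 1; ring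

theorem biForm_mulVec_right (T : Fin n → Fin n → W) (A : Matrix (Fin n) (Fin n) ℝ)
    (u v : Fin n → ℝ) :
    biForm T u (A *ᵥ v) = biForm (fun μ ν => ∑ k, A k ν • T μ k) u v := by
  simp only [biForm_apply, Matrix.mulVec, dotProduct, Finset.mul_sum, Finset.sum_smul,
    Finset.smul_sum, smul_smul]
  refine Finset.sum_congr rfl fun μ _ => ?_
  rw [Finset.sum_comm]
  refine Finset.sum_congr rfl fun ν _ => Finset.sum_congr rfl fun k _ => ?_
  congr 1; ring

theorem biForm_map {W' : Type*} [AddCommGroup W'] [Module ℝ W'] (L : W →ₗ[ℝ] W')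
    (T : Fin n → Fin n → W) (u v : Fin n → ℝ) :
    L (biForm T u v) = biForm (fun μ ν => L (T μ ν)) u v := by
  simp [biForm_apply]

theorem biForm_add (S T : Fin n → Fin n → W) (u v : Fin n → ℝ) :
    biForm (fun μ ν => S μ ν + T μ ν) u v = biForm S u v + biForm T u v := by
  simp [biForm_apply, Finset.sum_add_distrib]

theorem biForm_neg (T : Fin n → Fin n → W) (u v : Fin n → ℝ) :
    biForm (fun μ ν => - T μ ν) u v = - biForm T u v := by
  simp [biForm_apply]

variable {V : Type*} [NormedAddCommGroup V] [NormedSpace ℝ V]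
  {T : Fin n → Fin n → Coord n → V} {u v : Coord n → Fin n → ℝ} {x y : Coord n}

theorem cd_biForm (hT : ∀ μ ν, ContDiffAt ℝ ∞ (T μ ν) y) (hu : ContDiffAt ℝ ∞ u y)
    (hv : ContDiffAt ℝ ∞ v y) :
    ContDiffAt ℝ ∞ (fun z => biForm (fun μ ν => T μ ν z) (u z) (v z)) y := by
  simp only [biForm_apply]
  exact ContDiffAt.sum fun μ _ => ContDiffAt.sum fun ν _ =>
    ((cd_apply μ hu).mul (cd_apply ν hv)).smul (hT μ ν)

theorem dirD_biForm (hT : ∀ μ ν, ContDiffAt ℝ ∞ (T μ ν) y) (hu : ContDiffAt ℝ ∞ u y)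
    (hv : ContDiffAt ℝ ∞ v y) :
    dirD x (fun z => biForm (fun μ ν => T μ ν z) (u z) (v z)) y =
      biForm (fun μ ν => dirD x (T μ ν) y) (u y) (v y)
      + biForm (fun μ ν => T μ ν y) (dirD x u y) (v y)
      + biForm (fun μ ν => T μ ν y) (u y) (dirD x v y) := by
  have hm : ∀ μ ν, ContDiffAt ℝ ∞ (fun z => u z μ * v z ν) y := fun μ ν =>
    (cd_apply μ hu).mul (cd_apply ν hv)
  have hs : ∀ μ ν, ContDiffAt ℝ ∞ (fun z => (u z μ * v z ν) • T μ ν z) y := fun μ ν =>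
    cd_smul (hm μ ν) (hT μ ν)
  simp only [biForm_apply]
  rw [dirD_sum fun μ _ => ContDiffAt.sum fun ν _ => hs μ ν]
  simp only [← Finset.sum_add_distrib]
  refine Finset.sum_congr rfl fun μ _ => ?_
  rw [dirD_sum fun ν _ => hs μ ν]
  refine Finset.sum_congr rfl fun ν _ => ?_
  rw [dirD_smul (hm μ ν) (hT μ ν), dirD_rmul (cd_apply μ hu) (cd_apply ν hv),
    dirD_apply μ hu, dirD_apply ν hv, add_smul]
  abel

end TwoForms

namespace IsOrthoFrame

variable {n : ℕ} {U : Set (Coord n)} {g e : Coord n → Matrix (Fin n) (Fin n) ℝ}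
  (S : IsOrthoFrame U g e) {y : Coord n} (hy : y ∈ U)
include S hy

theorem cd_mulVec_const (u : Fin n → ℝ) : ContDiffAt ℝ ∞ (fun z => e z *ᵥ u) y :=
  cd_mulVec (S.smooth y hy) contDiffAt_const

/-- The frame components of a covariantly constant two-form with values in a matrix bundle. -/
theorem pd_frame_twoForm {κ 𝕜 : Type*} [RCLike 𝕜] [Fintype κ]
    {T : Fin n → Fin n → Coord n → Matrix κ κ 𝕜} {C : Matrix κ κ 𝕜}
    (hT : ∀ μ ν, ContDiffAt ℝ ∞ (T μ ν) y) (l : Fin n)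
    (h0 : ∀ μ ν, pd l (T μ ν) y
      - ∑ k, (christoffel g k l μ y • T k ν y + christoffel g k l ν y • T μ k y)
      + (C * T μ ν y - T μ ν y * C) = 0) (u v : Fin n → ℝ) :
    pd l (fun z => biForm (fun μ ν => T μ ν z) (e z *ᵥ u) (e z *ᵥ v)) y
      + (C * biForm (fun μ ν => T μ ν y) (e y *ᵥ u) (e y *ᵥ v)
        - biForm (fun μ ν => T μ ν y) (e y *ᵥ u) (e y *ᵥ v) * C)
    = biForm (fun μ ν => T μ ν y) (e y *ᵥ (spinMat g e l y *ᵥ u)) (e y *ᵥ v)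
      + biForm (fun μ ν => T μ ν y) (e y *ᵥ u) (e y *ᵥ (spinMat g e l y *ᵥ v)) := by
  classical
  have hd : ∀ u : Fin n → ℝ, dirD (cv l) (fun z => e z *ᵥ u) y =
      e y *ᵥ (spinMat g e l y *ᵥ u) - chrMat g l y *ᵥ (e y *ᵥ u) := by
    intro u
    rw [dirD_mulVec (S.smooth y hy) contDiffAt_const, dirD_const, ← pd_eq, S.pd_frame hy,
      Matrix.mulVec_zero, add_zero, Matrix.sub_mulVec, Matrix.mulVec_mulVec, Matrix.mulVec_mulVec]
  -- Covariant constancy replaces ∂_l T by Christoffel terms and a commutator. The former cancel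
  -- against those in ∂_l e, so that only the spin connection acts on the arguments.
  have h1 : (fun μ ν => dirD (cv l) (T μ ν) y) = fun μ ν =>
      ((∑ k, chrMat g l y k μ • T k ν y) + ∑ k, chrMat g l y k ν • T μ k y)
      + -(LinearMap.mulLeft ℝ C - LinearMap.mulRight ℝ C) (T μ ν y) := by
    funext μ ν
    have := h0 μ ν
    rw [Finset.sum_add_distrib] at this
    rw [← pd_eq]
    simp only [LinearMap.sub_apply, LinearMap.mulLeft_apply, LinearMap.mulRight_apply]
    have h2 := eq_neg_of_add_eq_zero_left this
    rw [sub_eq_iff_eq_add] at h2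
    rw [h2, add_comm]; rfl
  rw [pd_eq, dirD_biForm hT (S.cd_mulVec_const hy u) (S.cd_mulVec_const hy v), hd, hd, h1,
    biForm_add, biForm_add, biForm_neg, ← biForm_mulVec_left, ← biForm_mulVec_right, ← biForm_map]
  simp only [LinearMap.sub_apply, LinearMap.mulLeft_apply, LinearMap.mulRight_apply, map_sub]
  abel

end IsOrthoFrame

end SymSpace

namespace SymSpace

attribute [local instance] Matrix.normedAddCommGroup Matrix.normedSpace

/-! ### Constant curvature components in the radial frame -/

section SymFrame

variable {n : ℕ}

/-- The frame components of the curvature as a bilinear map with values in matrices. -/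
def frameCurv (g e : Coord n → Matrix (Fin n) (Fin n) ℝ) (y : Coord n) :
    (Fin n → ℝ) →ₗ[ℝ] (Fin n → ℝ) →ₗ[ℝ] Matrix (Fin n) (Fin n) ℝ :=
  ((biForm fun μ ν => riemMat g μ ν y).compl₁₂ (e y).mulVecLin (e y).mulVecLin).compr₂
    (LinearMap.mulLeft ℝ (e y)⁻¹ ∘ₗ LinearMap.mulRight ℝ (e y))

theorem frameCurv_apply (g e : Coord n → Matrix (Fin n) (Fin n) ℝ) (y : Coord n)
    (u v : Fin n → ℝ) : frameCurv g e y u v =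
      (e y)⁻¹ * (biForm (fun μ ν => riemMat g μ ν y) (e y *ᵥ u) (e y *ᵥ v) * e y) := rfl

theorem frameRiemann_eq (g e : Coord n → Matrix (Fin n) (Fin n) ℝ) (y : Coord n)
    (a b c d : Fin n) : frameRiemann g e a b c d y =
      frameCurv g e y (Pi.single c 1) (Pi.single d 1) a b := by
  simp only [frameCurv_apply, biForm_apply, frameRiemann, Matrix.mulVec_single_one, Matrix.col,
    Matrix.mul_apply, Matrix.sum_apply, Matrix.smul_apply, smul_eq_mul, riemMat, Matrix.of_apply,
    Finset.mul_sum, Finset.sum_mul, Matrix.transpose_apply]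
  refine Finset.sum_congr rfl fun α _ => Eq.trans ?_ (sum_rot _).symm
  refine Finset.sum_congr rfl fun b' _ =>
    Finset.sum_congr rfl fun μ _ => Finset.sum_congr rfl fun ν _ => by ring

/-- The matrices that act by derivations on a bilinear map. -/
def derivDefect (B : (Fin n → ℝ) →ₗ[ℝ] (Fin n → ℝ) →ₗ[ℝ] Matrix (Fin n) (Fin n) ℝ)
    (u v : Fin n → ℝ) : Matrix (Fin n) (Fin n) ℝ →ₗ[ℝ] Matrix (Fin n) (Fin n) ℝ :=
  LinearMap.mulRight ℝ (B u v) - LinearMap.mulLeft ℝ (B u v)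
    - (B.flip v) ∘ₗ ((mulVecBilin (Fin n) ℝ).flip u) - (B u) ∘ₗ ((mulVecBilin (Fin n) ℝ).flip v)

theorem derivDefect_apply (B : (Fin n → ℝ) →ₗ[ℝ] (Fin n → ℝ) →ₗ[ℝ] Matrix (Fin n) (Fin n) ℝ)
    (u v : Fin n → ℝ) (A : Matrix (Fin n) (Fin n) ℝ) :
    derivDefect B u v A = A * B u v - B u v * A - B (A *ᵥ u) v - B u (A *ᵥ v) := rfl

/-- Derivations of a bilinear map form a Lie algebra. -/
theorem derivDefect_comm {B : (Fin n → ℝ) →ₗ[ℝ] (Fin n → ℝ) →ₗ[ℝ] Matrix (Fin n) (Fin n) ℝ}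
    {A A' : Matrix (Fin n) (Fin n) ℝ} (h : ∀ u v, derivDefect B u v A = 0)
    (h' : ∀ u v, derivDefect B u v A' = 0) (u v : Fin n → ℝ) :
    derivDefect B u v (A * A' - A' * A) = 0 := by
  simp only [derivDefect_apply, sub_sub, sub_eq_zero] at h h'
  simp only [derivDefect_apply, Matrix.sub_mulVec, ← Matrix.mulVec_mulVec, map_sub,
    LinearMap.sub_apply]
  have e1 := h (A' *ᵥ u) v
  have e2 := h u (A' *ᵥ v)
  have e3 := h' (A *ᵥ u) v
  have e4 := h' u (A *ᵥ v)
  have f1 : B (A *ᵥ A' *ᵥ u) v = A * B (A' *ᵥ u) v - B (A' *ᵥ u) v * A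
    - B (A' *ᵥ u) (A *ᵥ v) := by rw [e1]; abel
  have f2 : B u (A *ᵥ A' *ᵥ v) = A * B u (A' *ᵥ v) - B u (A' *ᵥ v) * A
    - B (A *ᵥ u) (A' *ᵥ v) := by rw [e2]; abel
  have f3 : B (A' *ᵥ A *ᵥ u) v = A' * B (A *ᵥ u) v - B (A *ᵥ u) v * A'
    - B (A *ᵥ u) (A' *ᵥ v) := by rw [e3]; abel
  have f4 : B u (A' *ᵥ A *ᵥ v) = A' * B u (A *ᵥ v) - B u (A *ᵥ v) * A'
    - B (A' *ᵥ u) (A *ᵥ v) := by rw [e4]; abel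
  have k1 : B (A *ᵥ u) v = A * B u v - B u v * A - B u (A *ᵥ v) := by rw [h u v]; abel
  have k2 : B (A' *ᵥ u) v = A' * B u v - B u v * A' - B u (A' *ᵥ v) := by rw [h' u v]; abel
  rw [f1, f2, f3, f4, k1, k2]
  noncomm_ring

/-- The radial frame of a locally symmetric metric in normal coordinates. -/
structure IsSymFrame (U : Set (Coord n)) (g e : Coord n → Matrix (Fin n) (Fin n) ℝ) : Prop
    extends IsOrthoFrame U g e where
  zero_mem : (0 : Coord n) ∈ U
  starConvex : StarConvex ℝ 0 U
  geodesic : ∀ y ∈ U, ∀ l, ∑ μ, ∑ ν, christoffel g l μ ν y * y μ * y ν = 0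
  frame_zero : e 0 = 1
  parallel : ∀ y ∈ U, ∀ a ν,
    ∑ μ, y μ * (pd μ (fun z => e z ν a) y + ∑ l, christoffel g ν μ l y * e y l a) = 0
  nabla_riemann : ∀ y ∈ U, ∀ l α b μ ν, nablaRiemann g l α b μ ν y = 0

namespace IsSymFrame

variable {U : Set (Coord n)} {g e : Coord n → Matrix (Fin n) (Fin n) ℝ} (S : IsSymFrame U g e)
  {y : Coord n} (hy : y ∈ U)
include S hy

/-- The radial gauge: the frame is parallel along the rays, so radial covariant derivatives of frame
components are ordinary derivatives. -/
theorem radial_spinMat : ∑ μ, y μ • spinMat g e μ y = 0 := by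
  have h : ∑ μ, y μ • (pd μ e y + chrMat g μ y * e y) = 0 := by
    ext ν a
    have := S.parallel y hy a ν
    simp only [Matrix.sum_apply, Matrix.smul_apply, Matrix.add_apply, Matrix.mul_apply,
      smul_eq_mul, Matrix.zero_apply]
    rw [← this]
    refine Finset.sum_congr rfl fun μ _ => ?_
    rw [pd_eq, pd_eq, dirD_entry ν a (S.smooth y hy)]
    rfl
  have h2 := congrArg ((e y)⁻¹ * ·) h
  simp only [Finset.mul_sum, mul_smul_comm, mul_zero] at h2
  rw [← h2]
  exact Finset.sum_congr rfl fun μ _ => by rw [S.spinMat_eq hy]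

theorem pd_riemMat (l μ ν : Fin n) :
    pd l (riemMat g μ ν) y
      - ∑ k, (christoffel g k l μ y • riemMat g k ν y + christoffel g k l ν y • riemMat g μ k y)
      + (chrMat g l y * riemMat g μ ν y - riemMat g μ ν y * chrMat g l y) = 0 := by
  ext α b
  have := S.nabla_riemann y hy l α b μ ν
  rw [Matrix.zero_apply, ← this, nablaRiemann, pd_eq, Matrix.add_apply, Matrix.sub_apply,
    dirD_entry α b (S.cd_riemMat hy μ ν), Matrix.sub_apply, Matrix.mul_apply, Matrix.mul_apply,
    Matrix.sum_apply, pd_eq, ← Finset.sum_sub_distrib]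
  have e1 : dirD (cv l) (fun z => riemMat g μ ν z α b) y = dirD (cv l) (riemann g α b μ ν) y := rfl
  rw [e1, sub_add, ← Finset.sum_sub_distrib, sub_eq_add_neg, ← Finset.sum_neg_distrib]
  congr 1
  refine Finset.sum_congr rfl fun k _ => ?_
  simp only [riemMat, chrMat, Matrix.of_apply, Matrix.add_apply, Matrix.smul_apply, smul_eq_mul]
  ring

theorem cd_frameCurv (u v : Fin n → ℝ) : ContDiffAt ℝ ∞ (fun z => frameCurv g e z u v) y :=
  cd_mul (S.cd_coframe hy) (cd_mul (cd_biForm (fun μ ν => S.cd_riemMat hy μ ν)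
    (S.cd_mulVec_const hy u) (S.cd_mulVec_const hy v)) (S.smooth y hy))

theorem pd_frameCurv (l : Fin n) (u v : Fin n → ℝ) :
    pd l (fun z => frameCurv g e z u v) y = - derivDefect (frameCurv g e y) u v
      (spinMat g e l y) := by
  have hb := cd_biForm (fun μ ν => S.cd_riemMat hy μ ν)
    (S.cd_mulVec_const hy u) (S.cd_mulVec_const hy v)
  have h1 := S.pd_frame_twoForm hy (fun μ ν => S.cd_riemMat hy μ ν) l
    (fun μ ν => S.pd_riemMat hy l μ ν) u v
  rw [pd_eq] at h1
  rw [pd_eq]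
  simp only [frameCurv_apply]
  rw [dirD_mul (S.cd_coframe hy) (cd_mul hb (S.smooth y hy)), dirD_mul hb (S.smooth y hy),
    ← pd_eq, S.pd_coframe hy, ← pd_eq l e, S.pd_frame hy, derivDefect_apply]
  simp only [frameCurv_apply]
  set T := biForm (fun μ ν => riemMat g μ ν y)
  set b := T (e y *ᵥ u) (e y *ᵥ v)
  have h2 := eq_sub_of_add_eq h1
  rw [h2]
  have k1 : ∀ A, (e y)⁻¹ * (e y * A) = A := fun A => by rw [← mul_assoc, S.inv_mul hy, one_mul]
  have k2 : ∀ A, e y * ((e y)⁻¹ * A) = A := fun A => by rw [← mul_assoc, S.mul_inv hy, one_mul]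
  simp only [mul_add, mul_sub, add_mul, sub_mul, mul_assoc, k1, k2]
  abel

/-- Since ∇R = 0, the derivative of the components is linear in ω_l. Contracted with y^l it vanishes
in the radial gauge. -/
theorem frameCurv_const : frameCurv g e y = frameCurv g e 0 := by
  refine biForm_eq_of_single fun a b => ?_
  refine eq_zero_value_of_radial S.starConvex
    (f := fun z => frameCurv g e z (Pi.single a 1) (Pi.single b 1))
    (fun z hz => S.cd_frameCurv hz _ _) (fun z hz => ?_) hy
  rw [dirD_self]
  simp only [S.pd_frameCurv hz, smul_neg, Finset.sum_neg_distrib, ← map_smul, ← map_sum,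
    S.radial_spinMat hz, map_zero, neg_zero]

/-- The components are constant in every direction, not only radially, so the equation ∇_l R = 0
says that ω_l is a derivation of the curvature. -/
theorem derivDefect_spinMat (l : Fin n) (u v : Fin n → ℝ) :
    derivDefect (frameCurv g e 0) u v (spinMat g e l y) = 0 := by
  have h := S.pd_frameCurv hy l u v
  rw [pd_eq, dirD_congr S.isOpen hy (f' := fun _ => frameCurv g e 0 u v)
    (fun z hz => by rw [S.frameCurv_const hz]), dirD_const, S.frameCurv_const hy] at h
  simpa using h.symm

theorem spin_curvature_const (μ ν : Fin n) :
    pd μ (spinMat g e ν) y - pd ν (spinMat g e μ) y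
      + (spinMat g e μ y * spinMat g e ν y - spinMat g e ν y * spinMat g e μ y)
    = frameCurv g e 0 ((e y)⁻¹ *ᵥ Pi.single μ 1) ((e y)⁻¹ *ᵥ Pi.single ν 1) := by
  rw [S.spin_curvature hy, ← S.frameCurv_const hy, frameCurv_apply, Matrix.mulVec_mulVec,
    Matrix.mulVec_mulVec, S.mul_inv hy, Matrix.one_mulVec, Matrix.one_mulVec, biForm_single,
    mul_assoc]

omit hy in
theorem coframe_zero : (e 0)⁻¹ = 1 := by rw [S.frame_zero, inv_one]

omit hy in
-- The curvature at the origin is dω + [ω,ω]. Derivatives and commutators of derivations of R are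
-- derivations of R, whence R(w,z)·R = 0.
theorem derivDefect_frameCurv (w z u v : Fin n → ℝ) :
    derivDefect (frameCurv g e 0) u v (frameCurv g e 0 w z) = 0 := by
  have h : (frameCurv g e 0).compr₂ (derivDefect (frameCurv g e 0) u v) = 0 := by
    refine biForm_eq_of_single fun μ ν => ?_
    have hc := S.spin_curvature_const S.zero_mem μ ν
    rw [S.coframe_zero, Matrix.one_mulVec, Matrix.one_mulVec] at hc
    have hd : ∀ μ ν, derivDefect (frameCurv g e 0) u v (pd μ (spinMat g e ν) 0) = 0 := by
      intro μ ν
      rw [pd_eq, ← dirD_lin _ (S.cd_spinMat S.zero_mem ν),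
        dirD_congr S.isOpen S.zero_mem (f' := fun _ => 0)
          (fun z hz => S.derivDefect_spinMat hz ν u v), dirD_const]
    rw [LinearMap.compr₂_apply, ← hc, map_add, map_sub, hd, hd, derivDefect_comm
      (fun u v => S.derivDefect_spinMat S.zero_mem μ u v)
      (fun u v => S.derivDefect_spinMat S.zero_mem ν u v)]
    simp
  exact LinearMap.congr_fun₂ h w z

theorem riemann_bianchi (α b μ ν : Fin n) :
    riemann g α b μ ν y + riemann g α μ ν b y + riemann g α ν b μ y = 0 := by
  have hs : ∀ l r s, christoffel g l r s y = christoffel g l s r y := S.christoffel_symm hy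
  have hp : ∀ t l r s, pd t (christoffel g l r s) y = pd t (christoffel g l s r) y := fun t l r s =>
    dirD_congr S.isOpen hy fun z hz => S.christoffel_symm hz l r s
  unfold riemann
  rw [hp μ α ν b, hp ν α b μ, hp b α μ ν]
  simp only [Finset.sum_sub_distrib]
  have hq : ∀ r t u, ∑ k, christoffel g α r k y * christoffel g k t u y =
      ∑ k, christoffel g α r k y * christoffel g k u t y := fun r t u =>
    Finset.sum_congr rfl fun k _ => by rw [hs k t u]
  rw [hq μ ν b, hq ν b μ, hq b μ ν]
  ring

omit hy in
theorem frameRiemann_zero (a b c d : Fin n) : frameRiemann g e a b c d 0 = riemann g a b c d 0 := by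
  rw [frameRiemann_eq, frameCurv_apply, S.coframe_zero, S.frame_zero, Matrix.one_mulVec,
    Matrix.one_mulVec, biForm_single, one_mul, mul_one]
  rfl

variable {p : ℕ} {β : Matrix (Fin p) (Fin p) ℝ} {E : Fin p → Matrix (Fin n) (Fin n) ℝ}
  (hR : IsCurvatureFactorization β E (fun a b c d => frameRiemann g e a b c d 0))
include hR

omit S hy in
theorem frameCurv_zero : frameCurv g e 0 = (curvCoef E).compr₂ (holMap β E) := by
  refine biForm_eq_of_single fun c d => ?_
  ext a b
  rw [← frameRiemann_eq, LinearMap.compr₂_apply, curv_sum hR.symm, hR.factor a b c d]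
  simp [Pi.single_apply, curv]

omit hy in
-- The two analytic inputs of the algebra: the first Bianchi identity at the origin and R(u,v)·R =
-- 0.
theorem isHolonomy : IsHolonomy β E where
  symm := hR.symm
  nondegenerate := hR.nondegenerate
  antisymm := hR.antisymm
  linearIndependent := hR.linearIndependent
  bianchi a b c d := by
    have h : ∀ a b c d, curv β E a b c d = riemann g a b c d 0 := fun a b c d => by
      rw [← S.frameRiemann_zero]; exact (hR.factor a b c d).symm
    rw [h, h, h]
    exact S.riemann_bianchi S.zero_mem a b c d
  invariant u v w z := by
    have h := S.derivDefect_frameCurv u v w z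
    rw [frameCurv_zero hR, derivDefect_apply] at h
    simp only [LinearMap.compr₂_apply] at h
    rw [sub_sub, sub_eq_zero] at h
    exact h

end IsSymFrame

end SymFrame

end SymSpace

namespace SymSpace

/-! ### Trigonometric functions of √K from a block exponential -/

section Exponential

attribute [local instance] Matrix.linftyOpNormedRing Matrix.linftyOpNormedAlgebra

theorem hasSum_exp_matrix {ι : Type*} [Fintype ι] [DecidableEq ι] (M : Matrix ι ι ℝ) :
    HasSum (fun k : ℕ => ((k.factorial : ℝ)⁻¹) • M ^ k) (NormedSpace.exp M) :=
  NormedSpace.exp_series_hasSum_exp' (𝕂 := ℝ) M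

theorem hasDerivAt_exp_entry {ι : Type*} [Fintype ι] [DecidableEq ι] (M : Matrix ι ι ℝ) (i j : ι)
    (t : ℝ) : HasDerivAt (fun s : ℝ => NormedSpace.exp (s • M) i j)
      ((M * NormedSpace.exp (t • M)) i j) t := by
  have h := hasDerivAt_exp_smul_const' (𝕂 := ℝ) M t
  have h2 := (LinearMap.toContinuousLinearMap (Matrix.entryLinearMap ℝ ℝ i j)).hasFDerivAt
    |>.comp_hasDerivAt t h
  exact h2

end Exponential

section CosSinc

variable {n : ℕ} (K : Matrix (Fin n) (Fin n) ℝ)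

/-- The generator of the flow of the second-order equation `∂²Z = -K Z`. -/
def oscMat : Matrix (Fin n ⊕ Fin n) (Fin n ⊕ Fin n) ℝ := Matrix.fromBlocks 0 1 (-K) 0

theorem oscMat_mul_inl (X : Matrix (Fin n ⊕ Fin n) (Fin n ⊕ Fin n) ℝ) (i j : Fin n) :
    (oscMat K * X) (Sum.inl i) (Sum.inr j) = X (Sum.inr i) (Sum.inr j) := by
  simp [oscMat, Matrix.mul_apply, Matrix.one_apply]

theorem oscMat_mul_inr (X : Matrix (Fin n ⊕ Fin n) (Fin n ⊕ Fin n) ℝ) (i j : Fin n) :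
    (oscMat K * X) (Sum.inr i) (Sum.inr j) = -∑ k, K i k * X (Sum.inl k) (Sum.inr j) := by
  simp [oscMat, Matrix.mul_apply]

theorem oscMat_pow_even (m : ℕ) :
    oscMat K ^ (2 * m) = Matrix.fromBlocks ((-K) ^ m) 0 0 ((-K) ^ m) := by
  induction m with
  | zero => simp
  | succ m ih =>
    have : oscMat K ^ 2 = Matrix.fromBlocks (-K) 0 0 (-K) := by
      rw [pow_two, oscMat, Matrix.fromBlocks_multiply]; simp
    rw [show 2 * (m + 1) = 2 * m + 2 by ring, pow_add, ih, this, Matrix.fromBlocks_multiply]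
    simp [pow_succ]

theorem oscMat_pow_odd (m : ℕ) :
    oscMat K ^ (2 * m + 1) = Matrix.fromBlocks 0 ((-K) ^ m) ((-K) ^ m * (-K)) 0 := by
  rw [pow_succ, oscMat_pow_even, oscMat, Matrix.fromBlocks_multiply]; simp

theorem smul_neg_pow (m : ℕ) (r : ℝ) : r⁻¹ • (-K) ^ m = ((-1 : ℝ) ^ m / r) • K ^ m := by
  rw [div_eq_inv_mul, mul_smul]
  congr 1
  rcases Nat.even_or_odd m with h | h <;> simp [h.neg_one_pow, h.neg_pow]

/-- Only odd powers of the block matrix have an upper right block, namely (-K)^m; the exponential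
series becomes that of sin √K / √K. -/
theorem sincSqrt_eq (K : Matrix (Fin n) (Fin n) ℝ) (i j : Fin n) :
    sincSqrt K i j = NormedSpace.exp (oscMat K) (Sum.inl i) (Sum.inr j) := by
  have h := hasSum_exp_matrix (oscMat K)
  have h12 : HasSum (fun k : ℕ => (((k.factorial : ℝ)⁻¹) • oscMat K ^ k).toBlocks₁₂)
      (NormedSpace.exp (oscMat K)).toBlocks₁₂ := by
    refine Pi.hasSum.2 fun i => Pi.hasSum.2 fun j => ?_
    exact Pi.hasSum.1 (Pi.hasSum.1 h (Sum.inl i)) (Sum.inr j)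
  have hinj : Function.Injective (fun m : ℕ => 2 * m + 1) := fun a b h => by
    simpa using h
  have hz : ∀ k ∉ Set.range (fun m : ℕ => 2 * m + 1),
      (((k.factorial : ℝ)⁻¹) • oscMat K ^ k).toBlocks₁₂ = 0 := by
    intro k hk
    rcases Nat.even_or_odd' k with ⟨m, rfl | rfl⟩
    · rw [oscMat_pow_even, Matrix.fromBlocks_smul, Matrix.toBlocks_fromBlocks₁₂, smul_zero]
    · exact absurd ⟨m, rfl⟩ hk
  have h2 := (hinj.hasSum_iff hz).2 h12
  have h3 : HasSum (fun m : ℕ => ((-1 : ℝ) ^ m / (2 * m + 1).factorial) • K ^ m)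
      (NormedSpace.exp (oscMat K)).toBlocks₁₂ := by
    convert h2 using 1
    funext m
    simp only [Function.comp_apply, oscMat_pow_odd, Matrix.fromBlocks_smul,
      Matrix.toBlocks_fromBlocks₁₂, smul_neg_pow]
  rw [sincSqrt, h3.tsum_eq]
  rfl

/-- Only even powers contribute to the lower right block, again by (-K)^m. -/
theorem cosSqrt_eq (K : Matrix (Fin n) (Fin n) ℝ) (i j : Fin n) :
    cosSqrt K i j = NormedSpace.exp (oscMat K) (Sum.inr i) (Sum.inr j) := by
  have h := hasSum_exp_matrix (oscMat K)
  have h22 : HasSum (fun k : ℕ => (((k.factorial : ℝ)⁻¹) • oscMat K ^ k).toBlocks₂₂)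
      (NormedSpace.exp (oscMat K)).toBlocks₂₂ := by
    refine Pi.hasSum.2 fun i => Pi.hasSum.2 fun j => ?_
    exact Pi.hasSum.1 (Pi.hasSum.1 h (Sum.inr i)) (Sum.inr j)
  have hinj : Function.Injective (fun m : ℕ => 2 * m) := fun a b h => by
    simpa using h
  have hz : ∀ k ∉ Set.range (fun m : ℕ => 2 * m),
      (((k.factorial : ℝ)⁻¹) • oscMat K ^ k).toBlocks₂₂ = 0 := by
    intro k hk
    rcases Nat.even_or_odd' k with ⟨m, rfl | rfl⟩
    · exact absurd ⟨m, rfl⟩ hk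
    · rw [oscMat_pow_odd, Matrix.fromBlocks_smul, Matrix.toBlocks_fromBlocks₂₂, smul_zero]
  have h2 := (hinj.hasSum_iff hz).2 h22
  have h3 : HasSum (fun m : ℕ => ((-1 : ℝ) ^ m / (2 * m).factorial) • K ^ m)
      (NormedSpace.exp (oscMat K)).toBlocks₂₂ := by
    convert h2 using 1
    funext m
    simp only [Function.comp_apply, oscMat_pow_even, Matrix.fromBlocks_smul,
      Matrix.toBlocks_fromBlocks₂₂, smul_neg_pow]
  rw [cosSqrt, h3.tsum_eq]
  rfl

/-- `cos √K` and `sin √K / √K` solve the second-order equation `∂²Z = -K Z`. -/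
theorem sinc_cos_unique {A B : ℝ → Matrix (Fin n) (Fin n) ℝ}
    (hA : ∀ t ∈ Set.Icc (0 : ℝ) 1, ∀ i j, HasDerivAt (fun s => A s i j) (B t i j) t)
    (hB : ∀ t ∈ Set.Icc (0 : ℝ) 1, ∀ i j, HasDerivAt (fun s => B s i j) (-(K * A t) i j) t)
    (hA0 : A 0 = 0) (hB0 : B 0 = 1) : A 1 = sincSqrt K ∧ B 1 = cosSqrt K := by
  -- The difference between (A, B) and the last block column of exp(t · `oscMat K`) solves Z₁' = Z₂,
  -- Z₂' = -K Z₁ with zero initial value.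
  have hz := linear_ode_zero
    (Z := fun t => ((fun i j => A t i j - NormedSpace.exp (t • oscMat K) (Sum.inl i) (Sum.inr j),
      fun i j => B t i j - NormedSpace.exp (t • oscMat K) (Sum.inr i) (Sum.inr j)) :
      (Fin n → Fin n → ℝ) × (Fin n → Fin n → ℝ)))
    (LinearMap.toContinuousLinearMap ((LinearMap.snd ℝ _ _).prod
      (-(LinearMap.mulLeft ℝ K) ∘ₗ LinearMap.fst ℝ (Matrix (Fin n) (Fin n) ℝ) _)))
    (fun t ht => by
      refine HasDerivAt.prodMk ?_ ?_
      · refine hasDerivAt_pi.2 fun i => hasDerivAt_pi.2 fun j => ?_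
        convert! (hA t ht i j).sub (hasDerivAt_exp_entry (oscMat K) (Sum.inl i) (Sum.inr j) t)
          using 1
        rw [oscMat_mul_inl]
        rfl
      · refine hasDerivAt_pi.2 fun i => hasDerivAt_pi.2 fun j => ?_
        convert! (hB t ht i j).sub (hasDerivAt_exp_entry (oscMat K) (Sum.inr i) (Sum.inr j) t)
          using 1
        rw [oscMat_mul_inr]
        simp only [Matrix.mul_apply]
        change -(∑ k, K i k * (A t k j - _)) = _
        simp only [mul_sub, Finset.sum_sub_distrib]
        ring)
    (by
      ext i j <;> simp [hA0, hB0, Matrix.one_apply])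
  constructor
  · ext i j
    have := congrFun (congrFun (congrArg Prod.fst hz) i) j
    rw [sincSqrt_eq]
    simpa [sub_eq_zero] using this
  · ext i j
    have := congrFun (congrFun (congrArg Prod.snd hz) i) j
    rw [cosSqrt_eq]
    simpa [sub_eq_zero] using this

end CosSinc

end SymSpace

namespace SymSpace

attribute [local instance] Matrix.normedAddCommGroup Matrix.normedSpace

/-! ### The structure equations along rays -/

section Radial

variable {n p : ℕ}

/-- The coefficients of the spin connection in the holonomy algebra. -/
def spinCoef (g e : Coord n → Matrix (Fin n) (Fin n) ℝ) (β : Matrix (Fin p) (Fin p) ℝ)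
    (E : Fin p → Matrix (Fin n) (Fin n) ℝ) (μ : Fin n) (y : Coord n) : Fin p → ℝ :=
  holCoef β E (spinMat g e μ y)

/-- The coframe component vector `θ_μ = (θ^a_μ)`. -/
def coVec (e : Coord n → Matrix (Fin n) (Fin n) ℝ) (μ : Fin n) (y : Coord n) : Fin n → ℝ :=
  (e y)⁻¹ *ᵥ Pi.single μ 1

theorem sum_smul_single (v : Fin n → ℝ) : ∑ μ, v μ • (Pi.single μ 1 : Fin n → ℝ) = v := by
  ext i; simp [Finset.sum_apply, Pi.single_apply]

namespace IsSymFrame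

variable {U : Set (Coord n)} {g e : Coord n → Matrix (Fin n) (Fin n) ℝ} (S : IsSymFrame U g e)
  {y : Coord n} (hy : y ∈ U)
include S hy

theorem chrMat_mulVec (μ : Fin n) :
    (∑ l, y l • chrMat g l y) *ᵥ Pi.single μ 1 = chrMat g μ y *ᵥ y.ofLp := by
  rw [Matrix.sum_mulVec]
  ext i
  simp only [Finset.sum_apply, Matrix.smul_mulVec, Pi.smul_apply, Matrix.mulVec_single_one,
    smul_eq_mul]
  rw [Matrix.mulVec, dotProduct]
  refine Finset.sum_congr rfl fun l _ => ?_
  change y l * christoffel g i l μ y = christoffel g i μ l y * y l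
  rw [S.christoffel_symm hy]; ring

theorem radial_chrMat : (∑ l, y l • chrMat g l y) *ᵥ y.ofLp = 0 := by
  ext i
  have := S.geodesic y hy i
  rw [Pi.zero_apply, ← this, Matrix.sum_mulVec]
  simp only [Finset.sum_apply, Matrix.smul_mulVec, Pi.smul_apply, smul_eq_mul]
  simp only [Matrix.mulVec, dotProduct, Finset.mul_sum]
  exact Finset.sum_congr rfl fun μ _ => Finset.sum_congr rfl fun ν _ => by
    change y μ * (christoffel g i μ ν y * y ν) = _; ring

theorem radial_coframe : dirD y (fun z => (e z)⁻¹) y = (e y)⁻¹ * ∑ l, y l • chrMat g l y := by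
  rw [dirD_self]
  simp only [S.pd_coframe hy, smul_sub, Finset.sum_sub_distrib, ← smul_mul_assoc, ← Finset.sum_mul,
    S.radial_spinMat hy, Finset.mul_sum, mul_smul_comm]
  simp

theorem cd_coframe_mulVec {v : Coord n → Fin n → ℝ} (hv : ContDiffAt ℝ ∞ v y) :
    ContDiffAt ℝ ∞ (fun z => (e z)⁻¹ *ᵥ v z) y := cd_mulVec (S.cd_coframe hy) hv

/-- Gauss-type lemma. By the geodesic equation f(z) = θ(z)z - z satisfies z∂f = f, so its partial
derivatives are constant along rays. They vanish at the origin, where θ = 1, so f = 0. -/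
theorem coframe_mulVec_self : (e y)⁻¹ *ᵥ y.ofLp = y.ofLp := by
  set f : Coord n → Fin n → ℝ := fun z => (e z)⁻¹ *ᵥ z.ofLp - z.ofLp with hf
  have hcd : ∀ z ∈ U, ContDiffAt ℝ ∞ f z := fun z hz =>
    (S.cd_coframe_mulVec hz cd_ofLp).sub cd_ofLp
  have hd : ∀ v, ∀ z ∈ U, dirD v f z =
      dirD v (fun z => (e z)⁻¹) z *ᵥ z.ofLp + (e z)⁻¹ *ᵥ v.ofLp - v.ofLp := by
    intro v z hz
    rw [hf, dirD_sub (S.cd_coframe_mulVec hz cd_ofLp) cd_ofLp,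
      dirD_mulVec (S.cd_coframe hz) cd_ofLp, dirD_ofLp]
  have hr : ∀ z ∈ U, dirD z f z = f z := by
    intro z hz
    rw [hd z z hz, S.radial_coframe hz, ← Matrix.mulVec_mulVec, S.radial_chrMat hz]
    simp [hf]
  have hp : ∀ μ, ∀ z ∈ U, dirD (cv μ) f z = 0 := by
    intro μ z hz
    have h1 : ∀ z ∈ U, dirD z (dirD (cv μ) f) z = 0 := by
      intro z hz
      have := dirD_radial (v := cv μ) (hcd z hz)
      rw [dirD_congr S.isOpen hz hr] at this
      simpa using this
    rw [eq_zero_value_of_radial S.starConvex (fun z hz => cd_dirD (hcd z hz)) h1 hz,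
      hd _ 0 S.zero_mem, S.coframe_zero, Matrix.one_mulVec]
    simp
  have : f y = 0 := by
    rw [← hr y hy, dirD_self]
    exact Finset.sum_eq_zero fun μ _ => by rw [pd_eq, hp μ y hy, smul_zero]
  exact sub_eq_zero.1 this

theorem pd_coframe_mulVec_self (μ : Fin n) :
    pd μ (fun z => (e z)⁻¹) y *ᵥ y.ofLp = Pi.single μ 1 - coVec e μ y := by
  have h := dirD_mulVec (v := cv μ) (S.cd_coframe hy) (cd_ofLp (y := y))
  rw [dirD_congr S.isOpen hy (fun z hz => S.coframe_mulVec_self hz), dirD_ofLp] at h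
  rw [pd_eq, eq_sub_iff_add_eq, coVec]
  exact h.symm

/-- The torsion-free structure equation contracted with the position vector. The symmetry of the
Christoffel symbols and the derivative of θ(y)y = y remove all Christoffel symbols. -/
theorem radial_coVec (μ : Fin n) :
    dirD y (coVec e μ) y = Pi.single μ 1 - coVec e μ y + spinMat g e μ y *ᵥ y.ofLp := by
  have h1 : dirD y (coVec e μ) y = dirD y (fun z => (e z)⁻¹) y *ᵥ Pi.single μ 1 := by
    have := dirD_mulVec (v := y) (S.cd_coframe hy) (contDiffAt_const (c := (Pi.single μ 1 : Fin n → ℝ)))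
    rw [dirD_const, Matrix.mulVec_zero, add_zero] at this
    exact this
  rw [h1, S.radial_coframe hy, ← Matrix.mulVec_mulVec, S.chrMat_mulVec hy,
    ← S.pd_coframe_mulVec_self hy, S.pd_coframe hy, Matrix.sub_mulVec, Matrix.mulVec_mulVec,
    ← Matrix.mulVec_mulVec _ _ (e y)⁻¹, S.coframe_mulVec_self hy]
  abel

theorem cd_coVec (μ : Fin n) : ContDiffAt ℝ ∞ (coVec e μ) y :=
  cd_mulVec (S.cd_coframe hy) contDiffAt_const

omit S hy in
theorem sum_smul_coVec (v : Fin n → ℝ) : ∑ μ, v μ • coVec e μ y = (e y)⁻¹ *ᵥ v := by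
  conv_rhs => rw [← sum_smul_single v]
  simp only [Matrix.mulVec_sum, Matrix.mulVec_smul, coVec]

variable {β : Matrix (Fin p) (Fin p) ℝ} {E : Fin p → Matrix (Fin n) (Fin n) ℝ}
  (hR : IsCurvatureFactorization β E (fun a b c d => frameRiemann g e a b c d 0))
include hR

theorem spin_curvature_hol (μ ν : Fin n) :
    pd μ (spinMat g e ν) y - pd ν (spinMat g e μ) y
      + (spinMat g e μ y * spinMat g e ν y - spinMat g e ν y * spinMat g e μ y)
    = holMap β E (curvCoef E (coVec e μ y) (coVec e ν y)) := by
  rw [S.spin_curvature_const hy, frameCurv_zero hR]; rfl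

/-- The curvature equation of ω contracted with y^μ. The quadratic terms vanish in the radial gauge,
and differentiating the gauge condition y^μ ω_μ = 0 yields the term -ω_ν. -/
theorem radial_spinMat_eq (ν : Fin n) : dirD y (spinMat g e ν) y =
    - spinMat g e ν y + holMap β E (curvCoef E y.ofLp (coVec e ν y)) := by
  have h1 : ∑ μ, y μ • pd ν (spinMat g e μ) y = - spinMat g e ν y := by
    have h := dirD_sum (v := cv ν) (y := y) (s := Finset.univ)
      (f := fun μ z => z.ofLp μ • spinMat g e μ z)
      (fun μ _ => cd_smul (cd_apply μ cd_ofLp) (S.cd_spinMat hy μ))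
    rw [dirD_congr S.isOpen hy (f' := fun _ => 0) (fun z hz => S.radial_spinMat hz),
      dirD_const] at h
    have e1 : ∀ μ, dirD (cv ν) (fun z : Coord n => z.ofLp μ • spinMat g e μ z) y =
        (Pi.single ν 1 : Fin n → ℝ) μ • spinMat g e μ y + y μ • pd ν (spinMat g e μ) y := by
      intro μ
      rw [dirD_smul (cd_apply μ cd_ofLp) (S.cd_spinMat hy μ), ← dirD_apply μ cd_ofLp, dirD_ofLp]
      rfl
    simp only [e1, Finset.sum_add_distrib] at h
    have e2 : ∑ μ, (Pi.single ν 1 : Fin n → ℝ) μ • spinMat g e μ y = spinMat g e ν y := by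
      simp [Pi.single_apply]
    rw [e2] at h
    exact eq_neg_of_add_eq_zero_right h.symm
  have h2 : ∑ μ, y μ • (pd μ (spinMat g e ν) y - pd ν (spinMat g e μ) y
      + (spinMat g e μ y * spinMat g e ν y - spinMat g e ν y * spinMat g e μ y))
      = holMap β E (curvCoef E y.ofLp (coVec e ν y)) := by
    have e3 := congrArg (fun u => holMap β E (curvCoef E u (coVec e ν y)))
      ((sum_smul_coVec (e := e) (y := y) y.ofLp).trans (S.coframe_mulVec_self hy))
    simp only [map_sum, map_smul, LinearMap.sum_apply, LinearMap.smul_apply] at e3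
    simp only [S.spin_curvature_hol hy hR, e3]
  have e4 : ∑ μ, y μ • (spinMat g e μ y * spinMat g e ν y) = 0 := by
    simp only [← smul_mul_assoc, ← Finset.sum_mul, S.radial_spinMat hy, zero_mul]
  have e5 : ∑ μ, y μ • (spinMat g e ν y * spinMat g e μ y) = 0 := by
    simp only [← mul_smul_comm, ← Finset.mul_sum, S.radial_spinMat hy, mul_zero]
  simp only [smul_add, smul_sub, Finset.sum_add_distrib, Finset.sum_sub_distrib] at h2
  rw [← dirD_self, h1, e4, e5] at h2
  rw [← h2]; abel

/-- The part of ω_ν outside the holonomy algebra satisfies y∂f = -f, since the source R(y, θ_ν) lies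
inside; a smooth solution is zero. -/
theorem spinMat_eq_holMap (ν : Fin n) : spinMat g e ν y = holMap β E (spinCoef g e β E ν y) := by
  have H := S.isHolonomy hR
  set L : Matrix (Fin n) (Fin n) ℝ →ₗ[ℝ] Matrix (Fin n) (Fin n) ℝ :=
    LinearMap.id - holMap β E ∘ₗ holCoef β E with hL
  have hLh : ∀ c, L (holMap β E c) = 0 := by
    intro c; simp [hL, H.holCoef_holMap]
  have := radial_ode_zero S.starConvex (f := fun z => L (spinMat g e ν z))
    (fun z hz => cd_lin L (S.cd_spinMat hz ν)) 0 (fun z hz => by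
      rw [dirD_lin L (S.cd_spinMat hz ν), S.radial_spinMat_eq hz hR, map_add, map_neg, hLh]
      simp) hy
  exact sub_eq_zero.1 this

theorem cd_spinCoef (ν : Fin n) : ContDiffAt ℝ ∞ (spinCoef g e β E ν) y :=
  cd_lin (holCoef β E) (S.cd_spinMat hy ν)

theorem radial_spinCoef (ν : Fin n) : dirD y (spinCoef g e β E ν) y =
    - spinCoef g e β E ν y + curvCoef E y.ofLp (coVec e ν y) := by
  have H := S.isHolonomy hR
  have h := dirD_lin (v := y) (holCoef β E) (S.cd_spinMat hy ν)
  rw [S.radial_spinMat_eq hy hR, map_add, map_neg, H.holCoef_holMap] at h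
  exact h

omit S hy hR in
theorem curv_mulVec_eq (H : IsHolonomy β E) (u : Fin n → ℝ) :
    holMap β E (curvCoef E y.ofLp u) *ᵥ y.ofLp = -(matK β E y *ᵥ u) := by
  ext a
  simp only [Matrix.mulVec, dotProduct, curv_sum H.symm, matK, Matrix.of_apply, Pi.neg_apply,
    Finset.sum_mul]
  rw [sum_rot, ← Finset.sum_neg_distrib]
  refine Finset.sum_congr rfl fun b _ => ?_
  rw [← Finset.sum_neg_distrib]
  refine Finset.sum_congr rfl fun c _ => ?_
  rw [← Finset.sum_neg_distrib]
  refine Finset.sum_congr rfl fun d _ => ?_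
  rw [H.curv_antisymm_right]; ring

/-- The Jacobi equation. For A(t) = t θ(ty) and B(t) with columns e_ν + t ω_ν(ty) y, the radial
structure equations become A' = B and B' = -K A, with A(0) = 0 and B(0) = 1. -/
theorem coframe_eq_sinc : (e y)⁻¹ = sincSqrt (matK β E y) ∧
    (∀ ν, cosSqrt (matK β E y) *ᵥ Pi.single ν 1 = Pi.single ν 1 + spinMat g e ν y *ᵥ y.ofLp) := by
  have H := S.isHolonomy hR
  have hm : ∀ t ∈ Set.Icc (0 : ℝ) 1, t • y ∈ U := fun t ht =>
    smul_mem_of_starConvex S.starConvex hy ht.1 ht.2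
  set A : ℝ → Matrix (Fin n) (Fin n) ℝ := fun t => t • (e (t • y))⁻¹ with hA
  set B : ℝ → Matrix (Fin n) (Fin n) ℝ := fun t => Matrix.of fun i ν =>
    ((Pi.single ν 1 : Fin n → ℝ) + (t • spinMat g e ν (t • y)) *ᵥ y.ofLp) i with hB
  have key := sinc_cos_unique (matK β E y) (A := A) (B := B) ?_ ?_ ?_ ?_
  · constructor
    · rw [← key.1, hA]; simp
    · intro ν
      rw [← key.2, hB]
      ext i
      simp
  · intro t ht i ν
    have h1 := (hasDerivAt_id t).smul (hasDerivAt_ray (S.cd_coVec (hm t ht) ν))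
    have h2 := hasDerivAt_pi.1 h1 i
    have h3 := S.radial_coVec (hm t ht) ν
    rw [dirD_smul_dir] at h3
    convert! h2 using 1
    · funext s
      simp [hA, coVec]
    · have h4 := congrFun h3 i
      simp only [Pi.smul_apply, Pi.add_apply, Pi.sub_apply, id, one_smul] at h4 ⊢
      rw [h4]
      simp [hB, Matrix.smul_mulVec, Matrix.mulVec_smul]
      ring
  · intro t ht i ν
    have h1 := (hasDerivAt_id t).smul (hasDerivAt_ray (S.cd_spinMat (hm t ht) ν))
    have h3 := S.radial_spinMat_eq (hm t ht) hR ν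
    rw [dirD_smul_dir] at h3
    have h4 := ((LinearMap.toContinuousLinearMap (LinearMap.proj i ∘ₗ
      (mulVecBilin (Fin n) ℝ).flip y.ofLp)).hasFDerivAt.comp_hasDerivAt t h1).const_add
      ((Pi.single ν 1 : Fin n → ℝ) i)
    refine h4.congr_deriv ?_
    change ((id t • dirD y (spinMat g e ν) (t • y) + (1 : ℝ) • spinMat g e ν (t • y)) *ᵥ y.ofLp) i
      = _
    rw [id, h3, one_smul, neg_add_cancel_comm]
    have h5 : (matK β E y * A t) i ν = (matK β E y *ᵥ (t • coVec e ν (t • y))) i := by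
      simp [hA, coVec, Matrix.mul_apply, Matrix.mulVec, dotProduct]
    rw [h5, ← Pi.neg_apply, ← curv_mulVec_eq H]
    simp
  · simp [hA]
  · ext i ν
    simp [hB, Matrix.one_apply, Pi.single_apply]

end IsSymFrame

end Radial

end SymSpace

namespace SymSpace

attribute [local instance] Matrix.normedAddCommGroup Matrix.normedSpace

/-! ### Killing transport -/

section Transport

variable {n p : ℕ}

theorem dirD_prodMk {V W : Type*} [NormedAddCommGroup V] [NormedSpace ℝ V]
    [NormedAddCommGroup W] [NormedSpace ℝ W] {f : Coord n → V} {h : Coord n → W} {v y : Coord n}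
    (hf : ContDiffAt ℝ ∞ f y) (hh : ContDiffAt ℝ ∞ h y) :
    dirD v (fun z => (f z, h z)) y = (dirD v f y, dirD v h y) := by
  simp [dirD, (cd_diff hf).fderiv_prodMk (cd_diff hh)]

/-- The Killing transport equations for a vector field with frame components `ξ` and covariant
derivative `D(c)`, along the rays through the origin. -/
structure IsRadialTransport (U : Set (Coord n)) (β : Matrix (Fin p) (Fin p) ℝ)
    (E : Fin p → Matrix (Fin n) (Fin n) ℝ) (ξ : Coord n → Fin n → ℝ) (c : Coord n → Fin p → ℝ) :
    Prop where
  cd_vec : ∀ y ∈ U, ContDiffAt ℝ ∞ ξ y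
  cd_coef : ∀ y ∈ U, ContDiffAt ℝ ∞ c y
  radial_vec : ∀ y ∈ U, dirD y ξ y = holMap β E (c y) *ᵥ y.ofLp
  radial_coef : ∀ y ∈ U, dirD y c y = curvCoef E y.ofLp (ξ y)

/-- The generator of the radial Killing transport. -/
def transportGen (β : Matrix (Fin p) (Fin p) ℝ) (E : Fin p → Matrix (Fin n) (Fin n) ℝ) :
    Coord n →ₗ[ℝ] ((Fin n → ℝ) × (Fin p → ℝ)) →ₗ[ℝ] ((Fin n → ℝ) × (Fin p → ℝ)) :=
  LinearMap.mk₂ ℝ (fun y x => (holMap β E x.2 *ᵥ y.ofLp, curvCoef E y.ofLp x.1))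
    (fun _ _ _ => by simp [Matrix.mulVec_add])
    (fun _ _ _ => by simp [Matrix.mulVec_smul])
    (fun _ _ _ => by simp [Matrix.add_mulVec])
    (fun _ _ _ => by simp [Matrix.smul_mulVec])

variable {U : Set (Coord n)} {β : Matrix (Fin p) (Fin p) ℝ} {E : Fin p → Matrix (Fin n) (Fin n) ℝ}
  {ξ ξ' : Coord n → Fin n → ℝ} {c c' : Coord n → Fin p → ℝ}

theorem cd_holMap_mulVec {y : Coord n} (hc : ContDiffAt ℝ ∞ c y) (hξ : ContDiffAt ℝ ∞ ξ y) :
    ContDiffAt ℝ ∞ (fun z => holMap β E (c z) *ᵥ ξ z) y :=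
  cd_mulVec (cd_lin (holMap β E) hc) hξ

theorem dirD_holMap_mulVec {v y : Coord n} (hc : ContDiffAt ℝ ∞ c y) (hξ : ContDiffAt ℝ ∞ ξ y) :
    dirD v (fun z => holMap β E (c z) *ᵥ ξ z) y =
      holMap β E (dirD v c y) *ᵥ ξ y + holMap β E (c y) *ᵥ dirD v ξ y := by
  rw [dirD_mulVec (cd_lin (holMap β E) hc) hξ, dirD_lin _ hc]

namespace IsRadialTransport

/-- The invariant pairing of two solutions of the radial transport equations is constant. -/
theorem pairing_const (H : IsHolonomy β E) (hs : StarConvex ℝ 0 U)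
    (T : IsRadialTransport U β E ξ c) (T' : IsRadialTransport U β E ξ' c') {y : Coord n}
    (hy : y ∈ U) :
    ξ y ⬝ᵥ ξ' y + holForm β (c y) (c' y) = ξ 0 ⬝ᵥ ξ' 0 + holForm β (c 0) (c' 0) := by
  have h1 : ∀ z ∈ U, ContDiffAt ℝ ∞ (fun z => ξ z ⬝ᵥ ξ' z) z := fun z hz =>
    cd_bilin (dotProductBilin ℝ ℝ) (T.cd_vec z hz) (T'.cd_vec z hz)
  have h2 : ∀ z ∈ U, ContDiffAt ℝ ∞ (fun z => holForm β (c z) (c' z)) z := fun z hz =>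
    cd_bilin (holForm β) (T.cd_coef z hz) (T'.cd_coef z hz)
  refine eq_zero_value_of_radial hs (f := fun z => ξ z ⬝ᵥ ξ' z + holForm β (c z) (c' z))
    (fun z hz => (h1 z hz).add (h2 z hz)) (fun z hz => ?_) hy
  have e1 : dirD z (fun z => ξ z ⬝ᵥ ξ' z) z = dirD z ξ z ⬝ᵥ ξ' z + ξ z ⬝ᵥ dirD z ξ' z :=
    dirD_bilin (dotProductBilin ℝ ℝ) (T.cd_vec z hz) (T'.cd_vec z hz)
  -- By `holForm_curvCoef`, β(R(z,ξ), c') = z·D(c')ξ = -D(c')z·ξ, so the four terms of the radial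
  -- derivative cancel in pairs.
  rw [dirD_add (h1 z hz) (h2 z hz), e1, dirD_bilin (holForm β) (T.cd_coef z hz) (T'.cd_coef z hz),
    T.radial_vec z hz, T'.radial_vec z hz, T.radial_coef z hz, T'.radial_coef z hz,
    H.holForm_curvCoef, H.holForm_symm (c z), H.holForm_curvCoef, H.holMap_dot (c' z) z.ofLp,
    H.holMap_dot (c z) z.ofLp, dotProduct_comm (ξ z)]
  ring

/-- The bracket of two solutions of the radial transport equations is a solution. -/
theorem bracket (H : IsHolonomy β E)
    (T : IsRadialTransport U β E ξ c) (T' : IsRadialTransport U β E ξ' c') :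
    IsRadialTransport U β E (fun z => holMap β E (c' z) *ᵥ ξ z - holMap β E (c z) *ᵥ ξ' z)
      (fun z => curvCoef E (ξ z) (ξ' z) - holBr β E (c z) (c' z)) where
  cd_vec y hy := (cd_holMap_mulVec (T'.cd_coef y hy) (T.cd_vec y hy)).sub
    (cd_holMap_mulVec (T.cd_coef y hy) (T'.cd_vec y hy))
  cd_coef y hy := (cd_bilin (curvCoef E) (T.cd_vec y hy) (T'.cd_vec y hy)).sub
    (cd_bilin (holBr β E) (T.cd_coef y hy) (T'.cd_coef y hy))
  radial_vec y hy := by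
    rw [dirD_sub (cd_holMap_mulVec (T'.cd_coef y hy) (T.cd_vec y hy))
      (cd_holMap_mulVec (T.cd_coef y hy) (T'.cd_vec y hy)),
      dirD_holMap_mulVec (T'.cd_coef y hy) (T.cd_vec y hy),
      dirD_holMap_mulVec (T.cd_coef y hy) (T'.cd_vec y hy), T.radial_vec y hy, T'.radial_vec y hy,
      T.radial_coef y hy, T'.radial_coef y hy, map_sub, H.holMap_holBr, Matrix.sub_mulVec,
      Matrix.sub_mulVec, ← Matrix.mulVec_mulVec, ← Matrix.mulVec_mulVec]
    -- The Bianchi identity expresses R(ξ,ξ')y, demanded by the new coefficient, through the terms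
    -- that come from differentiating c and c'.
    have h := H.bianchi_vec y.ofLp (ξ' y) (ξ y)
    rw [H.curvCoef_antisymm (ξ y) y.ofLp, H.curvCoef_antisymm (ξ' y) (ξ y), map_neg, map_neg,
      Matrix.neg_mulVec, Matrix.neg_mulVec] at h
    have h2 : holMap β E (curvCoef E (ξ y) (ξ' y)) *ᵥ y.ofLp =
      holMap β E (curvCoef E y.ofLp (ξ' y)) *ᵥ ξ y
        - holMap β E (curvCoef E y.ofLp (ξ y)) *ᵥ ξ' y := by
      rw [← sub_eq_zero, ← neg_eq_zero, ← h]; abel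
    rw [h2]; abel
  radial_coef y hy := by
    rw [dirD_sub (cd_bilin (curvCoef E) (T.cd_vec y hy) (T'.cd_vec y hy))
      (cd_bilin (holBr β E) (T.cd_coef y hy) (T'.cd_coef y hy)),
      dirD_bilin (curvCoef E) (T.cd_vec y hy) (T'.cd_vec y hy),
      dirD_bilin (holBr β E) (T.cd_coef y hy) (T'.cd_coef y hy),
      T.radial_vec y hy, T'.radial_vec y hy, T.radial_coef y hy, T'.radial_coef y hy,
      H.holBr_antisymm (curvCoef E y.ofLp (ξ y)), H.holBr_curvCoef, H.holBr_curvCoef, map_sub,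
      H.curvCoef_antisymm (ξ y) (holMap β E (c' y) *ᵥ y.ofLp)]
    abel

end IsRadialTransport

/-- The structure constants are totally antisymmetric. -/
theorem IsHolonomy.pairing_bracket_antisymm (H : IsHolonomy β E) (x₁ x₂ x₃ : Fin n → ℝ)
    (c₁ c₂ c₃ : Fin p → ℝ) :
    (holMap β E c₂ *ᵥ x₁ - holMap β E c₁ *ᵥ x₂) ⬝ᵥ x₃
      + holForm β (curvCoef E x₁ x₂ - holBr β E c₁ c₂) c₃
    = -((holMap β E c₃ *ᵥ x₁ - holMap β E c₁ *ᵥ x₃) ⬝ᵥ x₂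
      + holForm β (curvCoef E x₁ x₃ - holBr β E c₁ c₃) c₂) := by
  simp only [map_sub, LinearMap.sub_apply, sub_dotProduct, H.holForm_curvCoef]
  have h1 := H.holMap_dot c₁ x₂ x₃
  rw [dotProduct_comm] at h1
  rw [H.holForm_holBr c₁ c₂ c₃, H.holForm_symm c₂, H.holMap_dot c₃, H.holMap_dot c₂, h1,
    dotProduct_comm _ x₂]
  rw [dotProduct_comm x₂]
  ring

namespace IsSymFrame

variable {g e : Coord n → Matrix (Fin n) (Fin n) ℝ} (S : IsSymFrame U g e)
  (hR : IsCurvatureFactorization β E (fun a b c d => frameRiemann g e a b c d 0))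
include S hR

/-- Solutions of the radial transport equations satisfy the full Killing transport equations. -/
theorem transport (T : IsRadialTransport U β E ξ c) (ν : Fin n) {y : Coord n} (hy : y ∈ U) :
    pd ν ξ y = -(spinMat g e ν y *ᵥ ξ y) + holMap β E (c y) *ᵥ coVec e ν y ∧
    pd ν c y = -(holBr β E (spinCoef g e β E ν y) (c y)) + curvCoef E (coVec e ν y) (ξ y) := by
  have H := S.isHolonomy hR
  -- `d₁` and `d₂` are the defects of the full transport equations. Differentiating the radial
  -- equations in direction ν and inserting the structure equations gives y∂d = -d + N(y)d with N =
  -- `transportGen`, so d = 0 by `radial_ode_zero`.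
  set d₁ : Coord n → Fin n → ℝ := fun z =>
    dirD (cv ν) ξ z + spinMat g e ν z *ᵥ ξ z - holMap β E (c z) *ᵥ coVec e ν z with hd₁
  set d₂ : Coord n → Fin p → ℝ := fun z =>
    dirD (cv ν) c z + holBr β E (spinCoef g e β E ν z) (c z) - curvCoef E (coVec e ν z) (ξ z)
    with hd₂
  have a1 : ∀ z ∈ U, ContDiffAt ℝ ∞ (dirD (cv ν) ξ) z := fun z hz => cd_dirD (T.cd_vec z hz)
  have a2 : ∀ z ∈ U, ContDiffAt ℝ ∞ (fun z => spinMat g e ν z *ᵥ ξ z) z := fun z hz =>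
    cd_mulVec (S.cd_spinMat hz ν) (T.cd_vec z hz)
  have a3 : ∀ z ∈ U, ContDiffAt ℝ ∞ (fun z => holMap β E (c z) *ᵥ coVec e ν z) z := fun z hz =>
    cd_holMap_mulVec (T.cd_coef z hz) (S.cd_coVec hz ν)
  have b1 : ∀ z ∈ U, ContDiffAt ℝ ∞ (dirD (cv ν) c) z := fun z hz => cd_dirD (T.cd_coef z hz)
  have b2 : ∀ z ∈ U, ContDiffAt ℝ ∞ (fun z => holBr β E (spinCoef g e β E ν z) (c z)) z :=
    fun z hz => cd_bilin _ (S.cd_spinCoef hz hR ν) (T.cd_coef z hz)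
  have b3 : ∀ z ∈ U, ContDiffAt ℝ ∞ (fun z => curvCoef E (coVec e ν z) (ξ z)) z :=
    fun z hz => cd_bilin _ (S.cd_coVec hz ν) (T.cd_vec z hz)
  have c1 : ∀ z ∈ U, ContDiffAt ℝ ∞ d₁ z := fun z hz => ((a1 z hz).add (a2 z hz)).sub (a3 z hz)
  have c2 : ∀ z ∈ U, ContDiffAt ℝ ∞ d₂ z := fun z hz => ((b1 z hz).add (b2 z hz)).sub (b3 z hz)
  have key := radial_ode_zero S.starConvex (f := fun z => (d₁ z, d₂ z))
    (fun z hz => (c1 z hz).prodMk (c2 z hz)) (transportGen β E) (fun z hz => ?_) hy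
  · rw [Prod.mk_eq_zero] at key
    obtain ⟨k1, k2⟩ := key
    constructor
    · rw [pd_eq, ← sub_eq_zero, ← k1, hd₁]; abel_nf
    · rw [pd_eq, ← sub_eq_zero, ← k2, hd₂]; abel_nf
  · have r1 := dirD_radial (v := cv ν) (T.cd_vec z hz)
    rw [dirD_congr S.isOpen hz T.radial_vec, dirD_holMap_mulVec (T.cd_coef z hz) cd_ofLp,
      dirD_ofLp] at r1
    have r2 := dirD_radial (v := cv ν) (T.cd_coef z hz)
    rw [dirD_congr S.isOpen hz T.radial_coef, dirD_bilin (curvCoef E) cd_ofLp (T.cd_vec z hz),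
      dirD_ofLp] at r2
    have hsp := S.spinMat_eq_holMap hz hR ν
    rw [dirD_prodMk (c1 z hz) (c2 z hz)]
    refine Prod.ext ?_ ?_
    · change dirD z d₁ z = - d₁ z + holMap β E (d₂ z) *ᵥ z.ofLp
      rw [hd₁, dirD_sub ((a1 z hz).add (a2 z hz)) (a3 z hz), dirD_add (a1 z hz) (a2 z hz),
        dirD_mulVec (S.cd_spinMat hz ν) (T.cd_vec z hz),
        dirD_holMap_mulVec (T.cd_coef z hz) (S.cd_coVec hz ν), S.radial_spinMat_eq hz hR,
        S.radial_coVec hz, T.radial_vec z hz, T.radial_coef z hz, ← sub_eq_iff_eq_add'.2 r1]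
      have h := H.bianchi_vec z.ofLp (coVec e ν z) (ξ z)
      rw [H.curvCoef_antisymm (ξ z) z.ofLp, map_neg, Matrix.neg_mulVec] at h
      have h2 : holMap β E (curvCoef E z.ofLp (coVec e ν z)) *ᵥ ξ z =
        holMap β E (curvCoef E z.ofLp (ξ z)) *ᵥ coVec e ν z
          - holMap β E (curvCoef E (coVec e ν z) (ξ z)) *ᵥ z.ofLp := by
        rw [← sub_eq_zero, ← h]; abel
      simp only [hd₂, map_add, map_sub, H.holMap_holBr, ← hsp, Matrix.add_mulVec, Matrix.sub_mulVec,
        Matrix.mulVec_add, Matrix.mulVec_sub, Matrix.neg_mulVec, ← Matrix.mulVec_mulVec, h2]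
      have h3 : (cv ν).ofLp = (Pi.single ν 1 : Fin n → ℝ) := rfl
      rw [h3]
      abel
    · change dirD z d₂ z = - d₂ z + curvCoef E z.ofLp (d₁ z)
      rw [hd₂, dirD_sub ((b1 z hz).add (b2 z hz)) (b3 z hz), dirD_add (b1 z hz) (b2 z hz),
        dirD_bilin _ (S.cd_spinCoef hz hR ν) (T.cd_coef z hz),
        dirD_bilin _ (S.cd_coVec hz ν) (T.cd_vec z hz), S.radial_spinCoef hz hR,
        S.radial_coVec hz, T.radial_vec z hz, T.radial_coef z hz, ← sub_eq_iff_eq_add'.2 r2]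
      have h3 : (cv ν).ofLp = (Pi.single ν 1 : Fin n → ℝ) := rfl
      rw [h3, hd₁]
      simp only [map_add, map_sub, map_neg, LinearMap.add_apply, LinearMap.sub_apply,
        LinearMap.neg_apply, H.holBr_antisymm (curvCoef E z.ofLp (coVec e ν z)), H.holBr_curvCoef,
        ← hsp, H.curvCoef_antisymm (coVec e ν z) (holMap β E (c z) *ᵥ z.ofLp)]
      abel

end IsSymFrame

end Transport

end SymSpace

namespace SymSpace

attribute [local instance] Matrix.normedAddCommGroup Matrix.normedSpace

/-! ### The fields ξ_A, their pairing and the completeness relations -/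

section Killing

variable {n p : ℕ}

/-- The frame components of the vector field `ξ_A`. -/
def kilVec (e : Coord n → Matrix (Fin n) (Fin n) ℝ) (β : Matrix (Fin p) (Fin p) ℝ)
    (E : Fin p → Matrix (Fin n) (Fin n) ℝ) (A : Fin n ⊕ Fin p) (y : Coord n) : Fin n → ℝ :=
  (e y)⁻¹ *ᵥ killing β E A y

/-- The coefficients of the covariant derivative of `ξ_A` in the holonomy algebra. -/
def kilCoef (g e : Coord n → Matrix (Fin n) (Fin n) ℝ) (β : Matrix (Fin p) (Fin p) ℝ)
    (E : Fin p → Matrix (Fin n) (Fin n) ℝ) (A : Fin n ⊕ Fin p) (y : Coord n) : Fin p → ℝ :=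
  -- Chosen to solve the radial transport equations with ξ_A; at the origin the values are 0 and
  -- minus the i-th basis vector.
  match A with
  | .inl a => curvCoef E y.ofLp (coVec e a y)
  | .inr i => - Pi.single i 1 - ∑ ν, (holGen β E i *ᵥ y.ofLp) ν • spinCoef g e β E ν y

theorem cosSqrt_commute_sincSqrt (K : Matrix (Fin n) (Fin n) ℝ) :
    Commute (cosSqrt K) (sincSqrt K) :=
  Commute.tsum_left _ fun i => Commute.tsum_right _ fun j =>
    ((Commute.pow_pow (Commute.refl K) i j).smul_left _).smul_right _

namespace IsSymFrame

variable {U : Set (Coord n)} {β : Matrix (Fin p) (Fin p) ℝ} {E : Fin p → Matrix (Fin n) (Fin n) ℝ}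
  {g e : Coord n → Matrix (Fin n) (Fin n) ℝ} (S : IsSymFrame U g e)
  (hR : IsCurvatureFactorization β E (fun a b c d => frameRiemann g e a b c d 0))
include S hR

/-- The coframe is sin √K / √K, which commutes with cos √K. Applied to √K cot √K it leaves cos √K,
whose columns `coframe_eq_sinc` identifies. -/
theorem kilVec_inl (a : Fin n) {y : Coord n} (hy : y ∈ U) :
    kilVec e β E (.inl a) y = Pi.single a 1 + spinMat g e a y *ᵥ y.ofLp := by
  obtain ⟨h1, h2⟩ := S.coframe_eq_sinc hy hR
  have h3 : killing β E (.inl a) y = sqrtCot (matK β E y) *ᵥ Pi.single a 1 := by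
    ext b; simp [killing]
  have hu : IsUnit (sincSqrt (matK β E y)).det := by
    rw [← h1]; exact Matrix.isUnit_nonsing_inv_det _ (S.isUnit_det hy)
  rw [kilVec, h3, h1, sqrtCot, Matrix.mulVec_mulVec, ← mul_assoc,
    ← (cosSqrt_commute_sincSqrt _).eq, mul_assoc, Matrix.mul_nonsing_inv _ hu, mul_one, h2]

omit S hR in
theorem kilVec_inr (i : Fin p) (y : Coord n) :
    kilVec e β E (.inr i) y = - ∑ ν, (holGen β E i *ᵥ y.ofLp) ν • coVec e ν y := by
  have h3 : killing β E (.inr i) y = - (holGen β E i *ᵥ y.ofLp) := by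
    ext b; rfl
  rw [kilVec, h3, Matrix.mulVec_neg, sum_smul_coVec]

/-- The vector fields `ξ_A` satisfy the radial transport equations. -/
theorem kil_radial (A : Fin n ⊕ Fin p) :
    IsRadialTransport U β E (kilVec e β E A) (kilCoef g e β E A) := by
  cases A with
  | inl a =>
    have hv : ∀ y ∈ U, ContDiffAt ℝ ∞ (fun z : Coord n => spinMat g e a z *ᵥ z.ofLp) y :=
      fun y hy => cd_mulVec (S.cd_spinMat hy a) cd_ofLp
    constructor
    · intro y hy
      exact contDiffAt_congr S.isOpen hy (fun z hz => S.kilVec_inl hR a hz)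
        (contDiffAt_const.add (hv y hy))
    · intro y hy
      exact cd_bilin (curvCoef E) cd_ofLp (S.cd_coVec hy a)
    · intro y hy
      rw [dirD_congr S.isOpen hy (fun z hz => S.kilVec_inl hR a hz),
        dirD_add contDiffAt_const (hv y hy), dirD_const,
        dirD_mulVec (S.cd_spinMat hy a) cd_ofLp, dirD_ofLp, S.radial_spinMat_eq hy hR,
        Matrix.add_mulVec, Matrix.neg_mulVec]
      simp only [kilCoef]
      abel
    · intro y hy
      rw [S.kilVec_inl hR a hy]
      change dirD y (fun z : Coord n => curvCoef E z.ofLp (coVec e a z)) y = _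
      rw [dirD_bilin (curvCoef E) cd_ofLp (S.cd_coVec hy a), dirD_ofLp, S.radial_coVec hy,
        map_add, map_sub, map_add]
      abel
  | inr i =>
    have hl : ∀ y ∈ U, ∀ ν, ContDiffAt ℝ ∞ (fun z : Coord n => (holGen β E i *ᵥ z.ofLp) ν) y :=
      fun y hy ν => cd_apply ν (cd_mulVec contDiffAt_const cd_ofLp)
    have hld : ∀ y ∈ U, ∀ ν, dirD y (fun z : Coord n => (holGen β E i *ᵥ z.ofLp) ν) y =
        (holGen β E i *ᵥ y.ofLp) ν := by
      intro y hy ν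
      rw [← dirD_apply (f := fun z : Coord n => holGen β E i *ᵥ z.ofLp) ν
        (cd_mulVec contDiffAt_const cd_ofLp), dirD_mulVec contDiffAt_const cd_ofLp, dirD_const,
        dirD_ofLp, Matrix.zero_mulVec, zero_add]
    have h1 : ∀ y ∈ U, ∀ ν, ContDiffAt ℝ ∞
        (fun z : Coord n => (holGen β E i *ᵥ z.ofLp) ν • coVec e ν z) y :=
      fun y hy ν => cd_smul (hl y hy ν) (S.cd_coVec hy ν)
    have h2 : ∀ y ∈ U, ∀ ν, ContDiffAt ℝ ∞
        (fun z : Coord n => (holGen β E i *ᵥ z.ofLp) ν • spinCoef g e β E ν z) y :=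
      fun y hy ν => cd_smul (hl y hy ν) (S.cd_spinCoef hy hR ν)
    constructor
    · intro y hy
      exact contDiffAt_congr S.isOpen hy (fun z hz => kilVec_inr i z)
        (ContDiffAt.sum fun ν _ => h1 y hy ν).neg
    · intro y hy
      exact contDiffAt_const.sub (ContDiffAt.sum fun ν _ => h2 y hy ν)
    · intro y hy
      rw [dirD_congr S.isOpen hy (fun z hz => kilVec_inr i z), dirD_neg,
        dirD_sum fun ν _ => h1 y hy ν]
      -- D_i z is homogeneous of degree one, so its radial derivative cancels the term -θ_ν of
      -- `radial_coVec`.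
      have e1 : ∀ ν, dirD y (fun z : Coord n => (holGen β E i *ᵥ z.ofLp) ν • coVec e ν z) y =
          (holGen β E i *ᵥ y.ofLp) ν • Pi.single ν 1
            + (holGen β E i *ᵥ y.ofLp) ν • (spinMat g e ν y *ᵥ y.ofLp) := by
        intro ν
        rw [dirD_smul (hl y hy ν) (S.cd_coVec hy ν), hld y hy, S.radial_coVec hy, ← smul_add,
          ← smul_add]
        congr 1; abel
      simp only [e1, Finset.sum_add_distrib, sum_smul_single, kilCoef, map_sub, map_neg, map_sum,
        map_smul, holMap_single, ← S.spinMat_eq_holMap hy hR, Matrix.sub_mulVec,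
        Matrix.neg_mulVec, Matrix.sum_mulVec, Matrix.smul_mulVec]
      abel
    · intro y hy
      change dirD y (fun z : Coord n => - Pi.single i 1
        - ∑ ν, (holGen β E i *ᵥ z.ofLp) ν • spinCoef g e β E ν z) y = _
      rw [dirD_sub contDiffAt_const (ContDiffAt.sum fun ν _ => h2 y hy ν), dirD_const,
        dirD_sum fun ν _ => h2 y hy ν, kilVec_inr]
      have e1 : ∀ ν, dirD y (fun z : Coord n =>
          (holGen β E i *ᵥ z.ofLp) ν • spinCoef g e β E ν z) y =
          (holGen β E i *ᵥ y.ofLp) ν • curvCoef E y.ofLp (coVec e ν y) := by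
        intro ν
        rw [dirD_smul (hl y hy ν) (S.cd_spinCoef hy hR ν), hld y hy, S.radial_spinCoef hy hR,
          ← smul_add]
        congr 1; abel
      simp only [e1, map_neg, map_sum, map_smul, zero_sub]

variable {y : Coord n} (hy : y ∈ U)

omit hR in
include hy in
theorem killing_eq (A : Fin n ⊕ Fin p) : killing β E A y = e y *ᵥ kilVec e β E A y := by
  rw [kilVec, Matrix.mulVec_mulVec, S.mul_inv hy, Matrix.one_mulVec]

include hy

theorem cd_killing (A : Fin n ⊕ Fin p) : ContDiffAt ℝ ∞ (killing β E A) y :=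
  contDiffAt_congr S.isOpen hy (fun _ hz => S.killing_eq hz A)
    (cd_mulVec (S.smooth y hy) ((S.kil_radial hR A).cd_vec y hy))

theorem pd_killing (A : Fin n ⊕ Fin p) (μ : Fin n) : pd μ (killing β E A) y =
    -(chrMat g μ y *ᵥ killing β E A y)
      + e y *ᵥ (holMap β E (kilCoef g e β E A y) *ᵥ coVec e μ y) := by
  rw [pd_eq, dirD_congr S.isOpen hy (fun _ hz => S.killing_eq hz A),
    dirD_mulVec (S.smooth y hy) ((S.kil_radial hR A).cd_vec y hy), ← pd_eq, ← pd_eq,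
    S.pd_frame hy, (S.transport hR (S.kil_radial hR A) μ hy).1, S.killing_eq hy A]
  simp only [Matrix.sub_mulVec, Matrix.mulVec_add, Matrix.mulVec_neg, ← Matrix.mulVec_mulVec]
  abel

/-- The transport equation in coordinates says that ∇ξ_A = e D(c_A) θ; passing to the frame strips e
and θ. The antisymmetry of D(c_A) is the Killing equation. -/
theorem frameNabla_killing (A : Fin n ⊕ Fin p) (a b : Fin n) :
    frameNabla g e (killing β E A) a b y = holMap β E (kilCoef g e β E A y) a b := by
  obtain ⟨N, hN⟩ : ∃ N, N = e y * holMap β E (kilCoef g e β E A y) * (e y)⁻¹ := ⟨_, rfl⟩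
  have h1 : ∀ μ ν, pd ν (fun z => killing β E A z μ) y
      + ∑ l, christoffel g μ ν l y * killing β E A y l = N μ ν := by
    intro μ ν
    have h2 := congrFun (S.pd_killing hR hy A ν) μ
    rw [pd_eq, dirD_apply μ (S.cd_killing hR hy A), ← pd_eq, Pi.add_apply, Pi.neg_apply] at h2
    have h3 : (chrMat g ν y *ᵥ killing β E A y) μ =
      ∑ l, christoffel g μ ν l y * killing β E A y l := rfl
    rw [h2, h3, neg_add_cancel_comm, coVec, Matrix.mulVec_mulVec, Matrix.mulVec_mulVec, hN]
    simp
  have h4 : holMap β E (kilCoef g e β E A y) = (e y)⁻¹ * (N * e y) := by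
    rw [hN, mul_assoc _ _ (e y), S.inv_mul hy, mul_one, ← mul_assoc, S.inv_mul hy, one_mul]
  simp only [frameNabla, h1, h4, Matrix.mul_apply, Finset.mul_sum]
  exact Finset.sum_congr rfl fun μ _ => Finset.sum_congr rfl fun ν _ => by ring

/-- The pairing is constant, and at the origin the pairs (ξ_A, c_A) are the basis (e_a, 0), (0,
-e_i). -/
theorem kil_pairing (A B : Fin n ⊕ Fin p) :
    kilVec e β E A y ⬝ᵥ kilVec e β E B y + holForm β (kilCoef g e β E A y) (kilCoef g e β E B y)
      = gam n β A B := by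
  rw [(S.kil_radial hR A).pairing_const (S.isHolonomy hR) S.starConvex (S.kil_radial hR B) hy]
  have v1 : ∀ a : Fin n, kilVec e β E (.inl a) 0 = Pi.single a 1 := fun a => by
    rw [S.kilVec_inl hR a S.zero_mem]; simp
  have v2 : ∀ i : Fin p, kilVec e β E (.inr i) 0 = 0 := fun i => by
    rw [kilVec_inr]; simp
  have c1 : ∀ a : Fin n, kilCoef g e β E (.inl a) 0 = 0 := fun a => by simp [kilCoef]
  have c2 : ∀ i : Fin p, kilCoef g e β E (.inr i) 0 = - Pi.single i 1 := fun i => by simp [kilCoef]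
  cases A <;> cases B <;>
    simp [v1, v2, c1, c2, gam, Matrix.one_apply, Pi.single_apply, holForm_apply, eq_comm,
      Matrix.mulVec_neg]

end IsSymFrame

/-- The pairs `(ξ_A, c_A)`, as the rows of a matrix. -/
def kilMat (g e : Coord n → Matrix (Fin n) (Fin n) ℝ) (β : Matrix (Fin p) (Fin p) ℝ)
    (E : Fin p → Matrix (Fin n) (Fin n) ℝ) (y : Coord n) :
    Matrix (Fin n ⊕ Fin p) (Fin n ⊕ Fin p) ℝ :=
  Matrix.of fun A => Sum.elim (kilVec e β E A y) (kilCoef g e β E A y)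

theorem sum_bilin_of_congr {ι V : Type*} [Fintype ι] [DecidableEq ι] [AddCommGroup V] [Module ℝ V]
    {X G G' : Matrix ι ι ℝ} (h : Xᵀ * G * X = G') (T : (ι → ℝ) →ₗ[ℝ] (ι → ℝ) →ₗ[ℝ] V) :
    ∑ A, ∑ B, G A B • T (X A) (X B) = ∑ I, ∑ J, G' I J • T (Pi.single I 1) (Pi.single J 1) := by
  have hx : ∀ A, X A = ∑ I, X A I • (Pi.single I 1 : ι → ℝ) := fun A => by
    ext J; simp [Finset.sum_apply, Pi.single_apply]
  have h1 : ∀ A B, G A B • T (X A) (X B) = ∑ I, ∑ J, (X A I * G A B * X B J) •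
      T (Pi.single I 1) (Pi.single J 1) := by
    intro A B
    conv_lhs => rw [hx A, hx B]
    simp only [map_sum, map_smul, LinearMap.sum_apply, LinearMap.smul_apply, Finset.smul_sum,
      smul_smul]
    rw [Finset.sum_comm]
    exact Finset.sum_congr rfl fun I _ => Finset.sum_congr rfl fun J _ => by congr 1; ring
  simp only [h1]
  rw [sum_pair_comm]
  refine Finset.sum_congr rfl fun I _ => Finset.sum_congr rfl fun J _ => ?_
  rw [← h]
  simp only [Matrix.mul_apply, Matrix.transpose_apply, Finset.sum_mul, Finset.sum_smul]
  rw [Finset.sum_comm]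

theorem gam_inv (β : Matrix (Fin p) (Fin p) ℝ) (hβ : IsUnit β.det) :
    (gam n β)⁻¹ = Matrix.fromBlocks 1 0 0 β⁻¹ := by
  refine Matrix.inv_eq_right_inv ?_
  rw [gam, Matrix.fromBlocks_multiply]
  simp [Matrix.mul_nonsing_inv _ hβ]

namespace IsSymFrame

variable {U : Set (Coord n)} {β : Matrix (Fin p) (Fin p) ℝ} {E : Fin p → Matrix (Fin n) (Fin n) ℝ}
  {g e : Coord n → Matrix (Fin n) (Fin n) ℝ} (S : IsSymFrame U g e)
  (hR : IsCurvatureFactorization β E (fun a b c d => frameRiemann g e a b c d 0))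
  {y : Coord n} (hy : y ∈ U)
include S hR hy

theorem kilMat_gram : kilMat g e β E y * gam n β * (kilMat g e β E y)ᵀ = gam n β := by
  ext A B
  rw [← S.kil_pairing hR hy A B]
  simp [Matrix.mul_apply, kilMat, gam, Fintype.sum_sum_type, dotProduct, holForm_apply,
    Matrix.mulVec, Matrix.one_apply, Finset.sum_mul, Finset.mul_sum, mul_assoc]
  rw [Finset.sum_comm]

theorem gam_det : IsUnit (gam n β).det := by
  rw [gam, Matrix.det_fromBlocks_zero₂₁]
  simpa using hR.nondegenerate

theorem kilMat_dual :
    gam n β * (kilMat g e β E y)ᵀ * (gam n β)⁻¹ * kilMat g e β E y = 1 := by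
  have h : kilMat g e β E y * (gam n β * (kilMat g e β E y)ᵀ * (gam n β)⁻¹) = 1 := by
    rw [← mul_assoc, ← mul_assoc, S.kilMat_gram hR hy, Matrix.mul_nonsing_inv _ (S.gam_det hR hy)]
  exact mul_eq_one_comm.1 h

/-- Completeness: for square X the relation XγXᵀ = γ inverts to Xᵀγ⁻¹X = γ⁻¹. Its blocks are the
contraction formulas below. -/
theorem kilMat_gram_inv : (kilMat g e β E y)ᵀ * (gam n β)⁻¹ * kilMat g e β E y = (gam n β)⁻¹ := by
  have h := congrArg ((gam n β)⁻¹ * ·) (S.kilMat_dual hR hy)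
  simp only [mul_assoc, mul_one] at h
  rw [← mul_assoc (gam n β)⁻¹, Matrix.nonsing_inv_mul _ (S.gam_det hR hy), one_mul] at h
  rw [mul_assoc, h]

variable {V : Type*} [AddCommGroup V] [Module ℝ V]

theorem sum_kilVec_kilVec (T : (Fin n → ℝ) →ₗ[ℝ] (Fin n → ℝ) →ₗ[ℝ] V) :
    ∑ A, ∑ B, (gam n β)⁻¹ A B • T (kilVec e β E A y) (kilVec e β E B y) =
      ∑ a, T (Pi.single a 1) (Pi.single a 1) := by
  have h := sum_bilin_of_congr (S.kilMat_gram_inv hR hy)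
    (T.compl₁₂ (LinearMap.funLeft ℝ ℝ Sum.inl) (LinearMap.funLeft ℝ ℝ Sum.inl))
  refine h.trans ?_
  have e1 : ∀ a : Fin n, LinearMap.funLeft ℝ ℝ Sum.inl
    (Pi.single (Sum.inl a) 1 : Fin n ⊕ Fin p → ℝ) = Pi.single a 1 := fun a => by
      ext b; simp [LinearMap.funLeft_apply, Pi.single_apply]
  have e2 : ∀ i : Fin p, LinearMap.funLeft ℝ ℝ Sum.inl
    (Pi.single (Sum.inr i) 1 : Fin n ⊕ Fin p → ℝ) = 0 := fun a => by
      ext b; simp [LinearMap.funLeft_apply]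
  simp [gam_inv β hR.nondegenerate, Fintype.sum_sum_type, e1, e2, Matrix.one_apply]

theorem sum_kilVec_kilCoef (T : (Fin n → ℝ) →ₗ[ℝ] (Fin p → ℝ) →ₗ[ℝ] V) :
    ∑ A, ∑ B, (gam n β)⁻¹ A B • T (kilVec e β E A y) (kilCoef g e β E B y) = 0 := by
  have h := sum_bilin_of_congr (S.kilMat_gram_inv hR hy)
    (T.compl₁₂ (LinearMap.funLeft ℝ ℝ Sum.inl) (LinearMap.funLeft ℝ ℝ Sum.inr))
  refine h.trans ?_
  have e1 : ∀ a : Fin n, LinearMap.funLeft ℝ ℝ Sum.inr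
    (Pi.single (Sum.inl a) 1 : Fin n ⊕ Fin p → ℝ) = 0 := fun a => by
      ext b; simp [LinearMap.funLeft_apply]
  have e2 : ∀ i : Fin p, LinearMap.funLeft ℝ ℝ Sum.inl
    (Pi.single (Sum.inr i) 1 : Fin n ⊕ Fin p → ℝ) = 0 := fun a => by
      ext b; simp [LinearMap.funLeft_apply]
  simp [gam_inv β hR.nondegenerate, Fintype.sum_sum_type, e1, e2]

theorem sum_kilCoef_kilCoef (T : (Fin p → ℝ) →ₗ[ℝ] (Fin p → ℝ) →ₗ[ℝ] V) :
    ∑ A, ∑ B, (gam n β)⁻¹ A B • T (kilCoef g e β E A y) (kilCoef g e β E B y) =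
      ∑ i, ∑ j, β⁻¹ i j • T (Pi.single i 1) (Pi.single j 1) := by
  have h := sum_bilin_of_congr (S.kilMat_gram_inv hR hy)
    (T.compl₁₂ (LinearMap.funLeft ℝ ℝ Sum.inr) (LinearMap.funLeft ℝ ℝ Sum.inr))
  refine h.trans ?_
  have e1 : ∀ a : Fin n, LinearMap.funLeft ℝ ℝ Sum.inr
    (Pi.single (Sum.inl a) 1 : Fin n ⊕ Fin p → ℝ) = 0 := fun a => by
      ext b; simp [LinearMap.funLeft_apply]
  have e2 : ∀ i : Fin p, LinearMap.funLeft ℝ ℝ Sum.inr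
    (Pi.single (Sum.inr i) 1 : Fin n ⊕ Fin p → ℝ) = Pi.single i 1 := fun a => by
      ext b; simp [LinearMap.funLeft_apply, Pi.single_apply]
  simp [gam_inv β hR.nondegenerate, Fintype.sum_sum_type, e1, e2]

/-- The pairs `(ξ_A, c_A)` form a basis; the expansion of a pair `(x, c)`. -/
theorem kil_expand (x : Fin n → ℝ) (c : Fin p → ℝ) :
    x = ∑ D, ∑ C, ((gam n β)⁻¹ D C * (x ⬝ᵥ kilVec e β E D y
        + holForm β c (kilCoef g e β E D y))) • kilVec e β E C y ∧
    c = ∑ D, ∑ C, ((gam n β)⁻¹ D C * (x ⬝ᵥ kilVec e β E D y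
        + holForm β c (kilCoef g e β E D y))) • kilCoef g e β E C y := by
  set X := kilMat g e β E y with hX
  have h1 : ∀ D, (Sum.elim x c ᵥ* (gam n β * Xᵀ)) D =
      x ⬝ᵥ kilVec e β E D y + holForm β c (kilCoef g e β E D y) := by
    intro D
    rw [← Matrix.vecMul_vecMul]
    simp [Matrix.vecMul, dotProduct, gam, Fintype.sum_sum_type, Matrix.one_apply, holForm_apply,
      Matrix.mulVec, Finset.sum_mul, Finset.mul_sum, mul_assoc, hX, kilMat]
    rw [Finset.sum_comm]
  have h2 : ∀ I, Sum.elim x c I = ∑ D, ∑ C, ((gam n β)⁻¹ D C * (x ⬝ᵥ kilVec e β E D y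
        + holForm β c (kilCoef g e β E D y))) * X C I := by
    intro I
    have h := congrArg (fun M => (Sum.elim x c ᵥ* M) I) (S.kilMat_dual hR hy)
    simp only [Matrix.vecMul_one] at h
    rw [← h, ← hX, ← Matrix.vecMul_vecMul, ← Matrix.vecMul_vecMul]
    change ∑ C, (∑ D, (Sum.elim x c ᵥ* (gam n β * Xᵀ)) D * (gam n β)⁻¹ D C) * X C I = _
    simp only [h1, Finset.sum_mul]
    rw [Finset.sum_comm]
    exact Finset.sum_congr rfl fun D _ => Finset.sum_congr rfl fun C _ => by ring
  constructor
  · ext a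
    simpa [Finset.sum_apply, hX, kilMat] using h2 (.inl a)
  · ext i
    simpa [Finset.sum_apply, hX, kilMat] using h2 (.inr i)

end IsSymFrame

end Killing

end SymSpace

namespace SymSpace

attribute [local instance] Matrix.normedAddCommGroup Matrix.normedSpace

/-! ### The commutation relations of a parallel gauge curvature -/

section Gauge

variable {n p : ℕ} {𝕜 κ : Type*} [RCLike 𝕜] [Fintype κ]

theorem biForm_self {W : Type*} [AddCommGroup W] [Module ℝ W]
    (G : (Fin n → ℝ) →ₗ[ℝ] (Fin n → ℝ) →ₗ[ℝ] W) :
    biForm (fun a b => G (Pi.single a 1) (Pi.single b 1)) = G :=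
  biForm_eq_of_single fun a b => biForm_single _ a b

/-- The curvature of the gauge connection as a bilinear form on frame vectors. -/
def gaugeForm (e : Coord n → Matrix (Fin n) (Fin n) ℝ) (𝓐 : Fin n → Coord n → Matrix κ κ 𝕜)
    (y : Coord n) : (Fin n → ℝ) →ₗ[ℝ] (Fin n → ℝ) →ₗ[ℝ] Matrix κ κ 𝕜 :=
  biForm fun a b => frameGaugeCurv e 𝓐 a b y

theorem gaugeForm_eq (e : Coord n → Matrix (Fin n) (Fin n) ℝ)
    (𝓐 : Fin n → Coord n → Matrix κ κ 𝕜) (y : Coord n) (u v : Fin n → ℝ) :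
    gaugeForm e 𝓐 y u v = biForm (fun μ ν => gaugeCurv 𝓐 μ ν y) (e y *ᵥ u) (e y *ᵥ v) := by
  have h : gaugeForm e 𝓐 y = (biForm (fun μ ν => gaugeCurv 𝓐 μ ν y)).compl₁₂
      (e y).mulVecLin (e y).mulVecLin := by
    refine biForm_eq_of_single fun a b => ?_
    rw [gaugeForm, biForm_single]
    simp [frameGaugeCurv, biForm_apply]
  rw [h]; rfl

/-- The covariant derivative of an endomorphism of the gauge bundle. -/
def gaugeD (𝓐 : Fin n → Coord n → Matrix κ κ 𝕜) (μ : Fin n) (f : Coord n → Matrix κ κ 𝕜)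
    (y : Coord n) : Matrix κ κ 𝕜 := pd μ f y + (𝓐 μ y * f y - f y * 𝓐 μ y)

/-- A smooth gauge connection with covariantly constant curvature. -/
structure IsParallelGauge (U : Set (Coord n)) (g : Coord n → Matrix (Fin n) (Fin n) ℝ)
    (𝓐 : Fin n → Coord n → Matrix κ κ 𝕜) : Prop where
  smooth : ∀ y ∈ U, ∀ μ, ContDiffAt ℝ ∞ (𝓐 μ) y
  parallel : ∀ y ∈ U, ∀ l μ ν, nablaGaugeCurv g 𝓐 l μ ν y = 0

variable {U : Set (Coord n)} {g e : Coord n → Matrix (Fin n) (Fin n) ℝ}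
  {𝓐 : Fin n → Coord n → Matrix κ κ 𝕜} {y : Coord n}

theorem gaugeForm_antisymm (u v : Fin n → ℝ) :
    gaugeForm e 𝓐 y u v = - gaugeForm e 𝓐 y v u := by
  have h : ∀ μ ν, gaugeCurv 𝓐 μ ν y = - gaugeCurv 𝓐 ν μ y := fun μ ν => by
    simp only [gaugeCurv]; abel
  rw [gaugeForm_eq, gaugeForm_eq, biForm_apply, biForm_apply, Finset.sum_comm,
    ← Finset.sum_neg_distrib]
  refine Finset.sum_congr rfl fun μ _ => ?_
  rw [← Finset.sum_neg_distrib]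
  refine Finset.sum_congr rfl fun ν _ => ?_
  rw [h ν μ, smul_neg, mul_comm]

namespace IsParallelGauge

variable (P : IsParallelGauge U g 𝓐) (hU : IsOpen U) (hy : y ∈ U)
include P hy

theorem gaugeCurv_eq (μ ν : Fin n) : gaugeCurv 𝓐 μ ν y =
    pd μ (𝓐 ν) y - pd ν (𝓐 μ) y + (𝓐 μ y * 𝓐 ν y - 𝓐 ν y * 𝓐 μ y) := by
  rw [gaugeCurv, matPd_eq (P.smooth y hy _), matPd_eq (P.smooth y hy _)]

theorem gaugeD_comm {f : Coord n → Matrix κ κ 𝕜} (hf : ContDiffAt ℝ ∞ f y) (μ ν : Fin n) :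
    gaugeD 𝓐 μ (gaugeD 𝓐 ν f) y - gaugeD 𝓐 ν (gaugeD 𝓐 μ f) y =
      gaugeCurv 𝓐 μ ν y * f y - f y * gaugeCurv 𝓐 μ ν y := by
  have h : ∀ μ ν, pd μ (gaugeD 𝓐 ν f) y = dirD (cv μ) (dirD (cv ν) f) y +
      (pd μ (𝓐 ν) y * f y + 𝓐 ν y * pd μ f y - (pd μ f y * 𝓐 ν y + f y * pd μ (𝓐 ν) y)) := by
    intro μ ν
    have h1 := cd_mul (P.smooth y hy ν) hf
    have h2 := cd_mul hf (P.smooth y hy ν)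
    change dirD (cv μ) (fun z => dirD (cv ν) f z + (𝓐 ν z * f z - f z * 𝓐 ν z)) y = _
    rw [dirD_add (cd_dirD hf) (h1.sub h2), dirD_sub h1 h2, dirD_mul (P.smooth y hy ν) hf,
      dirD_mul hf (P.smooth y hy ν)]
    rfl
  have h' : ∀ μ ν, gaugeD 𝓐 μ (gaugeD 𝓐 ν f) y = pd μ (gaugeD 𝓐 ν f) y
    + (𝓐 μ y * gaugeD 𝓐 ν f y - gaugeD 𝓐 ν f y * 𝓐 μ y) := fun _ _ => rfl
  rw [h', h', h, h, P.gaugeCurv_eq hy, dirD_comm hf]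
  simp only [gaugeD, mul_add, add_mul, mul_sub, sub_mul, mul_assoc]
  abel

include hU

theorem cd_gaugeCurv (μ ν : Fin n) : ContDiffAt ℝ ∞ (gaugeCurv 𝓐 μ ν) y := by
  have hA := P.smooth y hy
  exact contDiffAt_congr hU hy (fun z hz => P.gaugeCurv_eq hz μ ν)
    (((cd_pd (hA ν)).sub (cd_pd (hA μ))).add ((cd_mul (hA μ) (hA ν)).sub (cd_mul (hA ν) (hA μ))))

theorem pd_gaugeCurv (l μ ν : Fin n) : pd l (gaugeCurv 𝓐 μ ν) y
      - ∑ k, (christoffel g k l μ y • gaugeCurv 𝓐 k ν y + christoffel g k l ν y • gaugeCurv 𝓐 μ k y)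
      + (𝓐 l y * gaugeCurv 𝓐 μ ν y - gaugeCurv 𝓐 μ ν y * 𝓐 l y) = 0 := by
  rw [← P.parallel y hy l μ ν, nablaGaugeCurv, matPd_eq (P.cd_gaugeCurv hU hy μ ν)]

end IsParallelGauge

namespace IsSymFrame

variable (S : IsSymFrame U g e) (P : IsParallelGauge U g 𝓐) (hy : y ∈ U)
include S P hy

theorem cd_gaugeForm_const (u v : Fin n → ℝ) :
    ContDiffAt ℝ ∞ (fun z => gaugeForm e 𝓐 z u v) y := by
  simp only [gaugeForm_eq]
  exact cd_biForm (fun μ ν => P.cd_gaugeCurv S.isOpen hy μ ν) (S.cd_mulVec_const hy u)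
    (S.cd_mulVec_const hy v)

theorem gaugeD_gaugeForm_const (l : Fin n) (u v : Fin n → ℝ) :
    gaugeD 𝓐 l (fun z => gaugeForm e 𝓐 z u v) y =
      gaugeForm e 𝓐 y (spinMat g e l y *ᵥ u) v + gaugeForm e 𝓐 y u (spinMat g e l y *ᵥ v) := by
  simp only [gaugeD, gaugeForm_eq]
  exact S.pd_frame_twoForm hy (fun μ ν => P.cd_gaugeCurv S.isOpen hy μ ν) l
    (fun μ ν => P.pd_gaugeCurv S.isOpen hy l μ ν) u v

variable {u v : Coord n → Fin n → ℝ} (hu : ContDiffAt ℝ ∞ u y) (hv : ContDiffAt ℝ ∞ v y)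
include hu hv

theorem cd_gaugeForm : ContDiffAt ℝ ∞ (fun z => gaugeForm e 𝓐 z (u z) (v z)) y :=
  cd_biForm (fun a b => by
    simpa [gaugeForm, biForm_single] using
      S.cd_gaugeForm_const P hy (Pi.single a 1) (Pi.single b 1)) hu hv

/-- The frame components of the gauge curvature are covariantly constant. -/
theorem gaugeD_gaugeForm (l : Fin n) :
    gaugeD 𝓐 l (fun z => gaugeForm e 𝓐 z (u z) (v z)) y =
      gaugeForm e 𝓐 y (pd l u y + spinMat g e l y *ᵥ u y) (v y)
        + gaugeForm e 𝓐 y (u y) (pd l v y + spinMat g e l y *ᵥ v y) := by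
  classical
  have hT : ∀ a b, ContDiffAt ℝ ∞ (frameGaugeCurv e 𝓐 a b) y := fun a b => by
    simpa [gaugeForm, biForm_single] using
      S.cd_gaugeForm_const P hy (Pi.single a 1) (Pi.single b 1)
  have hd : ∀ u v, biForm (fun a b => dirD (cv l) (frameGaugeCurv e 𝓐 a b) y) u v =
      gaugeForm e 𝓐 y (spinMat g e l y *ᵥ u) v + gaugeForm e 𝓐 y u (spinMat g e l y *ᵥ v)
      - (𝓐 l y * gaugeForm e 𝓐 y u v - gaugeForm e 𝓐 y u v * 𝓐 l y) := by
    intro u v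
    set G : (Fin n → ℝ) →ₗ[ℝ] (Fin n → ℝ) →ₗ[ℝ] Matrix κ κ 𝕜 :=
      (gaugeForm e 𝓐 y).compl₁₂ (spinMat g e l y).mulVecLin LinearMap.id
      + (gaugeForm e 𝓐 y).compl₁₂ LinearMap.id (spinMat g e l y).mulVecLin
      - (gaugeForm e 𝓐 y).compr₂ (LinearMap.mulLeft ℝ (𝓐 l y) - LinearMap.mulRight ℝ (𝓐 l y))
      with hG
    have h : biForm (fun a b => dirD (cv l) (frameGaugeCurv e 𝓐 a b) y) = G := by
      refine biForm_eq_of_single fun a b => ?_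
      have h1 := S.gaugeD_gaugeForm_const P hy l (Pi.single a 1) (Pi.single b 1)
      rw [gaugeD] at h1
      have h2 : (fun z => gaugeForm e 𝓐 z (Pi.single a 1) (Pi.single b 1)) =
        frameGaugeCurv e 𝓐 a b := by funext z; rw [gaugeForm, biForm_single]
      rw [h2] at h1
      rw [biForm_single, ← pd_eq, eq_sub_of_add_eq h1, hG]
      rfl
    rw [h, hG]
    rfl
  have h1 := dirD_biForm (x := cv l) hT hu hv
  rw [gaugeD, pd_eq]
  simp only [gaugeForm] at h1 ⊢
  rw [h1, hd]
  simp only [gaugeForm, map_add, LinearMap.add_apply, pd_eq]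
  abel

omit hu hv u v
variable {β : Matrix (Fin p) (Fin p) ℝ} {E : Fin p → Matrix (Fin n) (Fin n) ℝ}
  (hR : IsCurvatureFactorization β E (fun a b c d => frameRiemann g e a b c d 0))
include hR

/-- The commutation relations of the gauge curvature. -/
theorem gaugeForm_comm (u v w z : Fin n → ℝ) :
    gaugeForm e 𝓐 y u v * gaugeForm e 𝓐 y w z - gaugeForm e 𝓐 y w z * gaugeForm e 𝓐 y u v =
      gaugeForm e 𝓐 y (holMap β E (curvCoef E u v) *ᵥ w) z
        + gaugeForm e 𝓐 y w (holMap β E (curvCoef E u v) *ᵥ z) := by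
  classical
  set F := gaugeForm e 𝓐 y with hF
  -- [∇_μ,∇_ν] is applied to the endomorphism 𝓕(w,z) in two ways: by the Ricci identity, and by ∇𝓕 =
  -- 0, which lets the curvature of the spin connection act on w and z.
  have hco : ∀ μ ν, gaugeCurv 𝓐 μ ν y * F w z - F w z * gaugeCurv 𝓐 μ ν y =
      F (holMap β E (curvCoef E (coVec e μ y) (coVec e ν y)) *ᵥ w) z
        + F w (holMap β E (curvCoef E (coVec e μ y) (coVec e ν y)) *ᵥ z) := by
    intro μ ν
    have hw : ∀ ν (w : Fin n → ℝ), ContDiffAt ℝ ∞ (fun x => spinMat g e ν x *ᵥ w) y := fun ν w =>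
      cd_mulVec (S.cd_spinMat hy ν) contDiffAt_const
    have hpw : ∀ μ ν (w : Fin n → ℝ), pd μ (fun x => spinMat g e ν x *ᵥ w) y =
        pd μ (spinMat g e ν) y *ᵥ w := fun μ ν w => by
      rw [pd_eq, dirD_mulVec (S.cd_spinMat hy ν) contDiffAt_const, dirD_const, Matrix.mulVec_zero,
        add_zero, pd_eq]
    have h2 : ∀ μ ν, gaugeD 𝓐 μ (gaugeD 𝓐 ν fun x => gaugeForm e 𝓐 x w z) y =
        F (pd μ (spinMat g e ν) y *ᵥ w + spinMat g e μ y *ᵥ (spinMat g e ν y *ᵥ w)) z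
          + F (spinMat g e ν y *ᵥ w) (spinMat g e μ y *ᵥ z)
          + (F (spinMat g e μ y *ᵥ w) (spinMat g e ν y *ᵥ z)
          + F w (pd μ (spinMat g e ν) y *ᵥ z + spinMat g e μ y *ᵥ (spinMat g e ν y *ᵥ z))) := by
      intro μ ν
      have h3 := S.gaugeD_gaugeForm P hy (hw ν w) (contDiffAt_const (c := z)) μ
      have h4 := S.gaugeD_gaugeForm P hy (contDiffAt_const (c := w)) (hw ν z) μ
      have c3 := S.cd_gaugeForm P hy (hw ν w) (contDiffAt_const (c := z))
      have c4 := S.cd_gaugeForm P hy (contDiffAt_const (c := w)) (hw ν z)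
      have hc : ∀ w : Fin n → ℝ, pd μ (fun _ : Coord n => w) y = 0 := fun w => dirD_const w
      rw [hpw, hc, zero_add] at h3 h4
      rw [← h3, ← h4]
      simp only [gaugeD]
      rw [pd_eq, dirD_congr S.isOpen hy (fun x hx => S.gaugeD_gaugeForm_const P hx ν w z),
        dirD_add c3 c4]
      have h5 := S.gaugeD_gaugeForm_const P hy ν w z
      rw [gaugeD] at h5
      rw [h5]
      simp only [pd_eq, mul_add, add_mul]
      abel
    have h6 := P.gaugeD_comm hy (S.cd_gaugeForm_const P hy w z) μ ν
    rw [h2, h2] at h6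
    rw [← h6, ← S.spin_curvature_hol hy hR μ ν]
    simp only [Matrix.add_mulVec, Matrix.sub_mulVec, Matrix.mulVec_mulVec, map_add, map_sub,
      LinearMap.add_apply, LinearMap.sub_apply]
    abel
  set L : (Fin n → ℝ) →ₗ[ℝ] (Fin n → ℝ) →ₗ[ℝ] Matrix κ κ 𝕜 :=
    F.compr₂ (LinearMap.mulRight ℝ (F w z) - LinearMap.mulLeft ℝ (F w z)) with hL
  set G₁ : Matrix (Fin n) (Fin n) ℝ →ₗ[ℝ] Matrix κ κ 𝕜 :=
    (F.flip z) ∘ₗ (mulVecBilin (Fin n) ℝ).flip w + (F w) ∘ₗ (mulVecBilin (Fin n) ℝ).flip z with hG₁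
  have key : L.compl₁₂ (e y)⁻¹.mulVecLin (e y)⁻¹.mulVecLin =
      ((curvCoef E).compr₂ (G₁ ∘ₗ holMap β E)).compl₁₂ (e y)⁻¹.mulVecLin (e y)⁻¹.mulVecLin := by
    refine biForm_eq_of_single fun μ ν => ?_
    have h7 : F (coVec e μ y) (coVec e ν y) = gaugeCurv 𝓐 μ ν y := by
      rw [hF, gaugeForm_eq, coVec, coVec, Matrix.mulVec_mulVec, Matrix.mulVec_mulVec, S.mul_inv hy,
        Matrix.one_mulVec, Matrix.one_mulVec, biForm_single]
    have h8 := hco μ ν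
    rw [← h7] at h8
    exact h8
  have h9 := LinearMap.congr_fun₂ key (e y *ᵥ u) (e y *ᵥ v)
  simp only [LinearMap.compl₁₂_apply, Matrix.mulVecLin_apply, Matrix.mulVec_mulVec, S.inv_mul hy,
    Matrix.one_mulVec] at h9
  exact h9

end IsSymFrame

end Gauge

end SymSpace

namespace SymSpace

attribute [local instance] Matrix.normedAddCommGroup Matrix.normedSpace

/-! ### Splitting of the gauge curvature and existence of X -/

section GaugeGenerator

variable {n p : ℕ} {𝕜 κ : Type*} [RCLike 𝕜] [Fintype κ] {U : Set (Coord n)}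
  {g e : Coord n → Matrix (Fin n) (Fin n) ℝ} {𝓐 : Fin n → Coord n → Matrix κ κ 𝕜} {y : Coord n}
  {β : Matrix (Fin p) (Fin p) ℝ} {E : Fin p → Matrix (Fin n) (Fin n) ℝ}

theorem sum_mul_smul_gaugeForm (A B : Matrix (Fin n) (Fin n) ℝ) (a b : Fin n) :
    ∑ c, ∑ d, (A c a * B d b) • frameGaugeCurv e 𝓐 c d y =
      gaugeForm e 𝓐 y (A *ᵥ Pi.single a 1) (B *ᵥ Pi.single b 1) := by
  simp [gaugeForm, biForm_apply]

theorem flatCurv_eq (a b : Fin n) : flatCurv e β E 𝓐 a b y =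
    gaugeForm e 𝓐 y (flatProj β E *ᵥ Pi.single a 1) (flatProj β E *ᵥ Pi.single b 1) :=
  sum_mul_smul_gaugeForm _ _ a b

theorem semiCurv_eq (a b : Fin n) : semiCurv e β E 𝓐 a b y =
    gaugeForm e 𝓐 y ((1 - flatProj β E) *ᵥ Pi.single a 1)
      ((1 - flatProj β E) *ᵥ Pi.single b 1) :=
  sum_mul_smul_gaugeForm _ _ a b

/-- The matrix of a real linear functional of the gauge curvature. -/
def gaugeMat (e : Coord n → Matrix (Fin n) (Fin n) ℝ) (𝓐 : Fin n → Coord n → Matrix κ κ 𝕜)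
    (y : Coord n) (l : Matrix κ κ 𝕜 →ₗ[ℝ] ℝ) : Matrix (Fin n) (Fin n) ℝ :=
  Matrix.of fun a b => l (frameGaugeCurv e 𝓐 a b y)

theorem mul_gaugeMat_mul (l : Matrix κ κ 𝕜 →ₗ[ℝ] ℝ) (A B : Matrix (Fin n) (Fin n) ℝ)
    (a b : Fin n) : (Aᵀ * gaugeMat e 𝓐 y l * B) a b =
      l (gaugeForm e 𝓐 y (A *ᵥ Pi.single a 1) (B *ᵥ Pi.single b 1)) := by
  rw [← sum_mul_smul_gaugeForm]
  simp only [map_sum, map_smul, Matrix.mul_apply, Finset.sum_mul, Matrix.transpose_apply, gaugeMat,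
    Matrix.of_apply, smul_eq_mul]
  rw [Finset.sum_comm]
  exact Finset.sum_congr rfl fun c _ => Finset.sum_congr rfl fun d _ => by ring

theorem gaugeMat_transpose (l : Matrix κ κ 𝕜 →ₗ[ℝ] ℝ) :
    (gaugeMat e 𝓐 y l)ᵀ = - gaugeMat e 𝓐 y l := by
  ext a b
  have h := gaugeForm_antisymm (e := e) (𝓐 := 𝓐) (y := y) (Pi.single b 1) (Pi.single a 1)
  rw [gaugeForm, biForm_single, biForm_single] at h
  simp [gaugeMat, h]

/-- Real functionals separate points; this reduces the matrix-valued gauge curvature to the real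
two-forms `gaugeMat`. -/
theorem eq_of_forall_functional {V : Type*} [AddCommGroup V] [Module ℝ V] {x x' : V}
    (h : ∀ l : V →ₗ[ℝ] ℝ, l x = l x') : x = x' := by
  rw [← sub_eq_zero, ← Module.forall_dual_apply_eq_zero_iff ℝ]
  intro l
  rw [map_sub, h, sub_self]

/-- The representation `c ↦ (1/2) D(c)_{ab} X_{ab}` of the holonomy algebra. -/
def gaugeRep (β : Matrix (Fin p) (Fin p) ℝ) (E : Fin p → Matrix (Fin n) (Fin n) ℝ)
    (x : Fin n → Fin n → Matrix κ κ 𝕜) : (Fin p → ℝ) →ₗ[ℝ] Matrix κ κ 𝕜 where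
  toFun c := (1 / 2 : ℝ) • ∑ a, ∑ b, holMap β E c a b • x a b
  map_add' c c' := by
    simp only [map_add, Matrix.add_apply, add_smul, Finset.sum_add_distrib, smul_add]
  map_smul' t c := by
    simp only [map_smul, Matrix.smul_apply, smul_eq_mul, mul_smul, ← Finset.smul_sum,
      RingHom.id_apply]
    rw [smul_comm]

theorem gaugeRep_apply (x : Fin n → Fin n → Matrix κ κ 𝕜) (c : Fin p → ℝ) :
    gaugeRep β E x c = (1 / 2 : ℝ) • ∑ a, ∑ b, holMap β E c a b • x a b := rfl

namespace IsSymFrame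

variable (S : IsSymFrame U g e) (P : IsParallelGauge U g 𝓐) (hy : y ∈ U)
  (hR : IsCurvatureFactorization β E (fun a b c d => frameRiemann g e a b c d 0))
include S P hy hR

/-- By `gaugeForm_comm` the first summand is the functional of [𝓕_cd, 𝓕_ab], odd under exchange of
the pairs. This is the hypothesis on `f` in `semi_mem_holonomy`. -/
theorem gaugeMat_parallel (l : Matrix κ κ 𝕜 →ₗ[ℝ] ℝ) (a b c d : Fin n) :
    (gaugeMat e 𝓐 y l * holMap β E (curvCoef E (Pi.single c 1) (Pi.single d 1))
      - holMap β E (curvCoef E (Pi.single c 1) (Pi.single d 1)) * gaugeMat e 𝓐 y l) a b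
    + (gaugeMat e 𝓐 y l * holMap β E (curvCoef E (Pi.single a 1) (Pi.single b 1))
      - holMap β E (curvCoef E (Pi.single a 1) (Pi.single b 1)) * gaugeMat e 𝓐 y l) c d = 0 := by
  classical
  have H := S.isHolonomy hR
  have key : ∀ a b c d : Fin n,
      (gaugeMat e 𝓐 y l * holMap β E (curvCoef E (Pi.single c 1) (Pi.single d 1))
      - holMap β E (curvCoef E (Pi.single c 1) (Pi.single d 1)) * gaugeMat e 𝓐 y l) a b =
      l (gaugeForm e 𝓐 y (Pi.single c 1) (Pi.single d 1)
        * gaugeForm e 𝓐 y (Pi.single a 1) (Pi.single b 1)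
        - gaugeForm e 𝓐 y (Pi.single a 1) (Pi.single b 1)
        * gaugeForm e 𝓐 y (Pi.single c 1) (Pi.single d 1)) := by
    intro a b c d
    rw [S.gaugeForm_comm P hy hR]
    set R := holMap β E (curvCoef E (Pi.single c 1) (Pi.single d 1)) with hRd
    have h1 := mul_gaugeMat_mul (e := e) (𝓐 := 𝓐) (y := y) l 1 R a b
    have h2 := mul_gaugeMat_mul (e := e) (𝓐 := 𝓐) (y := y) l R 1 a b
    rw [Matrix.transpose_one, one_mul, Matrix.one_mulVec] at h1
    rw [hRd, H.holMap_transpose, ← hRd, mul_one, Matrix.one_mulVec, neg_mul] at h2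
    rw [map_add, ← h1, ← h2, Matrix.sub_apply, Matrix.neg_apply]
    ring
  rw [key, key, ← map_add, sub_add_sub_cancel, sub_self, map_zero]

theorem gaugeForm_flatProj_left (u v : Fin n → ℝ) :
    gaugeForm e 𝓐 y (flatProj β E *ᵥ u) v =
      gaugeForm e 𝓐 y (flatProj β E *ᵥ u) (flatProj β E *ᵥ v) := by
  have H := S.isHolonomy hR
  have h : (gaugeForm e 𝓐 y).compl₁₂ (flatProj β E).mulVecLin LinearMap.id =
      (gaugeForm e 𝓐 y).compl₁₂ (flatProj β E).mulVecLin (flatProj β E).mulVecLin := by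
    refine biForm_eq_of_single fun a b => ?_
    refine eq_of_forall_functional fun l => ?_
    have h1 := mul_gaugeMat_mul (e := e) (𝓐 := 𝓐) (y := y) l (flatProj β E) 1 a b
    have h2 := mul_gaugeMat_mul (e := e) (𝓐 := 𝓐) (y := y) l (flatProj β E) (flatProj β E) a b
    rw [flatProj_transpose, ← H.flatProj_mul_eq (S.gaugeMat_parallel P hy hR l)] at h2
    rw [flatProj_transpose, mul_one, h2, Matrix.one_mulVec] at h1
    exact h1.symm
  exact LinearMap.congr_fun₂ h u v

theorem gaugeForm_flatProj_right (u v : Fin n → ℝ) :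
    gaugeForm e 𝓐 y u (flatProj β E *ᵥ v) =
      gaugeForm e 𝓐 y (flatProj β E *ᵥ u) (flatProj β E *ᵥ v) := by
  rw [gaugeForm_antisymm, S.gaugeForm_flatProj_left P hy hR, gaugeForm_antisymm, neg_neg]

/-- The decomposition of the gauge curvature in its semisimple and flat parts. -/
theorem gaugeForm_decomp (u v : Fin n → ℝ) :
    gaugeForm e 𝓐 y u v = gaugeForm e 𝓐 y ((1 - flatProj β E) *ᵥ u) ((1 - flatProj β E) *ᵥ v)
      + gaugeForm e 𝓐 y (flatProj β E *ᵥ u) (flatProj β E *ᵥ v) := by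
  simp only [Matrix.sub_mulVec, Matrix.one_mulVec, map_sub, LinearMap.sub_apply]
  rw [S.gaugeForm_flatProj_left P hy hR u v, S.gaugeForm_flatProj_right P hy hR u v]
  abel

/-- The flat part of the gauge curvature commutes with the gauge curvature. -/
theorem flat_gaugeForm_comm (u v w z : Fin n → ℝ) :
    gaugeForm e 𝓐 y (flatProj β E *ᵥ u) (flatProj β E *ᵥ v) * gaugeForm e 𝓐 y w z =
      gaugeForm e 𝓐 y w z * gaugeForm e 𝓐 y (flatProj β E *ᵥ u) (flatProj β E *ᵥ v) := by
  have h := S.gaugeForm_comm P hy hR (flatProj β E *ᵥ u) (flatProj β E *ᵥ v) w z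
  rw [(S.isHolonomy hR).curvCoef_flatProj] at h
  simp only [map_zero, Matrix.zero_mulVec, LinearMap.zero_apply, add_zero] at h
  exact sub_eq_zero.1 h

end IsSymFrame

/-- The `E k` are antisymmetric, so antisymmetrizing the dual matrices does not change their
pairings. -/
theorem IsHolonomy.exists_antisymm_dual (H : IsHolonomy β E) :
    ∃ N : Fin p → Matrix (Fin n) (Fin n) ℝ, (∀ j, (N j)ᵀ = - N j) ∧
      ∀ j k, ∑ a, ∑ b, N j a b * E k a b = if j = k then 1 else 0 := by
  obtain ⟨M, hM⟩ := H.exists_dual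
  refine ⟨fun j => (1 / 2 : ℝ) • (M j - (M j)ᵀ), fun j => ?_, fun j k => ?_⟩
  · rw [Matrix.transpose_smul, Matrix.transpose_sub, Matrix.transpose_transpose, ← smul_neg,
      neg_sub]
  · have h1 : ∑ a, ∑ b, M j b a * E k a b = - ∑ a, ∑ b, M j a b * E k a b := by
      rw [Finset.sum_comm, ← Finset.sum_neg_distrib]
      refine Finset.sum_congr rfl fun b _ => ?_
      rw [← Finset.sum_neg_distrib]
      refine Finset.sum_congr rfl fun a _ => ?_
      have := congrFun (congrFun (H.antisymm k) b) a
      simp only [Matrix.transpose_apply, Matrix.neg_apply] at this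
      rw [this]; ring
    have h2 : ∀ a b, ((1 / 2 : ℝ) • (M j - (M j)ᵀ)) a b * E k a b =
        (1 / 2) * (M j a b * E k a b) - (1 / 2) * (M j b a * E k a b) := fun a b => by
      simp only [Matrix.smul_apply, Matrix.sub_apply, Matrix.transpose_apply, smul_eq_mul]; ring
    simp only [h2, Finset.sum_sub_distrib, ← Finset.mul_sum, h1, hM]
    ring

/-- The semisimple part of the gauge curvature is generated by an antisymmetric family. -/
theorem IsSymFrame.exists_gaugeGenerator (S : IsSymFrame U g e) (P : IsParallelGauge U g 𝓐)
    (hR : IsCurvatureFactorization β E (fun a b c d => frameRiemann g e a b c d 0)) :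
    ∃ X, IsGaugeGenerator e β E 𝓐 X U := by
  classical
  have H := S.isHolonomy hR
  obtain ⟨N, hN, hNE⟩ := H.exists_antisymm_dual
  set Y : Coord n → Fin p → Matrix κ κ 𝕜 := fun y k => ∑ a, ∑ b, N k a b • semiCurv e β E 𝓐 a b y
    with hY
  -- Each functional of the semisimple part lies in the holonomy algebra, hence is a combination of
  -- the `E k`. The dual matrices recover its coefficients uniformly in the functional, as those of
  -- `Y`.
  have hE : ∀ y ∈ U, ∀ a b, semiCurv e β E 𝓐 a b y = ∑ k, E k a b • Y y k := by
    intro y hy a b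
    refine eq_of_forall_functional fun l => ?_
    obtain ⟨c, hc⟩ := H.semi_mem_holonomy (S.gaugeMat_parallel P hy hR l) (gaugeMat_transpose l)
    have h1 : ∀ a b, l (semiCurv e β E 𝓐 a b y) = holMap β E c a b := by
      intro a b
      rw [← hc, semiCurv_eq, ← mul_gaugeMat_mul, Matrix.transpose_sub, Matrix.transpose_one,
        flatProj_transpose]
    have h2 : ∀ a b, holMap β E c a b = ∑ k, (-∑ i, c i * β i k) * E k a b := by
      intro a b
      simp only [holMap_apply, holGen, Matrix.sum_apply, Matrix.smul_apply, Matrix.neg_apply,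
        smul_eq_mul, mul_neg, neg_mul, Finset.sum_neg_distrib, Finset.mul_sum, Finset.sum_mul]
      rw [Finset.sum_comm]
      simp only [mul_assoc]
    have h3 : ∀ k, l (Y y k) = -∑ i, c i * β i k := by
      intro k
      simp only [hY, map_sum, map_smul, h1, h2, smul_eq_mul, Finset.mul_sum]
      have : ∀ a b j, N k a b * ((-∑ i, c i * β i j) * E j a b) =
        (-∑ i, c i * β i j) * (N k a b * E j a b) := fun _ _ _ => by ring
      simp only [this]
      rw [Finset.sum_congr rfl fun a _ => Finset.sum_comm, Finset.sum_comm]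
      simp only [← Finset.mul_sum, hNE]
      simp
    simp only [map_sum, map_smul, h3, h1, h2, smul_eq_mul, mul_comm]
  -- Contracting the curvature with N_j gives β_{jl} E^l, so the factor 2β⁻¹ compensates both the
  -- one half and β.
  refine ⟨fun y c d => ∑ j, ∑ k, (2 * β⁻¹ j k * N j c d) • Y y k, fun y hy a b => ?_,
    fun y hy a b => ?_⟩
  · simp only [← Finset.sum_neg_distrib]
    refine Finset.sum_congr rfl fun j _ => Finset.sum_congr rfl fun k _ => ?_
    have := congrFun (congrFun (hN j) b) a
    simp only [Matrix.transpose_apply, Matrix.neg_apply] at this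
    rw [this, mul_neg, neg_smul]
  · rw [hE y hy]
    have h1 : ∀ j, ∑ c, ∑ d, curv β E c d a b * N j c d = ∑ l, β j l * E l a b := by
      intro j
      simp only [curv, Finset.sum_mul]
      rw [sum_pair_comm]
      have : ∀ i l c d, β i l * E i c d * E l a b * N j c d =
        (β i l * E l a b) * (N j c d * E i c d) := fun _ _ _ _ => by ring
      simp only [this, ← Finset.mul_sum, hNE]
      simp
    have h2 : ∑ c, ∑ d, curv β E c d a b • ∑ j, ∑ k, (2 * β⁻¹ j k * N j c d) • Y y k =
        ∑ j, ∑ k, ∑ c, ∑ d, (2 * β⁻¹ j k * (curv β E c d a b * N j c d)) • Y y k := by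
      simp only [Finset.smul_sum, smul_smul]
      rw [sum_pair_comm]
      exact Finset.sum_congr rfl fun j _ => Finset.sum_congr rfl fun k _ =>
        Finset.sum_congr rfl fun c _ => Finset.sum_congr rfl fun d _ => by congr 1; ring
    rw [h2, Finset.sum_comm, Finset.smul_sum]
    refine Finset.sum_congr rfl fun k _ => ?_
    simp only [← Finset.sum_smul, ← Finset.mul_sum, h1, smul_smul]
    congr 1
    have h3 : ∀ l, ∑ j, β⁻¹ k j * β j l = (1 : Matrix (Fin p) (Fin p) ℝ) k l := fun l => by
      rw [← Matrix.nonsing_inv_mul β H.nondegenerate]; rfl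
    have h4 : ∀ j, 2 * β⁻¹ j k * ∑ l, β j l * E l a b =
        2 * ∑ l, (β⁻¹ k j * β j l) * E l a b := fun j => by
      rw [H.inv_symm j k, mul_assoc, Finset.mul_sum]
      simp only [mul_assoc]
    simp only [h4, ← Finset.mul_sum]
    rw [Finset.sum_comm]
    simp only [← Finset.sum_mul, h3, Matrix.one_apply]
    simp

end GaugeGenerator

end SymSpace

namespace SymSpace

attribute [local instance] Matrix.normedAddCommGroup Matrix.normedSpace

/-! ### The representation of the holonomy algebra on 𝓦 -/

section LinearFamily

variable {n p : ℕ} {V : Type*} [NormedAddCommGroup V] [NormedSpace ℝ V]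
  {L : Coord n → (Fin p → ℝ) →ₗ[ℝ] V} {c : Coord n → Fin p → ℝ} {v y : Coord n}

theorem linear_apply_eq_sum (f : (Fin p → ℝ) →ₗ[ℝ] V) (c : Fin p → ℝ) :
    f c = ∑ i, c i • f (Pi.single i 1) := by
  conv_lhs => rw [← sum_smul_single c]
  simp

theorem cd_linear_family (hL : ∀ c, ContDiffAt ℝ ∞ (fun z => L z c) y) (hc : ContDiffAt ℝ ∞ c y) :
    ContDiffAt ℝ ∞ (fun z => L z (c z)) y := by
  have h : (fun z => L z (c z)) = fun z => ∑ i, c z i • L z (Pi.single i 1) :=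
    funext fun z => linear_apply_eq_sum _ _
  rw [h]
  exact ContDiffAt.sum fun i _ => cd_smul (cd_apply i hc) (hL _)

theorem dirD_linear_family (hL : ∀ c, ContDiffAt ℝ ∞ (fun z => L z c) y)
    (hc : ContDiffAt ℝ ∞ c y) :
    dirD v (fun z => L z (c z)) y = dirD v (fun z => L z (c y)) y + L y (dirD v c y) := by
  have h : (fun z => L z (c z)) = fun z => ∑ i, c z i • L z (Pi.single i 1) :=
    funext fun z => linear_apply_eq_sum _ _
  have h' : (fun z => L z (c y)) = fun z => ∑ i, c y i • L z (Pi.single i 1) :=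
    funext fun z => linear_apply_eq_sum _ _
  rw [h, h', dirD_sum fun i _ => cd_smul (cd_apply i hc) (hL _),
    dirD_sum fun i _ => cd_smul contDiffAt_const (hL _), linear_apply_eq_sum (L y),
    ← Finset.sum_add_distrib]
  refine Finset.sum_congr rfl fun i _ => ?_
  rw [dirD_smul (cd_apply i hc) (hL _), dirD_const_smul _ (hL _), dirD_apply i hc, add_comm]

end LinearFamily

section GaugeRep

variable {n p : ℕ} {𝕜 κ : Type*} [RCLike 𝕜] [Fintype κ] {U : Set (Coord n)}
  {g e : Coord n → Matrix (Fin n) (Fin n) ℝ} {𝓐 : Fin n → Coord n → Matrix κ κ 𝕜} {y : Coord n}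
  {β : Matrix (Fin p) (Fin p) ℝ} {E : Fin p → Matrix (Fin n) (Fin n) ℝ}
  {X : Coord n → Fin n → Fin n → Matrix κ κ 𝕜}

theorem gaugeD_add {f f' : Coord n → Matrix κ κ 𝕜} (hf : ContDiffAt ℝ ∞ f y)
    (hf' : ContDiffAt ℝ ∞ f' y) (l : Fin n) :
    gaugeD 𝓐 l (fun z => f z + f' z) y = gaugeD 𝓐 l f y + gaugeD 𝓐 l f' y := by
  simp only [gaugeD]
  rw [pd_eq, dirD_add hf hf', ← pd_eq, ← pd_eq, mul_add, add_mul]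
  abel

theorem gaugeD_const_smul {f : Coord n → Matrix κ κ 𝕜} (hf : ContDiffAt ℝ ∞ f y) (t : ℝ)
    (l : Fin n) : gaugeD 𝓐 l (fun z => t • f z) y = t • gaugeD 𝓐 l f y := by
  classical
  simp only [gaugeD]
  rw [pd_eq, dirD_const_smul _ hf, ← pd_eq, smul_add, smul_sub, mul_smul_comm, smul_mul_assoc]

theorem gaugeD_mul {f f' : Coord n → Matrix κ κ 𝕜} (hf : ContDiffAt ℝ ∞ f y)
    (hf' : ContDiffAt ℝ ∞ f' y) (l : Fin n) :
    gaugeD 𝓐 l (fun z => f z * f' z) y = gaugeD 𝓐 l f y * f' y + f y * gaugeD 𝓐 l f' y := by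
  simp only [gaugeD]
  rw [pd_eq, dirD_mul hf hf', ← pd_eq, ← pd_eq]
  noncomm_ring

namespace IsSymFrame

variable (S : IsSymFrame U g e) (P : IsParallelGauge U g 𝓐) (hy : y ∈ U)
  (hR : IsCurvatureFactorization β E (fun a b c d => frameRiemann g e a b c d 0))
  (hX : IsGaugeGenerator e β E 𝓐 X U)

theorem _root_.SymSpace.IsHolonomy.curvCoef_semi (H : IsHolonomy β E) (u v : Fin n → ℝ) :
    curvCoef E ((1 - flatProj β E) *ᵥ u) ((1 - flatProj β E) *ᵥ v) = curvCoef E u v := by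
  simp only [Matrix.sub_mulVec, Matrix.one_mulVec, map_sub, LinearMap.sub_apply,
    H.curvCoef_flatProj, sub_zero]
  rw [H.curvCoef_antisymm u (flatProj β E *ᵥ v), H.curvCoef_flatProj, neg_zero, sub_zero]

include hy hR hX in
-- The defining relation of X, read on the curvature coefficients. As these span, `gaugeRep` is the
-- same for every X and inherits smoothness, derivatives and commutators from 𝓕.
theorem gaugeRep_curv (u v : Fin n → ℝ) : gaugeRep β E (X y) (curvCoef E u v) =
    gaugeForm e 𝓐 y ((1 - flatProj β E) *ᵥ u) ((1 - flatProj β E) *ᵥ v) := by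
  have h : (curvCoef E).compr₂ (gaugeRep β E (X y)) = (gaugeForm e 𝓐 y).compl₁₂
      (1 - flatProj β E).mulVecLin (1 - flatProj β E).mulVecLin := by
    refine biForm_eq_of_single fun a b => ?_
    have h1 := hX.semi y hy a b
    rw [semiCurv_eq] at h1
    refine Eq.trans ?_ h1.symm
    rw [LinearMap.compr₂_apply, gaugeRep_apply]
    congr 1
    refine Finset.sum_congr rfl fun c _ => Finset.sum_congr rfl fun d _ => ?_
    rw [curv_sum hR.symm]
    simp [Pi.single_apply]
  exact LinearMap.congr_fun₂ h u v

include S P hy hR hX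

theorem cd_gaugeRep (c : Fin p → ℝ) : ContDiffAt ℝ ∞ (fun z => gaugeRep β E (X z) c) y := by
  refine (S.isHolonomy hR).curvCoef_induction
    (P := fun c => ContDiffAt ℝ ∞ (fun z => gaugeRep β E (X z) c) y) (fun u v => ?_)
    (fun c c' h1 h2 => ?_) (fun t c h1 => ?_) c
  · exact contDiffAt_congr S.isOpen hy (fun z hz => gaugeRep_curv hz hR hX u v)
      (S.cd_gaugeForm_const P hy _ _)
  · simp only [map_add]; exact h1.add h2
  · simp only [map_smul]; exact cd_smul contDiffAt_const h1

/-- On a curvature transformation the map is 𝓕(hu,hv), whose derivative lets ω_l act on the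
arguments. Since ω_l is in the holonomy algebra it commutes with h. -/
theorem gaugeD_gaugeRep (c : Fin p → ℝ) (l : Fin n) :
    gaugeD 𝓐 l (fun z => gaugeRep β E (X z) c) y =
      gaugeRep β E (X y) (holBr β E (spinCoef g e β E l y) c) := by
  have H := S.isHolonomy hR
  refine H.curvCoef_induction
    (P := fun c => gaugeD 𝓐 l (fun z => gaugeRep β E (X z) c) y =
      gaugeRep β E (X y) (holBr β E (spinCoef g e β E l y) c)) (fun u v => ?_)
    (fun c c' h1 h2 => ?_) (fun t c h1 => ?_) c
  · have h1 : ∀ w, spinMat g e l y *ᵥ ((1 - flatProj β E) *ᵥ w) =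
        (1 - flatProj β E) *ᵥ (spinMat g e l y *ᵥ w) := by
      intro w
      rw [Matrix.mulVec_mulVec, Matrix.mulVec_mulVec, S.spinMat_eq_holMap hy hR, mul_sub, sub_mul,
        holMap_mul_flatProj, H.flatProj_mul_holMap, mul_one, one_mul]
    have h2 : gaugeD 𝓐 l (fun z => gaugeRep β E (X z) (curvCoef E u v)) y =
        gaugeD 𝓐 l (fun z => gaugeForm e 𝓐 z ((1 - flatProj β E) *ᵥ u)
          ((1 - flatProj β E) *ᵥ v)) y := by
      rw [gaugeD, gaugeD, pd_eq, dirD_congr S.isOpen hy (fun z hz => gaugeRep_curv hz hR hX u v),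
        gaugeRep_curv hy hR hX, pd_eq]
    rw [h2, S.gaugeD_gaugeForm_const P hy, h1, h1, H.holBr_curvCoef, map_add,
      gaugeRep_curv hy hR hX, gaugeRep_curv hy hR hX, S.spinMat_eq_holMap hy hR]
  · have e1 := S.cd_gaugeRep P hy hR hX c
    have e2 := S.cd_gaugeRep P hy hR hX c'
    simp only [map_add]
    rw [gaugeD_add e1 e2, h1, h2]
  · simp only [map_smul]
    rw [gaugeD_const_smul (S.cd_gaugeRep P hy hR hX c), h1]

/-- By double induction on curvature transformations this is `gaugeForm_comm`, because D(c) commutes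
with h. -/
theorem gaugeRep_comm (c c' : Fin p → ℝ) :
    gaugeRep β E (X y) c * gaugeRep β E (X y) c' - gaugeRep β E (X y) c' * gaugeRep β E (X y) c =
      gaugeRep β E (X y) (holBr β E c c') := by
  classical
  have H := S.isHolonomy hR
  set r := gaugeRep β E (X y) with hr
  refine H.curvCoef_induction (P := fun c => r c * r c' - r c' * r c = r (holBr β E c c'))
    (fun u v => ?_) (fun a b h1 h2 => ?_) (fun t a h1 => ?_) c
  · refine H.curvCoef_induction (P := fun c' => r (curvCoef E u v) * r c' - r c' * r (curvCoef E u v)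
      = r (holBr β E (curvCoef E u v) c')) (fun w z => ?_) (fun a b h1 h2 => ?_)
      (fun t a h1 => ?_) c'
    · rw [H.holBr_curvCoef, map_add, hr, gaugeRep_curv hy hR hX, gaugeRep_curv hy hR hX,
        gaugeRep_curv hy hR hX, gaugeRep_curv hy hR hX, S.gaugeForm_comm P hy hR, H.curvCoef_semi]
      have h1 : ∀ c w, holMap β E c *ᵥ ((1 - flatProj β E) *ᵥ w) =
          (1 - flatProj β E) *ᵥ (holMap β E c *ᵥ w) := by
        intro c w
        rw [Matrix.mulVec_mulVec, Matrix.mulVec_mulVec, mul_sub, sub_mul,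
          holMap_mul_flatProj, H.flatProj_mul_holMap, mul_one, one_mul]
      rw [h1, h1]
    · rw [map_add, map_add, map_add, ← h1, ← h2, mul_add, add_mul]; abel
    · rw [map_smul, map_smul, map_smul, ← h1, mul_smul_comm, smul_mul_assoc, smul_sub]
  · rw [map_add, map_add, LinearMap.add_apply, map_add, ← h1, ← h2, mul_add, add_mul]; abel
  · rw [map_smul, map_smul, LinearMap.smul_apply, map_smul, ← h1, mul_smul_comm, smul_mul_assoc,
      smul_sub]

theorem flat_gaugeRep_comm (u v : Fin n → ℝ) (c : Fin p → ℝ) :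
    gaugeForm e 𝓐 y (flatProj β E *ᵥ u) (flatProj β E *ᵥ v) * gaugeRep β E (X y) c =
      gaugeRep β E (X y) c * gaugeForm e 𝓐 y (flatProj β E *ᵥ u) (flatProj β E *ᵥ v) := by
  classical
  set B := gaugeForm e 𝓐 y (flatProj β E *ᵥ u) (flatProj β E *ᵥ v) with hB
  refine (S.isHolonomy hR).curvCoef_induction (P := fun c => B * gaugeRep β E (X y) c =
    gaugeRep β E (X y) c * B) (fun w z => ?_) (fun a b h1 h2 => ?_) (fun t a h1 => ?_) c
  · rw [gaugeRep_curv hy hR hX, hB, S.flat_gaugeForm_comm P hy hR]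
  · rw [map_add, mul_add, add_mul, h1, h2]
  · rw [map_smul, mul_smul_comm, smul_mul_assoc, h1]

omit hX in
/-- The flat part of the gauge curvature is covariantly constant along Killing fields. -/
theorem gaugeD_flat {ξ ξ' : Coord n → Fin n → ℝ} {c c' : Coord n → Fin p → ℝ}
    (T : IsRadialTransport U β E ξ c) (T' : IsRadialTransport U β E ξ' c') (l : Fin n) :
    gaugeD 𝓐 l (fun z => gaugeForm e 𝓐 z (flatProj β E *ᵥ ξ z) (flatProj β E *ᵥ ξ' z)) y = 0 := by
  have H := S.isHolonomy hR
  -- q annihilates the holonomy algebra on both sides. Hence q ξ has zero derivative by the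
  -- transport equation, and ω_l q ξ = 0.
  have h : ∀ {ξ : Coord n → Fin n → ℝ} {c : Coord n → Fin p → ℝ}, IsRadialTransport U β E ξ c →
      pd l (fun z => flatProj β E *ᵥ ξ z) y + spinMat g e l y *ᵥ (flatProj β E *ᵥ ξ y) = 0 := by
    intro ξ c T
    rw [pd_eq, dirD_mulVec contDiffAt_const (T.cd_vec y hy), dirD_const, ← pd_eq,
      (S.transport hR T l hy).1, S.spinMat_eq_holMap hy hR]
    simp only [Matrix.mulVec_add, Matrix.mulVec_neg, Matrix.mulVec_mulVec, ← mul_assoc,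
      holMap_mul_flatProj, H.flatProj_mul_holMap, Matrix.zero_mulVec, neg_zero, add_zero]
  rw [S.gaugeD_gaugeForm P hy (cd_mulVec contDiffAt_const (T.cd_vec y hy))
    (cd_mulVec contDiffAt_const (T'.cd_vec y hy)), h T, h T']
  simp

end IsSymFrame

end GaugeRep

/-! ### The representation of the orthogonal Lie algebra -/

section SpinRep

variable {n : ℕ} {𝕜 ι : Type*} [RCLike 𝕜]

/-- The representation `A ↦ (1/2) A_{ab} Σ_{ab}` of the orthogonal Lie algebra. -/
def spinRep (Sg : Fin n → Fin n → Matrix ι ι 𝕜) : Matrix (Fin n) (Fin n) ℝ →ₗ[ℝ] Matrix ι ι 𝕜 where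
  toFun A := (1 / 2 : ℝ) • ∑ a, ∑ b, A a b • Sg a b
  map_add' A B := by
    simp only [Matrix.add_apply, add_smul, Finset.sum_add_distrib, smul_add]
  map_smul' t A := by
    simp only [Matrix.smul_apply, smul_eq_mul, mul_smul, ← Finset.smul_sum, RingHom.id_apply]
    rw [smul_comm]

theorem spinRep_apply (Sg : Fin n → Fin n → Matrix ι ι 𝕜) (A : Matrix (Fin n) (Fin n) ℝ) :
    spinRep Sg A = (1 / 2 : ℝ) • ∑ a, ∑ b, A a b • Sg a b := rfl

/-- By the antisymmetry of `A` and `B` the four terms of the bracket relation contribute equally,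
compensating the factor 1/4; the antisymmetry of Σ merges the two halves of AB - BA. -/
theorem spinRep_comm [Fintype ι] {Sg : Fin n → Fin n → Matrix ι ι 𝕜} (hSg : IsSpinRep Sg)
    {A B : Matrix (Fin n) (Fin n) ℝ} (hA : Aᵀ = -A) (hB : Bᵀ = -B) :
    spinRep Sg A * spinRep Sg B - spinRep Sg B * spinRep Sg A = spinRep Sg (A * B - B * A) := by
  classical
  have hA' : ∀ a b, A a b = - A b a := fun a b => by
    have := congrFun (congrFun hA b) a; simpa using this
  have hB' : ∀ a b, B a b = - B b a := fun a b => by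
    have := congrFun (congrFun hB b) a; simpa using this
  have h1 : spinRep Sg A * spinRep Sg B - spinRep Sg B * spinRep Sg A =
      (1 / 4 : ℝ) • ∑ a, ∑ b, ∑ c, ∑ d, (A a b * B c d) • (Sg a b * Sg c d - Sg c d * Sg a b) := by
    have e1 : spinRep Sg A * spinRep Sg B =
        (1 / 4 : ℝ) • ∑ a, ∑ b, ∑ c, ∑ d, (A a b * B c d) • (Sg a b * Sg c d) := by
      simp only [spinRep_apply, smul_mul_assoc, mul_smul_comm, smul_smul, Finset.sum_mul,
        Finset.mul_sum, Finset.smul_sum]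
      norm_num
      rw [sum_pair_comm]
      refine Finset.sum_congr rfl fun a _ => Finset.sum_congr rfl fun b _ =>
        Finset.sum_congr rfl fun c _ => Finset.sum_congr rfl fun d _ => by congr 1; ring
    have e2 : spinRep Sg B * spinRep Sg A =
        (1 / 4 : ℝ) • ∑ a, ∑ b, ∑ c, ∑ d, (A a b * B c d) • (Sg c d * Sg a b) := by
      simp only [spinRep_apply, smul_mul_assoc, mul_smul_comm, smul_smul, Finset.sum_mul,
        Finset.mul_sum, Finset.smul_sum]
      norm_num
      refine Finset.sum_congr rfl fun a _ => Finset.sum_congr rfl fun b _ =>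
        Finset.sum_congr rfl fun c _ => Finset.sum_congr rfl fun d _ => by congr 1; ring
    rw [e1, e2, ← smul_sub]
    simp only [← Finset.sum_sub_distrib, ← smul_sub]
  have hone : ∀ (a b : Fin n) (M : Matrix ι ι 𝕜),
      (1 : Matrix (Fin n) (Fin n) 𝕜) a b • M = (if a = b then (1 : ℝ) else 0) • M := by
    intro a b M
    rw [Matrix.one_apply]; split <;> simp
  have hS : ∀ a b, Sg a b = - Sg b a := hSg.antisymm
  have h2 : spinRep Sg (A * B - B * A) = ∑ a, ∑ b, (A * B) a b • Sg a b := by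
    have e1 : ∑ a, ∑ b, (B * A) a b • Sg a b = - ∑ a, ∑ b, (A * B) a b • Sg a b := by
      have e2 : (B * A) = (A * B)ᵀ := by rw [Matrix.transpose_mul, hA, hB, neg_mul_neg]
      rw [e2, Finset.sum_comm, ← Finset.sum_neg_distrib]
      refine Finset.sum_congr rfl fun a _ => ?_
      rw [← Finset.sum_neg_distrib]
      refine Finset.sum_congr rfl fun b _ => ?_
      rw [Matrix.transpose_apply, hS b a, smul_neg]
    rw [map_sub, spinRep_apply, spinRep_apply, e1, smul_neg, sub_neg_eq_add, ← add_smul]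
    norm_num
  rw [h1, h2]
  simp only [hSg.bracket, hone, smul_add, smul_sub, smul_smul, Finset.sum_add_distrib,
    Finset.sum_sub_distrib]
  have t1 : ∑ a, ∑ b, ∑ c, ∑ d, (A a b * B c d * if b = c then (1 : ℝ) else 0) • Sg a d =
      ∑ a, ∑ d, (A * B) a d • Sg a d := by
    refine Finset.sum_congr rfl fun a _ => ?_
    simp only [mul_ite, mul_one, mul_zero, ite_smul, zero_smul]
    rw [Finset.sum_congr rfl fun b _ => Finset.sum_comm, Finset.sum_comm]
    refine Finset.sum_congr rfl fun d _ => ?_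
    simp [Matrix.mul_apply, Finset.sum_smul]
  have t2 : ∑ a, ∑ b, ∑ c, ∑ d, (A a b * B c d * if a = c then (1 : ℝ) else 0) • Sg b d =
      - ∑ a, ∑ d, (A * B) a d • Sg a d := by
    rw [← t1, Finset.sum_comm]
    simp only [← Finset.sum_neg_distrib]
    refine Finset.sum_congr rfl fun a _ => Finset.sum_congr rfl fun b _ =>
      Finset.sum_congr rfl fun c _ => Finset.sum_congr rfl fun d _ => ?_
    rw [hA' b a, ← neg_smul]; congr 1; ring
  have t3 : ∑ a, ∑ b, ∑ c, ∑ d, (A a b * B c d * if b = d then (1 : ℝ) else 0) • Sg a c =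
      - ∑ a, ∑ d, (A * B) a d • Sg a d := by
    rw [← t1]
    simp only [← Finset.sum_neg_distrib]
    refine Finset.sum_congr rfl fun a _ => Finset.sum_congr rfl fun b _ => ?_
    rw [Finset.sum_comm]
    refine Finset.sum_congr rfl fun c _ => Finset.sum_congr rfl fun d _ => ?_
    rw [hB' d c, ← neg_smul]; congr 1; ring
  have t4 : ∑ a, ∑ b, ∑ c, ∑ d, (A a b * B c d * if a = d then (1 : ℝ) else 0) • Sg b c =
      ∑ a, ∑ d, (A * B) a d • Sg a d := by
    rw [← t1, Finset.sum_comm]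
    refine Finset.sum_congr rfl fun a _ => Finset.sum_congr rfl fun b _ => ?_
    rw [Finset.sum_comm]
    refine Finset.sum_congr rfl fun c _ => Finset.sum_congr rfl fun d _ => ?_
    rw [hB' d c, hA' b a]; congr 1; ring
  rw [t1, t2, t3, t4]
  module

end SpinRep

end SymSpace

namespace SymSpace

attribute [local instance] Matrix.normedAddCommGroup Matrix.normedSpace

/-! ### The representation on the twisted fibre and its Casimir operator -/

section TotalRep

variable {n p : ℕ} {𝕜 ι κ : Type*} [RCLike 𝕜]

section Kronecker

variable (ι κ 𝕜)

/-- The action of endomorphisms of the first factor on the tensor product. -/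
def kronL [DecidableEq κ] : Matrix ι ι 𝕜 →ₗ[ℝ] Matrix (ι × κ) (ι × κ) 𝕜 where
  toFun M := M ⊗ₖ (1 : Matrix κ κ 𝕜)
  map_add' M N := Matrix.add_kronecker M N _
  map_smul' t M := Matrix.smul_kronecker t M _

/-- The action of endomorphisms of the second factor on the tensor product. -/
def kronR [DecidableEq ι] : Matrix κ κ 𝕜 →ₗ[ℝ] Matrix (ι × κ) (ι × κ) 𝕜 where
  toFun M := (1 : Matrix ι ι 𝕜) ⊗ₖ M
  map_add' M N := Matrix.kronecker_add _ M N
  map_smul' t M := Matrix.kronecker_smul t _ M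

end Kronecker

variable [Fintype ι] [DecidableEq ι] [Fintype κ] [DecidableEq κ]

theorem kronL_mul (M N : Matrix ι ι 𝕜) :
    kronL 𝕜 ι κ M * kronL 𝕜 ι κ N = kronL 𝕜 ι κ (M * N) := by
  change M ⊗ₖ 1 * N ⊗ₖ 1 = (M * N) ⊗ₖ 1
  rw [← Matrix.mul_kronecker_mul, one_mul]

theorem kronR_mul (M N : Matrix κ κ 𝕜) :
    kronR 𝕜 ι κ M * kronR 𝕜 ι κ N = kronR 𝕜 ι κ (M * N) := by
  change 1 ⊗ₖ M * 1 ⊗ₖ N = 1 ⊗ₖ (M * N)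
  rw [← Matrix.mul_kronecker_mul, one_mul]

theorem kronR_mul_kronL (M : Matrix κ κ 𝕜) (N : Matrix ι ι 𝕜) :
    kronR 𝕜 ι κ M * kronL 𝕜 ι κ N = kronL 𝕜 ι κ N * kronR 𝕜 ι κ M := by
  change 1 ⊗ₖ M * N ⊗ₖ 1 = N ⊗ₖ 1 * 1 ⊗ₖ M
  rw [← Matrix.mul_kronecker_mul, ← Matrix.mul_kronecker_mul, one_mul, mul_one, mul_one, one_mul]

theorem kron_commutator (M N : Matrix ι ι 𝕜) (M' N' : Matrix κ κ 𝕜) :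
    (kronL 𝕜 ι κ M + kronR 𝕜 ι κ M') * (kronL 𝕜 ι κ N + kronR 𝕜 ι κ N')
      - (kronL 𝕜 ι κ N + kronR 𝕜 ι κ N') * (kronL 𝕜 ι κ M + kronR 𝕜 ι κ M')
    = kronL 𝕜 ι κ (M * N - N * M) + kronR 𝕜 ι κ (M' * N' - N' * M') := by
  simp only [mul_add, add_mul, kronL_mul, kronR_mul, kronR_mul_kronL, map_sub]
  abel

/-- The representation of the holonomy algebra on the fibre of the twisted bundle. -/
def totRep (β : Matrix (Fin p) (Fin p) ℝ) (E : Fin p → Matrix (Fin n) (Fin n) ℝ)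
    (Sg : Fin n → Fin n → Matrix ι ι 𝕜) (x : Fin n → Fin n → Matrix κ κ 𝕜) :
    (Fin p → ℝ) →ₗ[ℝ] Matrix (ι × κ) (ι × κ) 𝕜 :=
  kronL 𝕜 ι κ ∘ₗ spinRep Sg ∘ₗ holMap β E + kronR 𝕜 ι κ ∘ₗ gaugeRep β E x

variable {U : Set (Coord n)}
  {g e : Coord n → Matrix (Fin n) (Fin n) ℝ} {𝓐 : Fin n → Coord n → Matrix κ κ 𝕜} {y : Coord n}
  {β : Matrix (Fin p) (Fin p) ℝ} {E : Fin p → Matrix (Fin n) (Fin n) ℝ}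
  {X : Coord n → Fin n → Fin n → Matrix κ κ 𝕜} {Sg : Fin n → Fin n → Matrix ι ι 𝕜}

theorem totRep_apply (x : Fin n → Fin n → Matrix κ κ 𝕜) (c : Fin p → ℝ) :
    totRep β E Sg x c =
      kronL 𝕜 ι κ (spinRep Sg (holMap β E c)) + kronR 𝕜 ι κ (gaugeRep β E x c) := rfl

theorem connForm_eq (μ : Fin n) (y : Coord n) : connForm g e Sg 𝓐 μ y =
    kronL 𝕜 ι κ (spinRep Sg (spinMat g e μ y)) + kronR 𝕜 ι κ (𝓐 μ y) := rfl

/-- The contraction is with G^b_a, in reversed index order; antisymmetry of Σ and X yields the minus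
sign. -/
theorem sum_smul_genG (hSg : IsSpinRep Sg) (hX : ∀ a b, X y a b = - X y b a) (c : Fin p → ℝ) :
    (1 / 2 : ℝ) • ∑ a, ∑ b, holMap β E c a b • genG Sg X b a y = - totRep β E Sg (X y) c := by
  have h : ∀ a b, genG Sg X b a y = -(kronL 𝕜 ι κ (Sg a b) + kronR 𝕜 ι κ (X y a b)) := by
    intro a b
    rw [hSg.antisymm a b, hX a b, map_neg, map_neg, neg_add, neg_neg, neg_neg]
    rfl
  simp only [h, smul_neg, smul_add, Finset.sum_neg_distrib, Finset.sum_add_distrib, totRep_apply,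
    spinRep_apply, gaugeRep_apply, map_smul, map_sum]

theorem holRep_eq (hSg : IsSpinRep Sg) (hX : ∀ a b, X y a b = - X y b a) (i : Fin p) :
    holRep β E Sg X i y = totRep β E Sg (X y) (Pi.single i 1) := by
  have h := sum_smul_genG (β := β) (E := E) hSg hX (Pi.single i 1)
  rw [holMap_single] at h
  rw [holRep, neg_smul, h, neg_neg]

namespace IsSymFrame

variable (S : IsSymFrame U g e) (P : IsParallelGauge U g 𝓐) (hy : y ∈ U)
  (hR : IsCurvatureFactorization β E (fun a b c d => frameRiemann g e a b c d 0))
  (hX : IsGaugeGenerator e β E 𝓐 X U) (hSg : IsSpinRep Sg)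
include S P hy

theorem cd_connForm (μ : Fin n) : ContDiffAt ℝ ∞ (connForm g e Sg 𝓐 μ) y :=
  (cd_lin (kronL 𝕜 ι κ ∘ₗ spinRep Sg) (S.cd_spinMat hy μ)).add
    (cd_lin (kronR 𝕜 ι κ) (P.smooth y hy μ))

theorem pd_connForm (μ ν : Fin n) : pd μ (connForm g e Sg 𝓐 ν) y =
    kronL 𝕜 ι κ (spinRep Sg (pd μ (spinMat g e ν) y)) + kronR 𝕜 ι κ (pd μ (𝓐 ν) y) := by
  have h1 := dirD_lin (v := cv μ) (kronL 𝕜 ι κ ∘ₗ spinRep Sg) (S.cd_spinMat hy ν)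
  have h2 := dirD_lin (v := cv μ) (kronR 𝕜 ι κ) (P.smooth y hy ν)
  have h3 := dirD_add (v := cv μ) (cd_lin (kronL 𝕜 ι κ ∘ₗ spinRep Sg) (S.cd_spinMat hy ν))
    (cd_lin (kronR 𝕜 ι κ) (P.smooth y hy ν))
  rw [h1, h2] at h3
  exact h3

include hR hSg

/-- The curvature of the twisted bundle. -/
theorem connForm_curvature (hX : IsGaugeGenerator e β E 𝓐 X U) (μ ν : Fin n) :
    pd μ (connForm g e Sg 𝓐 ν) y - pd ν (connForm g e Sg 𝓐 μ) y
      + (connForm g e Sg 𝓐 μ y * connForm g e Sg 𝓐 ν y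
        - connForm g e Sg 𝓐 ν y * connForm g e Sg 𝓐 μ y)
    = totRep β E Sg (X y) (curvCoef E (coVec e μ y) (coVec e ν y))
      + kronR 𝕜 ι κ (gaugeForm e 𝓐 y (flatProj β E *ᵥ coVec e μ y)
        (flatProj β E *ᵥ coVec e ν y)) := by
  have h1 : gaugeForm e 𝓐 y (coVec e μ y) (coVec e ν y) = gaugeCurv 𝓐 μ ν y := by
    rw [gaugeForm_eq, coVec, coVec, Matrix.mulVec_mulVec, Matrix.mulVec_mulVec, S.mul_inv hy,
        Matrix.one_mulVec, Matrix.one_mulVec, biForm_single]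
  -- The semisimple part of 𝓕 joins the spin curvature to form ρ(R); the flat part stays as a
  -- separate term.
  rw [S.pd_connForm P hy, S.pd_connForm P hy, connForm_eq, connForm_eq, kron_commutator,
    spinRep_comm hSg (S.spinMat_transpose hy μ) (S.spinMat_transpose hy ν), totRep_apply,
    gaugeRep_curv hy hR hX, ← S.spin_curvature_hol hy hR μ ν, add_assoc (kronL 𝕜 ι κ _),
    ← map_add, ← S.gaugeForm_decomp P hy hR, h1, P.gaugeCurv_eq hy]
  simp only [map_add, map_sub]
  abel

include hX

theorem cd_totRep (c : Fin p → ℝ) : ContDiffAt ℝ ∞ (fun z => totRep β E Sg (X z) c) y :=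
  contDiffAt_const.add (cd_lin (kronR 𝕜 ι κ) (S.cd_gaugeRep P hy hR hX c))

theorem totRep_comm (c c' : Fin p → ℝ) :
    totRep β E Sg (X y) c * totRep β E Sg (X y) c' - totRep β E Sg (X y) c' * totRep β E Sg (X y) c
      = totRep β E Sg (X y) (holBr β E c c') := by
  have H := S.isHolonomy hR
  rw [totRep_apply, totRep_apply, kron_commutator,
    spinRep_comm hSg (H.holMap_transpose c) (H.holMap_transpose c'),
    S.gaugeRep_comm P hy hR hX, ← H.holMap_holBr]
  rfl

theorem gaugeD_totRep_const (c : Fin p → ℝ) (l : Fin n) :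
    gaugeD (connForm g e Sg 𝓐) l (fun z => totRep β E Sg (X z) c) y =
      totRep β E Sg (X y) (holBr β E (spinCoef g e β E l y) c) := by
  have H := S.isHolonomy hR
  have h1 : pd l (fun z => totRep β E Sg (X z) c) y =
      kronR 𝕜 ι κ (pd l (fun z => gaugeRep β E (X z) c) y) := by
    have h2 := dirD_add (v := cv l)
      (contDiffAt_const (c := kronL 𝕜 ι κ (spinRep Sg (holMap β E c))))
      (cd_lin (kronR 𝕜 ι κ) (S.cd_gaugeRep P hy hR hX c))
    rw [dirD_const, zero_add, dirD_lin (kronR 𝕜 ι κ) (S.cd_gaugeRep P hy hR hX c)] at h2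
    exact h2
  have h3 := S.gaugeD_gaugeRep P hy hR hX c l
  rw [gaugeD] at h3
  rw [gaugeD, h1, connForm_eq, totRep_apply, kron_commutator,
    spinRep_comm hSg (S.spinMat_transpose hy l) (H.holMap_transpose c),
    totRep_apply, ← h3, H.holMap_holBr, ← S.spinMat_eq_holMap hy hR, map_add]
  abel

theorem cd_totRep_coef {c : Coord n → Fin p → ℝ} (hc : ContDiffAt ℝ ∞ c y) :
    ContDiffAt ℝ ∞ (fun z => totRep β E Sg (X z) (c z)) y :=
  cd_linear_family (L := fun z => totRep β E Sg (X z)) (S.cd_totRep P hy hR hX hSg) hc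

theorem gaugeD_totRep {c : Coord n → Fin p → ℝ} (hc : ContDiffAt ℝ ∞ c y) (l : Fin n) :
    gaugeD (connForm g e Sg 𝓐) l (fun z => totRep β E Sg (X z) (c z)) y =
      totRep β E Sg (X y) (pd l c y + holBr β E (spinCoef g e β E l y) (c y)) := by
  rw [map_add, ← S.gaugeD_totRep_const P hy hR hX hSg, gaugeD, gaugeD, pd_eq,
    dirD_linear_family (L := fun z => totRep β E Sg (X z)) (S.cd_totRep P hy hR hX hSg) hc, pd_eq,
    pd_eq]
  abel

theorem flat_totRep_comm (u v : Fin n → ℝ) (c : Fin p → ℝ) :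
    kronR 𝕜 ι κ (gaugeForm e 𝓐 y (flatProj β E *ᵥ u) (flatProj β E *ᵥ v)) *
      totRep β E Sg (X y) c =
    totRep β E Sg (X y) c *
      kronR 𝕜 ι κ (gaugeForm e 𝓐 y (flatProj β E *ᵥ u) (flatProj β E *ᵥ v)) := by
  rw [totRep_apply, mul_add, add_mul, kronR_mul_kronL, kronR_mul, kronR_mul,
    S.flat_gaugeRep_comm P hy hR hX]

omit hX hSg in
theorem gaugeD_kronR_flat {ξ ξ' : Coord n → Fin n → ℝ} {c c' : Coord n → Fin p → ℝ}
    (T : IsRadialTransport U β E ξ c) (T' : IsRadialTransport U β E ξ' c') (l : Fin n) :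
    gaugeD (connForm g e Sg 𝓐) l (fun z => kronR 𝕜 ι κ
      (gaugeForm e 𝓐 z (flatProj β E *ᵥ ξ z) (flatProj β E *ᵥ ξ' z))) y = 0 := by
  have h1 := S.cd_gaugeForm P hy (cd_mulVec (contDiffAt_const (c := flatProj β E)) (T.cd_vec y hy))
    (cd_mulVec (contDiffAt_const (c := flatProj β E)) (T'.cd_vec y hy))
  have h2 := S.gaugeD_flat P hy hR T T' l
  rw [gaugeD] at h2
  rw [gaugeD, pd_eq, dirD_lin (kronR 𝕜 ι κ) h1, connForm_eq, add_mul, mul_add, kronR_mul_kronL,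
    kronR_mul, kronR_mul]
  have h3 := congrArg (kronR 𝕜 ι κ) h2
  rw [map_add, map_sub, map_zero, pd_eq] at h3
  rw [← h3]; abel

/-- The Casimir operator of the holonomy algebra is covariantly constant and commutes with the
holonomy algebra. -/
theorem holCasimir_eq : holCasimir β E Sg X y = ∑ i, ∑ j, β⁻¹ i j •
    (totRep β E Sg (X y) (Pi.single i 1) * totRep β E Sg (X y) (Pi.single j 1)) := by
  simp only [holCasimir, holRep_eq hSg (hX.antisymm y hy)]

/-- Invariance of β^{ij} D_i ⊗ D_j, mapped through the product of ρ with itself. -/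
theorem holCasimir_comm (c : Fin p → ℝ) : totRep β E Sg (X y) c * holCasimir β E Sg X y =
    holCasimir β E Sg X y * totRep β E Sg (X y) c := by
  have H := S.isHolonomy hR
  have h := H.casimir_invariant (((LinearMap.mul ℝ (Matrix (ι × κ) (ι × κ) 𝕜)).compl₁₂
    (totRep β E Sg (X y)) (totRep β E Sg (X y)))) c
  simp only [LinearMap.compl₁₂_apply, LinearMap.mul_apply', ← S.totRep_comm P hy hR hX hSg] at h
  rw [← sub_eq_zero, ← h, S.holCasimir_eq P hy hR hX hSg]
  simp only [Finset.mul_sum, Finset.sum_mul, ← Finset.sum_sub_distrib, mul_smul_comm,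
    smul_mul_assoc, ← smul_sub]
  refine Finset.sum_congr rfl fun i _ => Finset.sum_congr rfl fun j _ => ?_
  congr 1
  noncomm_ring

theorem cd_holCasimir : ContDiffAt ℝ ∞ (holCasimir β E Sg X) y := by
  refine contDiffAt_congr S.isOpen hy (fun z hz => S.holCasimir_eq P hz hR hX hSg)
    (ContDiffAt.sum fun i _ => ContDiffAt.sum fun j _ => ?_)
  exact cd_smul contDiffAt_const (cd_mul (S.cd_totRep P hy hR hX hSg _)
    (S.cd_totRep P hy hR hX hSg _))

/-- The covariant derivative of ρ is ρ composed with ad(ω_l), so this is `casimir_invariant` for the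
spin connection coefficients. -/
theorem gaugeD_holCasimir (l : Fin n) :
    gaugeD (connForm g e Sg 𝓐) l (holCasimir β E Sg X) y = 0 := by
  have H := S.isHolonomy hR
  have h := H.casimir_invariant (((LinearMap.mul ℝ (Matrix (ι × κ) (ι × κ) 𝕜)).compl₁₂
    (totRep β E Sg (X y)) (totRep β E Sg (X y)))) (spinCoef g e β E l y)
  simp only [LinearMap.compl₁₂_apply, LinearMap.mul_apply',
    ← S.gaugeD_totRep_const P hy hR hX hSg] at h
  have cd : ∀ i j, ContDiffAt ℝ ∞ (fun z => totRep β E Sg (X z) (Pi.single i 1)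
      * totRep β E Sg (X z) (Pi.single j 1)) y := fun i j =>
    cd_mul (S.cd_totRep P hy hR hX hSg _) (S.cd_totRep P hy hR hX hSg _)
  have h1 : pd l (holCasimir β E Sg X) y = ∑ i, ∑ j, β⁻¹ i j • pd l (fun z =>
      totRep β E Sg (X z) (Pi.single i 1) * totRep β E Sg (X z) (Pi.single j 1)) y := by
    rw [pd_eq, dirD_congr S.isOpen hy (fun z hz => S.holCasimir_eq P hz hR hX hSg)]
    refine (dirD_sum fun i _ => ContDiffAt.sum fun j _ =>
      cd_smul contDiffAt_const (cd i j)).trans (Finset.sum_congr rfl fun i _ => ?_)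
    refine (dirD_sum fun j _ => cd_smul contDiffAt_const (cd i j)).trans
      (Finset.sum_congr rfl fun j _ => ?_)
    exact dirD_const_smul _ (cd i j)
  have h2 := fun i j => gaugeD_mul (𝓐 := connForm g e Sg 𝓐) (l := l)
    (S.cd_totRep P hy hR hX hSg (Pi.single i 1)) (S.cd_totRep P hy hR hX hSg (Pi.single j 1))
  simp only [← h2] at h
  rw [gaugeD, h1, S.holCasimir_eq P hy hR hX hSg, ← h]
  simp only [gaugeD, smul_add, smul_sub, Finset.sum_add_distrib,
    Finset.sum_sub_distrib, Finset.mul_sum, Finset.sum_mul, mul_smul_comm, smul_mul_assoc]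

theorem lieShift_eq (A : Fin n ⊕ Fin p) : lieShift g e β E Sg X A y =
    - totRep β E Sg (X y) (kilCoef g e β E A y) := by
  rw [lieShift, ← sum_smul_genG hSg (hX.antisymm y hy)]
  simp only [S.frameNabla_killing hR hy]

end IsSymFrame

end TotalRep

end SymSpace

namespace SymSpace

attribute [local instance] Matrix.normedAddCommGroup Matrix.normedSpace

/-! ### Products of twisted Lie derivatives -/

section Operators

variable {n p : ℕ} {𝕜 ι κ : Type*} [RCLike 𝕜] [Fintype ι] [DecidableEq ι] [Fintype κ]
  [DecidableEq κ] {U : Set (Coord n)}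
  {g e : Coord n → Matrix (Fin n) (Fin n) ℝ} {𝓐 : Fin n → Coord n → Matrix κ κ 𝕜} {y : Coord n}
  {β : Matrix (Fin p) (Fin p) ℝ} {E : Fin p → Matrix (Fin n) (Fin n) ℝ}
  {X : Coord n → Fin n → Fin n → Matrix κ κ 𝕜} {Sg : Fin n → Fin n → Matrix ι ι 𝕜}
  {φ φ' : Coord n → ι × κ → 𝕜}

/-- The covariant derivative `v^μ ∇_μ φ` as a linear function of `v`. -/
def covDeriv (g e : Coord n → Matrix (Fin n) (Fin n) ℝ) (Sg : Fin n → Fin n → Matrix ι ι 𝕜)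
    (𝓐 : Fin n → Coord n → Matrix κ κ 𝕜) (φ : Coord n → ι × κ → 𝕜) (y : Coord n) :
    (Fin n → ℝ) →ₗ[ℝ] (ι × κ → 𝕜) :=
  Fintype.linearCombination ℝ fun μ => nabla g e Sg 𝓐 μ φ y

/-- The second covariant derivative of a section. -/
def hessian (g e : Coord n → Matrix (Fin n) (Fin n) ℝ) (Sg : Fin n → Fin n → Matrix ι ι 𝕜)
    (𝓐 : Fin n → Coord n → Matrix κ κ 𝕜) (φ : Coord n → ι × κ → 𝕜) (y : Coord n) (μ ν : Fin n) :
    ι × κ → 𝕜 :=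
  nabla g e Sg 𝓐 μ (nabla g e Sg 𝓐 ν φ) y - ∑ l, christoffel g l μ ν y • nabla g e Sg 𝓐 l φ y

theorem covDeriv_apply (v : Fin n → ℝ) :
    covDeriv g e Sg 𝓐 φ y v = ∑ μ, v μ • nabla g e Sg 𝓐 μ φ y := by
  simp [covDeriv, Fintype.linearCombination_apply]

theorem nabla_add (hφ : ContDiffAt ℝ ∞ φ y) (hφ' : ContDiffAt ℝ ∞ φ' y) (μ : Fin n) :
    nabla g e Sg 𝓐 μ (fun z => φ z + φ' z) y =
      nabla g e Sg 𝓐 μ φ y + nabla g e Sg 𝓐 μ φ' y := by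
  simp only [nabla]
  rw [pd_eq, dirD_add hφ hφ', Matrix.mulVec_add, pd_eq, pd_eq]; abel

theorem nabla_sub (hφ : ContDiffAt ℝ ∞ φ y) (hφ' : ContDiffAt ℝ ∞ φ' y) (μ : Fin n) :
    nabla g e Sg 𝓐 μ (fun z => φ z - φ' z) y =
      nabla g e Sg 𝓐 μ φ y - nabla g e Sg 𝓐 μ φ' y := by
  simp only [nabla]
  rw [pd_eq, dirD_sub hφ hφ', Matrix.mulVec_sub, pd_eq, pd_eq]; abel

theorem nabla_smul {f : Coord n → ℝ} (hf : ContDiffAt ℝ ∞ f y) (hφ : ContDiffAt ℝ ∞ φ y)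
    (μ : Fin n) : nabla g e Sg 𝓐 μ (fun z => f z • φ z) y =
      pd μ f y • φ y + f y • nabla g e Sg 𝓐 μ φ y := by
  simp only [nabla]
  rw [pd_eq, dirD_smul hf hφ, Matrix.mulVec_smul, pd_eq, pd_eq, smul_add, add_assoc]

theorem nabla_sum {ι' : Type*} [Fintype ι'] {f : ι' → Coord n → ι × κ → 𝕜}
    (hf : ∀ i, ContDiffAt ℝ ∞ (f i) y) (μ : Fin n) :
    nabla g e Sg 𝓐 μ (fun z => ∑ i, f i z) y = ∑ i, nabla g e Sg 𝓐 μ (f i) y := by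
  simp only [nabla]
  rw [pd_eq, dirD_sum fun i _ => hf i, Matrix.mulVec_sum, Finset.sum_add_distrib]
  rfl

theorem nabla_mulVec {M : Coord n → Matrix (ι × κ) (ι × κ) 𝕜} (hM : ContDiffAt ℝ ∞ M y)
    (hφ : ContDiffAt ℝ ∞ φ y) (μ : Fin n) :
    nabla g e Sg 𝓐 μ (fun z => M z *ᵥ φ z) y =
      gaugeD (connForm g e Sg 𝓐) μ M y *ᵥ φ y + M y *ᵥ nabla g e Sg 𝓐 μ φ y := by
  simp only [nabla, gaugeD]
  rw [pd_eq, dirD_mulVec hM hφ, pd_eq, pd_eq]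
  simp only [Matrix.add_mulVec, Matrix.sub_mulVec, Matrix.mulVec_add, Matrix.mulVec_mulVec]
  abel

theorem nabla_congr (hU : IsOpen U) (hy : y ∈ U) (h : ∀ z ∈ U, φ z = φ' z) (μ : Fin n) :
    nabla g e Sg 𝓐 μ φ y = nabla g e Sg 𝓐 μ φ' y := by
  rw [nabla, nabla, pd_eq, dirD_congr hU hy h, h y hy, pd_eq]

theorem twistedLie_congr (hU : IsOpen U) (hy : y ∈ U) (h : ∀ z ∈ U, φ z = φ' z)
    (A : Fin n ⊕ Fin p) :
    twistedLie g e β E Sg 𝓐 X A φ y = twistedLie g e β E Sg 𝓐 X A φ' y := by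
  simp only [twistedLie, nabla_congr hU hy h, h y hy]

theorem twistedLie_add (hφ : ContDiffAt ℝ ∞ φ y) (hφ' : ContDiffAt ℝ ∞ φ' y)
    (A : Fin n ⊕ Fin p) : twistedLie g e β E Sg 𝓐 X A (fun z => φ z + φ' z) y =
      twistedLie g e β E Sg 𝓐 X A φ y + twistedLie g e β E Sg 𝓐 X A φ' y := by
  simp only [twistedLie, nabla_add hφ hφ', Matrix.mulVec_add, smul_add, Finset.sum_add_distrib]
  abel

theorem twistedLie_sub (hφ : ContDiffAt ℝ ∞ φ y) (hφ' : ContDiffAt ℝ ∞ φ' y)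
    (A : Fin n ⊕ Fin p) : twistedLie g e β E Sg 𝓐 X A (fun z => φ z - φ' z) y =
      twistedLie g e β E Sg 𝓐 X A φ y - twistedLie g e β E Sg 𝓐 X A φ' y := by
  simp only [twistedLie, nabla_sub hφ hφ', Matrix.mulVec_sub, smul_sub, Finset.sum_sub_distrib]
  abel

theorem twistedLie_const_smul (hφ : ContDiffAt ℝ ∞ φ y) (t : ℝ) (A : Fin n ⊕ Fin p) :
    twistedLie g e β E Sg 𝓐 X A (fun z => t • φ z) y = t • twistedLie g e β E Sg 𝓐 X A φ y := by
  have h : ∀ μ, nabla g e Sg 𝓐 μ (fun z => t • φ z) y = t • nabla g e Sg 𝓐 μ φ y := by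
    intro μ
    rw [nabla_smul contDiffAt_const hφ, pd_eq, dirD_const, zero_smul, zero_add]
  simp only [twistedLie, h, Matrix.mulVec_smul, smul_add, Finset.smul_sum]
  simp only [smul_comm t]

theorem twistedLie_sum {ι' : Type*} [Fintype ι'] {f : ι' → Coord n → ι × κ → 𝕜}
    (hf : ∀ i, ContDiffAt ℝ ∞ (f i) y) (A : Fin n ⊕ Fin p) :
    twistedLie g e β E Sg 𝓐 X A (fun z => ∑ i, f i z) y =
      ∑ i, twistedLie g e β E Sg 𝓐 X A (f i) y := by
  simp only [twistedLie, nabla_sum hf, Matrix.mulVec_sum, Finset.smul_sum, Finset.sum_add_distrib]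
  rw [Finset.sum_comm]

namespace IsSymFrame

variable (S : IsSymFrame U g e) (P : IsParallelGauge U g 𝓐) (hy : y ∈ U)
  (hR : IsCurvatureFactorization β E (fun a b c d => frameRiemann g e a b c d 0))
  (hX : IsGaugeGenerator e β E 𝓐 X U) (hSg : IsSpinRep Sg)
include S P

theorem cd_nabla {y : Coord n} (hy : y ∈ U) {φ : Coord n → ι × κ → 𝕜} (hφ : ContDiffAt ℝ ∞ φ y)
    (μ : Fin n) : ContDiffAt ℝ ∞ (nabla g e Sg 𝓐 μ φ) y :=
  (cd_pd hφ).add (cd_mulVec (S.cd_connForm P hy μ) hφ)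

include hy

theorem nabla_comm (hφ : ContDiffAt ℝ ∞ φ y) (μ ν : Fin n) :
    nabla g e Sg 𝓐 μ (nabla g e Sg 𝓐 ν φ) y - nabla g e Sg 𝓐 ν (nabla g e Sg 𝓐 μ φ) y =
      (pd μ (connForm g e Sg 𝓐 ν) y - pd ν (connForm g e Sg 𝓐 μ) y
        + (connForm g e Sg 𝓐 μ y * connForm g e Sg 𝓐 ν y
          - connForm g e Sg 𝓐 ν y * connForm g e Sg 𝓐 μ y)) *ᵥ φ y := by
  have h : ∀ μ ν, pd μ (nabla g e Sg 𝓐 ν φ) y = dirD (cv μ) (dirD (cv ν) φ) y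
      + (pd μ (connForm g e Sg 𝓐 ν) y *ᵥ φ y + connForm g e Sg 𝓐 ν y *ᵥ pd μ φ y) := by
    intro μ ν
    change dirD (cv μ) (fun z => dirD (cv ν) φ z + connForm g e Sg 𝓐 ν z *ᵥ φ z) y = _
    rw [dirD_add (cd_dirD hφ) (cd_mulVec (S.cd_connForm P hy ν) hφ),
      dirD_mulVec (S.cd_connForm P hy ν) hφ]
    rfl
  have h' : ∀ μ ν, nabla g e Sg 𝓐 μ (nabla g e Sg 𝓐 ν φ) y = pd μ (nabla g e Sg 𝓐 ν φ) y
    + connForm g e Sg 𝓐 μ y *ᵥ (pd ν φ y + connForm g e Sg 𝓐 ν y *ᵥ φ y) := fun _ _ => rfl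
  rw [h', h', h, h, dirD_comm hφ]
  simp only [Matrix.add_mulVec, Matrix.sub_mulVec, Matrix.mulVec_add, Matrix.mulVec_mulVec]
  abel

include hR hX hSg

theorem twistedLie_eq (A : Fin n ⊕ Fin p) (φ : Coord n → ι × κ → 𝕜) :
    twistedLie g e β E Sg 𝓐 X A φ y = covDeriv g e Sg 𝓐 φ y (killing β E A y)
      - totRep β E Sg (X y) (kilCoef g e β E A y) *ᵥ φ y := by
  rw [twistedLie, S.lieShift_eq P hy hR hX hSg, Matrix.neg_mulVec, ← sub_eq_add_neg,
    covDeriv_apply]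

theorem cd_twistedLie (hφ : ContDiffAt ℝ ∞ φ y) (A : Fin n ⊕ Fin p) :
    ContDiffAt ℝ ∞ (twistedLie g e β E Sg 𝓐 X A φ) y := by
  refine contDiffAt_congr S.isOpen hy (fun z hz => S.twistedLie_eq P hz hR hX hSg A φ) ?_
  refine ContDiffAt.sub ?_ (cd_mulVec (S.cd_totRep_coef P hy hR hX hSg
    ((S.kil_radial hR A).cd_coef y hy)) hφ)
  simp only [covDeriv_apply]
  exact ContDiffAt.sum fun μ _ => cd_smul (cd_apply μ (S.cd_killing hR hy A))
    (S.cd_nabla P hy hφ μ)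

/-- The twisted Lie derivative commutes with covariantly constant endomorphisms that commute with
the holonomy algebra. -/
theorem twistedLie_mulVec {M : Coord n → Matrix (ι × κ) (ι × κ) 𝕜} (hM : ContDiffAt ℝ ∞ M y)
    (hφ : ContDiffAt ℝ ∞ φ y) (h0 : ∀ μ, gaugeD (connForm g e Sg 𝓐) μ M y = 0)
    (hc : ∀ c, totRep β E Sg (X y) c * M y = M y * totRep β E Sg (X y) c) (A : Fin n ⊕ Fin p) :
    twistedLie g e β E Sg 𝓐 X A (fun z => M z *ᵥ φ z) y =
      M y *ᵥ twistedLie g e β E Sg 𝓐 X A φ y := by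
  rw [S.twistedLie_eq P hy hR hX hSg, S.twistedLie_eq P hy hR hX hSg]
  simp only [covDeriv_apply, nabla_mulVec hM hφ, h0, Matrix.zero_mulVec, zero_add,
    Matrix.mulVec_mulVec, hc, Matrix.mulVec_sub, Matrix.mulVec_sum, Matrix.mulVec_smul]

/-- The transport equations supply the derivatives of ξ_B and c_B; the Christoffel term in ∂ξ_B
completes the second covariant derivative to the Hessian. -/
theorem nabla_twistedLie (hφ : ContDiffAt ℝ ∞ φ y) (B : Fin n ⊕ Fin p) (μ : Fin n) :
    nabla g e Sg 𝓐 μ (twistedLie g e β E Sg 𝓐 X B φ) y =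
      ∑ ν, killing β E B y ν • hessian g e Sg 𝓐 φ y μ ν
      + covDeriv g e Sg 𝓐 φ y (e y *ᵥ (holMap β E (kilCoef g e β E B y) *ᵥ coVec e μ y))
      - totRep β E Sg (X y) (curvCoef E (coVec e μ y) (kilVec e β E B y)) *ᵥ φ y
      - totRep β E Sg (X y) (kilCoef g e β E B y) *ᵥ nabla g e Sg 𝓐 μ φ y := by
  have hk := S.cd_killing hR hy B
  have hc := (S.kil_radial hR B).cd_coef y hy
  have hr := S.cd_totRep_coef P hy hR hX hSg hc
  have h1 : nabla g e Sg 𝓐 μ (fun z => covDeriv g e Sg 𝓐 φ z (killing β E B z)) y =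
      covDeriv g e Sg 𝓐 φ y (pd μ (killing β E B) y)
        + ∑ ν, killing β E B y ν • nabla g e Sg 𝓐 μ (nabla g e Sg 𝓐 ν φ) y := by
    simp only [covDeriv_apply]
    rw [nabla_sum fun ν => cd_smul (cd_apply ν hk) (S.cd_nabla P hy hφ ν),
      ← Finset.sum_add_distrib]
    refine Finset.sum_congr rfl fun ν _ => ?_
    rw [nabla_smul (cd_apply ν hk) (S.cd_nabla P hy hφ ν), pd_eq, ← dirD_apply ν hk]
    rfl
  have h2 : ContDiffAt ℝ ∞ (fun z => covDeriv g e Sg 𝓐 φ z (killing β E B z)) y := by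
    simp only [covDeriv_apply]
    exact ContDiffAt.sum fun μ _ => cd_smul (cd_apply μ hk) (S.cd_nabla P hy hφ μ)
  have h3 : covDeriv g e Sg 𝓐 φ y (chrMat g μ y *ᵥ killing β E B y) =
      ∑ ν, killing β E B y ν • ∑ l, christoffel g l μ ν y • nabla g e Sg 𝓐 l φ y := by
    rw [covDeriv_apply]
    simp only [Matrix.mulVec, dotProduct, Finset.sum_smul, Finset.smul_sum, smul_smul]
    rw [Finset.sum_comm]
    refine Finset.sum_congr rfl fun ν _ => Finset.sum_congr rfl fun l _ => ?_
    congr 1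
    exact mul_comm _ _
  rw [nabla_congr S.isOpen hy (fun z hz => S.twistedLie_eq P hz hR hX hSg B φ),
    nabla_sub h2 (cd_mulVec hr hφ), h1, nabla_mulVec hr hφ, S.gaugeD_totRep P hy hR hX hSg hc,
    S.pd_killing hR hy, (S.transport hR (S.kil_radial hR B) μ hy).2, map_add, map_neg, h3]
  simp only [hessian, smul_sub, Finset.sum_sub_distrib]
  rw [neg_add_cancel_comm]
  abel

/-- The product of two twisted Lie derivatives. -/
theorem twistedLie_twistedLie (hφ : ContDiffAt ℝ ∞ φ y) (A B : Fin n ⊕ Fin p) :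
    twistedLie g e β E Sg 𝓐 X A (twistedLie g e β E Sg 𝓐 X B φ) y =
      biForm (hessian g e Sg 𝓐 φ y) (e y *ᵥ kilVec e β E A y) (e y *ᵥ kilVec e β E B y)
      + covDeriv g e Sg 𝓐 φ y (e y *ᵥ (holMap β E (kilCoef g e β E B y) *ᵥ kilVec e β E A y))
      - totRep β E Sg (X y) (curvCoef E (kilVec e β E A y) (kilVec e β E B y)) *ᵥ φ y
      - totRep β E Sg (X y) (kilCoef g e β E B y) *ᵥ
        covDeriv g e Sg 𝓐 φ y (e y *ᵥ kilVec e β E A y)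
      - totRep β E Sg (X y) (kilCoef g e β E A y) *ᵥ
        covDeriv g e Sg 𝓐 φ y (e y *ᵥ kilVec e β E B y)
      + (totRep β E Sg (X y) (kilCoef g e β E A y) * totRep β E Sg (X y) (kilCoef g e β E B y))
        *ᵥ φ y := by
  have h1 : ∀ {W : Type _} [AddCommGroup W] [Module ℝ W] (L : (Fin n → ℝ) →ₗ[ℝ] W),
      ∑ μ, killing β E A y μ • L (coVec e μ y) = L (kilVec e β E A y) := by
    intro W _ _ L
    rw [kilVec, ← sum_smul_coVec]; simp
  have h2 := h1 (covDeriv g e Sg 𝓐 φ y ∘ₗ (e y).mulVecLin ∘ₗ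
    (holMap β E (kilCoef g e β E B y)).mulVecLin)
  have h3 := h1 ((mulVecBilin (ι × κ) 𝕜).flip (φ y) ∘ₗ totRep β E Sg (X y) ∘ₗ
    (curvCoef E).flip (kilVec e β E B y))
  have h4 : ∑ μ, killing β E A y μ • (totRep β E Sg (X y) (kilCoef g e β E B y) *ᵥ
      nabla g e Sg 𝓐 μ φ y) = totRep β E Sg (X y) (kilCoef g e β E B y) *ᵥ
        covDeriv g e Sg 𝓐 φ y (killing β E A y) := by
    simp only [covDeriv_apply, Matrix.mulVec_sum, Matrix.mulVec_smul]
  have h5 : ∑ μ, killing β E A y μ • ∑ ν, killing β E B y ν • hessian g e Sg 𝓐 φ y μ ν =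
      biForm (hessian g e Sg 𝓐 φ y) (killing β E A y) (killing β E B y) := by
    simp only [biForm_apply, Finset.smul_sum, smul_smul]
  rw [S.twistedLie_eq P hy hR hX hSg A, covDeriv_apply]
  simp only [S.nabla_twistedLie P hy hR hX hSg hφ, smul_add, smul_sub, Finset.sum_add_distrib,
    Finset.sum_sub_distrib]
  rw [h4, h5, S.twistedLie_eq P hy hR hX hSg B, ← S.killing_eq hy, ← S.killing_eq hy,
    Matrix.mulVec_sub, Matrix.mulVec_mulVec]
  simp only [LinearMap.comp_apply, Matrix.mulVecLin_apply, LinearMap.flip_apply] at h2 h3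
  have h6 : ∀ M v, mulVecBilin (ι × κ) 𝕜 M v = M *ᵥ v := fun _ _ => rfl
  simp only [h6] at h3
  rw [h2, h3]
  abel

end IsSymFrame

end Operators

end SymSpace

namespace SymSpace

attribute [local instance] Matrix.normedAddCommGroup Matrix.normedSpace

/-! ### The Laplacian and the commutators -/

section Main

variable {n p : ℕ} {𝕜 ι κ : Type*} [RCLike 𝕜] [Fintype ι] [DecidableEq ι] [Fintype κ]
  [DecidableEq κ] {U : Set (Coord n)}
  {g e : Coord n → Matrix (Fin n) (Fin n) ℝ} {𝓐 : Fin n → Coord n → Matrix κ κ 𝕜} {y : Coord n}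
  {β : Matrix (Fin p) (Fin p) ℝ} {E : Fin p → Matrix (Fin n) (Fin n) ℝ}
  {X : Coord n → Fin n → Fin n → Matrix κ κ 𝕜} {Sg : Fin n → Fin n → Matrix ι ι 𝕜}
  {φ φ' : Coord n → ι × κ → 𝕜}

theorem gam_inv_symm (hβ : β.IsSymm) (A B : Fin n ⊕ Fin p) :
    (gam n β)⁻¹ A B = (gam n β)⁻¹ B A := by
  have h1 : (gam n β)ᵀ = gam n β := by
    rw [gam, Matrix.fromBlocks_transpose, hβ]; simp
  have h2 : ((gam n β)⁻¹)ᵀ = (gam n β)⁻¹ := by rw [Matrix.transpose_nonsing_inv, h1]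
  exact congrFun (congrFun h2 B) A

theorem biForm_gaugeForm_flat (u v : Fin n → ℝ) :
    ∑ a, ∑ b, (u a * v b) • flatCurv e β E 𝓐 a b y =
      gaugeForm e 𝓐 y (flatProj β E *ᵥ u) (flatProj β E *ᵥ v) := by
  have h := LinearMap.congr_fun₂ (biForm_self ((gaugeForm e 𝓐 y).compl₁₂
    (flatProj β E).mulVecLin (flatProj β E).mulVecLin)) u v
  simp only [biForm_apply] at h
  simp only [flatCurv_eq]
  exact h

theorem flatCurvKilling_eq (A B : Fin n ⊕ Fin p) :
    flatCurvKilling (ι := ι) e β E 𝓐 A B y = kronR 𝕜 ι κ (gaugeForm e 𝓐 y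
      (flatProj β E *ᵥ kilVec e β E A y) (flatProj β E *ᵥ kilVec e β E B y)) := by
  rw [← biForm_gaugeForm_flat]; rfl

/-- The vector part of the bracket of two Killing fields. -/
def brVec (g e : Coord n → Matrix (Fin n) (Fin n) ℝ) (β : Matrix (Fin p) (Fin p) ℝ)
    (E : Fin p → Matrix (Fin n) (Fin n) ℝ) (A B : Fin n ⊕ Fin p) (y : Coord n) : Fin n → ℝ :=
  holMap β E (kilCoef g e β E B y) *ᵥ kilVec e β E A y
    - holMap β E (kilCoef g e β E A y) *ᵥ kilVec e β E B y

/-- The holonomy part of the bracket of two Killing fields. -/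
def brCoef (g e : Coord n → Matrix (Fin n) (Fin n) ℝ) (β : Matrix (Fin p) (Fin p) ℝ)
    (E : Fin p → Matrix (Fin n) (Fin n) ℝ) (A B : Fin n ⊕ Fin p) (y : Coord n) : Fin p → ℝ :=
  curvCoef E (kilVec e β E A y) (kilVec e β E B y)
    - holBr β E (kilCoef g e β E A y) (kilCoef g e β E B y)

/-- The structure constants of the isometry algebra, with all indices lowered. -/
def strConst (g e : Coord n → Matrix (Fin n) (Fin n) ℝ) (β : Matrix (Fin p) (Fin p) ℝ)
    (E : Fin p → Matrix (Fin n) (Fin n) ℝ) (A B D : Fin n ⊕ Fin p) : ℝ :=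
  brVec g e β E A B 0 ⬝ᵥ kilVec e β E D 0 + holForm β (brCoef g e β E A B 0) (kilCoef g e β E D 0)

/-- Contractions with totally antisymmetric structure constants cancel. -/
theorem sum_antisymm_cancel {J V : Type*} [Fintype J] [AddCommGroup V] [Module ℝ V]
    {γ s : Matrix J J ℝ} (hγ : ∀ A B, γ A B = γ B A) (hs : ∀ A B, s A B = - s B A)
    (f : J → J → V) :
    ∑ B, ∑ C, γ B C • (∑ D, ∑ F, (γ D F * s B D) • f F C + ∑ D, ∑ F, (γ D F * s C D) • f B F)
      = 0 := by
  have h1 : ∑ B, ∑ C, γ B C • ∑ D, ∑ F, (γ D F * s B D) • f F C =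
      ∑ F, ∑ C, (γ * s * γ) C F • f F C := by
    simp only [Finset.smul_sum, smul_smul]
    rw [Finset.sum_comm, Finset.sum_comm (f := fun F C => (γ * s * γ) C F • f F C)]
    refine Finset.sum_congr rfl fun C _ => ?_
    rw [Finset.sum_congr rfl fun B _ => Finset.sum_comm, Finset.sum_comm]
    refine Finset.sum_congr rfl fun F _ => ?_
    simp only [← Finset.sum_smul, Matrix.mul_apply, Finset.sum_mul]
    rw [Finset.sum_comm]
    congr 1
    refine Finset.sum_congr rfl fun D _ => Finset.sum_congr rfl fun B _ => ?_
    rw [hγ B C]; ring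
  have h2 : ∑ B, ∑ C, γ B C • ∑ D, ∑ F, (γ D F * s C D) • f B F =
      ∑ F, ∑ C, (γ * s * γ) F C • f F C := by
    simp only [Finset.smul_sum, smul_smul]
    refine Finset.sum_congr rfl fun B _ => ?_
    rw [Finset.sum_congr rfl fun C _ => Finset.sum_comm, Finset.sum_comm]
    refine Finset.sum_congr rfl fun F _ => ?_
    simp only [← Finset.sum_smul, Matrix.mul_apply, Finset.sum_mul]
    rw [Finset.sum_comm]
    congr 1
    exact Finset.sum_congr rfl fun D _ => Finset.sum_congr rfl fun C _ => by ring
  -- The two contractions are with γsγ and with its transpose, so antisymmetry makes them cancel.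
  have h3 : (γ * s * γ)ᵀ = -(γ * s * γ) := by
    have h4 : γᵀ = γ := Matrix.ext fun A B => hγ B A
    have h5 : sᵀ = -s := Matrix.ext fun A B => hs B A
    rw [Matrix.transpose_mul, Matrix.transpose_mul, h4, h5, neg_mul, mul_neg, mul_assoc]
  simp only [smul_add, Finset.sum_add_distrib]
  rw [h1, h2, ← Finset.sum_add_distrib]
  refine Finset.sum_eq_zero fun F _ => ?_
  rw [← Finset.sum_add_distrib]
  refine Finset.sum_eq_zero fun C _ => ?_
  have h6 : (γ * s * γ) C F = -(γ * s * γ) F C := congrFun (congrFun h3 F) C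
  rw [h6, neg_smul, neg_add_cancel]

namespace IsSymFrame

variable (S : IsSymFrame U g e) (P : IsParallelGauge U g 𝓐) (hy : y ∈ U)
  (hR : IsCurvatureFactorization β E (fun a b c d => frameRiemann g e a b c d 0))
  (hX : IsGaugeGenerator e β E 𝓐 X U) (hSg : IsSpinRep Sg)
include S hR

theorem strConst_eq (hy : y ∈ U) (A B D : Fin n ⊕ Fin p) : strConst g e β E A B D =
    brVec g e β E A B y ⬝ᵥ kilVec e β E D y
      + holForm β (brCoef g e β E A B y) (kilCoef g e β E D y) := by
  have H := S.isHolonomy hR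
  exact (((S.kil_radial hR A).bracket H (S.kil_radial hR B)).pairing_const H S.starConvex
    (S.kil_radial hR D) hy).symm

theorem strConst_antisymm (A B D : Fin n ⊕ Fin p) :
    strConst g e β E A B D = - strConst g e β E A D B :=
  (S.isHolonomy hR).pairing_bracket_antisymm _ _ _ _ _ _

include P hX hSg

include hy in
/-- The Laplacian in terms of the twisted Lie derivatives. -/
theorem laplacian_eq (hφ : ContDiffAt ℝ ∞ φ y) : laplacian g e Sg 𝓐 φ y =
    lieCasimir g e β E Sg 𝓐 X φ y - holCasimir β E Sg X y *ᵥ φ y := by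
  have H := S.isHolonomy hR
  set r := totRep β E Sg (X y) with hr
  set d := covDeriv g e Sg 𝓐 φ y with hd
  set m := mulVecBilin (ι × κ) 𝕜 with hm
  -- Completeness is applied to the six terms of `twistedLie_twistedLie`: the Hessian becomes the
  -- Laplacian, the three terms mixing ξ and c vanish, R(ξ_A,ξ_B) contracts to R(e_a,e_a) = 0, and
  -- the cc term is the Casimir operator.
  have t1 := S.sum_kilVec_kilVec hR hy ((biForm (hessian g e Sg 𝓐 φ y)).compl₁₂
    (e y).mulVecLin (e y).mulVecLin)
  have t2 := S.sum_kilVec_kilCoef hR hy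
    (((mulVecBilin (Fin n) ℝ ∘ₗ holMap β E).flip).compr₂ (d ∘ₗ (e y).mulVecLin))
  have t3 := S.sum_kilVec_kilVec hR hy ((curvCoef E).compr₂ (m.flip (φ y) ∘ₗ r))
  have t4 := S.sum_kilVec_kilCoef hR hy ((m.flip).compl₁₂ (d ∘ₗ (e y).mulVecLin) r)
  have t5 : ∑ A, ∑ B, (gam n β)⁻¹ A B • (r (kilCoef g e β E A y) *ᵥ
      d (e y *ᵥ kilVec e β E B y)) = 0 := by
    rw [Finset.sum_comm, ← t4]
    refine Finset.sum_congr rfl fun A _ => Finset.sum_congr rfl fun B _ => ?_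
    rw [gam_inv_symm hR.symm]; rfl
  have t6 := S.sum_kilCoef_kilCoef hR hy (((LinearMap.mul ℝ (Matrix (ι × κ) (ι × κ) 𝕜)).compl₁₂
    r r).compr₂ (m.flip (φ y)))
  have h1 : ∑ a, ((biForm (hessian g e Sg 𝓐 φ y)).compl₁₂ (e y).mulVecLin (e y).mulVecLin)
      (Pi.single a 1) (Pi.single a 1) = laplacian g e Sg 𝓐 φ y := by
    have h2 : ∀ a, ((biForm (hessian g e Sg 𝓐 φ y)).compl₁₂ (e y).mulVecLin (e y).mulVecLin)
      (Pi.single a 1) (Pi.single a 1) =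
        ∑ μ, ∑ ν, (e y μ a * e y ν a) • hessian g e Sg 𝓐 φ y μ ν := by
      intro a
      simp [biForm_apply]
    simp only [h2, laplacian]
    rw [Finset.sum_comm]
    refine Finset.sum_congr rfl fun μ _ => ?_
    rw [Finset.sum_comm]
    refine Finset.sum_congr rfl fun ν _ => ?_
    rw [← Finset.sum_smul, S.metric_inv hy]
    rfl
  have h3 : ∑ a, ((curvCoef E).compr₂ (m.flip (φ y) ∘ₗ r)) (Pi.single a 1) (Pi.single a 1) = 0 := by
    refine Finset.sum_eq_zero fun a _ => ?_
    have h4 : curvCoef E (Pi.single a 1) (Pi.single a 1) = 0 :=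
      self_eq_neg.1 (H.curvCoef_antisymm _ _)
    rw [LinearMap.compr₂_apply, h4, map_zero]
  have h5 : ∑ i, ∑ j, β⁻¹ i j • (((LinearMap.mul ℝ (Matrix (ι × κ) (ι × κ) 𝕜)).compl₁₂
      r r).compr₂ (m.flip (φ y))) (Pi.single i 1) (Pi.single j 1) =
      holCasimir β E Sg X y *ᵥ φ y := by
    rw [S.holCasimir_eq P hy hR hX hSg, Matrix.sum_mulVec]
    refine Finset.sum_congr rfl fun i _ => ?_
    rw [Matrix.sum_mulVec]
    refine Finset.sum_congr rfl fun j _ => ?_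
    rw [Matrix.smul_mulVec]
    rfl
  have t1' : ∑ A, ∑ B, (gam n β)⁻¹ A B • biForm (hessian g e Sg 𝓐 φ y)
      (e y *ᵥ kilVec e β E A y) (e y *ᵥ kilVec e β E B y) = laplacian g e Sg 𝓐 φ y := t1.trans h1
  have t2' : ∑ A, ∑ B, (gam n β)⁻¹ A B •
      d (e y *ᵥ (holMap β E (kilCoef g e β E B y) *ᵥ kilVec e β E A y)) = 0 := t2
  have t3' : ∑ A, ∑ B, (gam n β)⁻¹ A B •
      (r (curvCoef E (kilVec e β E A y) (kilVec e β E B y)) *ᵥ φ y) = 0 := t3.trans h3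
  have t4' : ∑ A, ∑ B, (gam n β)⁻¹ A B •
      (r (kilCoef g e β E B y) *ᵥ d (e y *ᵥ kilVec e β E A y)) = 0 := t4
  have t6' : ∑ A, ∑ B, (gam n β)⁻¹ A B •
      ((r (kilCoef g e β E A y) * r (kilCoef g e β E B y)) *ᵥ φ y) =
        holCasimir β E Sg X y *ᵥ φ y := t6.trans h5
  rw [lieCasimir]
  simp only [S.twistedLie_twistedLie P hy hR hX hSg hφ, smul_add, smul_sub,
    Finset.sum_add_distrib, Finset.sum_sub_distrib]
  rw [← hr, ← hd, t1', t2', t3', t4', t5, t6']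
  abel

include hy in
/-- The commutator of two twisted Lie derivatives. -/
theorem twistedLie_comm (hφ : ContDiffAt ℝ ∞ φ y) (A B : Fin n ⊕ Fin p) :
    twistedLie g e β E Sg 𝓐 X A (twistedLie g e β E Sg 𝓐 X B φ) y =
      twistedLie g e β E Sg 𝓐 X B (twistedLie g e β E Sg 𝓐 X A φ) y
      + (∑ D, ∑ C, ((gam n β)⁻¹ D C * strConst g e β E A B D) • twistedLie g e β E Sg 𝓐 X C φ y
      + flatCurvKilling e β E 𝓐 A B y *ᵥ φ y) := by
  have H := S.isHolonomy hR
  set r := totRep β E Sg (X y) with hr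
  set d := covDeriv g e Sg 𝓐 φ y with hd
  -- The antisymmetric part of the Hessian is the bundle curvature, that is ρ(R) plus the flat part
  -- of 𝓕.
  have h1 : biForm (hessian g e Sg 𝓐 φ y) (e y *ᵥ kilVec e β E A y) (e y *ᵥ kilVec e β E B y) =
      biForm (hessian g e Sg 𝓐 φ y) (e y *ᵥ kilVec e β E B y) (e y *ᵥ kilVec e β E A y)
      + (r (curvCoef E (kilVec e β E A y) (kilVec e β E B y)) *ᵥ φ y
        + flatCurvKilling e β E 𝓐 A B y *ᵥ φ y) := by
    set G : (Fin n → ℝ) →ₗ[ℝ] (Fin n → ℝ) →ₗ[ℝ] (ι × κ → 𝕜) :=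
      ((curvCoef E).compr₂ r + ((gaugeForm e 𝓐 y).compl₁₂ (flatProj β E).mulVecLin
        (flatProj β E).mulVecLin).compr₂ (kronR 𝕜 ι κ)).compr₂
        ((mulVecBilin (ι × κ) 𝕜).flip (φ y)) with hG
    have e1 : ∀ μ ν, hessian g e Sg 𝓐 φ y μ ν = hessian g e Sg 𝓐 φ y ν μ
        + G (coVec e μ y) (coVec e ν y) := by
      intro μ ν
      have e2 := S.nabla_comm P hy hφ μ ν (Sg := Sg)
      rw [S.connForm_curvature P hy hR hSg hX] at e2
      simp only [hessian]
      rw [sub_eq_iff_eq_add.1 e2]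
      have e3 : ∀ l, christoffel g l μ ν y = christoffel g l ν μ y := fun l =>
        S.christoffel_symm hy l μ ν
      simp only [e3]
      rw [add_sub_assoc, add_comm]
      rfl
    have e4 : biForm (hessian g e Sg 𝓐 φ y) = (biForm (hessian g e Sg 𝓐 φ y)).flip
        + G.compl₁₂ (e y)⁻¹.mulVecLin (e y)⁻¹.mulVecLin := by
      refine biForm_eq_of_single fun μ ν => ?_
      rw [LinearMap.add_apply, LinearMap.add_apply, LinearMap.flip_apply, biForm_single,
        biForm_single, e1]
      rfl
    have e5 := LinearMap.congr_fun₂ e4 (e y *ᵥ kilVec e β E A y) (e y *ᵥ kilVec e β E B y)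
    rw [LinearMap.add_apply, LinearMap.add_apply, LinearMap.flip_apply, LinearMap.compl₁₂_apply,
      Matrix.mulVecLin_apply, Matrix.mulVecLin_apply, Matrix.mulVec_mulVec, Matrix.mulVec_mulVec,
      S.inv_mul hy, Matrix.one_mulVec, Matrix.one_mulVec] at e5
    rw [e5, flatCurvKilling_eq, ← Matrix.add_mulVec]
    rfl
  -- The remaining terms are ∇ along `brVec` minus ρ(`brCoef`). The bracket pair is expanded in the
  -- basis (ξ_C, c_C) at `y`, with coefficients that are constant by `strConst_eq`.
  obtain ⟨x1, x2⟩ := S.kil_expand hR hy (brVec g e β E A B y) (brCoef g e β E A B y)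
  simp only [← S.strConst_eq hR hy] at x1 x2
  have h2 : d (e y *ᵥ brVec g e β E A B y) - r (brCoef g e β E A B y) *ᵥ φ y =
      ∑ D, ∑ C, ((gam n β)⁻¹ D C * strConst g e β E A B D) • twistedLie g e β E Sg 𝓐 X C φ y := by
    simp only [S.twistedLie_eq P hy hR hX hSg, S.killing_eq hy, smul_sub, Finset.sum_sub_distrib]
    rw [x1, x2]
    simp only [Matrix.mulVec_sum, Matrix.mulVec_smul, map_sum, map_smul, Matrix.sum_mulVec,
      Matrix.smul_mulVec, hr, hd]
  have h3 : curvCoef E (kilVec e β E B y) (kilVec e β E A y) =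
      - curvCoef E (kilVec e β E A y) (kilVec e β E B y) := H.curvCoef_antisymm _ _
  rw [S.twistedLie_twistedLie P hy hR hX hSg hφ, S.twistedLie_twistedLie P hy hR hX hSg hφ,
    ← hr, ← hd, h1, ← h2, h3, map_neg, Matrix.neg_mulVec, brVec, brCoef, map_sub,
    ← S.totRep_comm P hy hR hX hSg, ← hr]
  simp only [Matrix.mulVec_sub, map_sub, Matrix.sub_mulVec]
  abel

include hy in
-- 𝓑_AB is covariantly constant and commutes with ρ, so it passes through each 𝓛_C.
theorem twistedLie_flatCurvKilling (hφ : ContDiffAt ℝ ∞ φ y) (A B C : Fin n ⊕ Fin p) :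
    twistedLie g e β E Sg 𝓐 X C (fun z => flatCurvKilling e β E 𝓐 A B z *ᵥ φ z) y =
      flatCurvKilling e β E 𝓐 A B y *ᵥ twistedLie g e β E Sg 𝓐 X C φ y := by
  have h1 : flatCurvKilling (ι := ι) e β E 𝓐 A B = fun z => kronR 𝕜 ι κ (gaugeForm e 𝓐 z
      (flatProj β E *ᵥ kilVec e β E A z) (flatProj β E *ᵥ kilVec e β E B z)) :=
    funext fun z => flatCurvKilling_eq A B
  rw [h1]
  refine S.twistedLie_mulVec P hy hR hX hSg ?_ hφ
    (fun μ => S.gaugeD_kronR_flat P hy hR (S.kil_radial hR A) (S.kil_radial hR B) μ)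
    (fun c => (S.flat_totRep_comm P hy hR hX hSg _ _ c).symm) C
  exact cd_lin (kronR 𝕜 ι κ) (S.cd_gaugeForm P hy
    (cd_mulVec contDiffAt_const ((S.kil_radial hR A).cd_vec y hy))
    (cd_mulVec contDiffAt_const ((S.kil_radial hR B).cd_vec y hy)))

include hy in
/-- The commutator of the twisted Lie derivatives with the Laplacian. -/
theorem twistedLie_laplacian (hφ : ∀ z ∈ U, ContDiffAt ℝ ∞ φ z) (A : Fin n ⊕ Fin p) :
    twistedLie g e β E Sg 𝓐 X A (laplacian g e Sg 𝓐 φ) y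
      - laplacian g e Sg 𝓐 (twistedLie g e β E Sg 𝓐 X A φ) y
    = (2 : ℝ) • ∑ B, ∑ C, (gam n β)⁻¹ B C •
      (flatCurvKilling e β E 𝓐 A B y *ᵥ twistedLie g e β E Sg 𝓐 X C φ y) := by
  set L : Fin n ⊕ Fin p → (Coord n → ι × κ → 𝕜) → Coord n → ι × κ → 𝕜 :=
    fun A φ => twistedLie g e β E Sg 𝓐 X A φ with hL
  have cdL : ∀ {φ : Coord n → ι × κ → 𝕜}, (∀ z ∈ U, ContDiffAt ℝ ∞ φ z) → ∀ A, ∀ z ∈ U,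
      ContDiffAt ℝ ∞ (L A φ) z := fun h A z hz => S.cd_twistedLie P hz hR hX hSg (h z hz) A
  have cdF : ∀ B, ContDiffAt ℝ ∞ (fun z => flatCurvKilling e β E 𝓐 A B z *ᵥ φ z) y := by
    intro B
    refine cd_mulVec ?_ (hφ y hy)
    exact contDiffAt_congr S.isOpen hy (fun z hz => flatCurvKilling_eq A B)
      (cd_lin (kronR 𝕜 ι κ) (S.cd_gaugeForm P hy
        (cd_mulVec contDiffAt_const ((S.kil_radial hR A).cd_vec y hy))
        (cd_mulVec contDiffAt_const ((S.kil_radial hR B).cd_vec y hy))))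
  -- Δ is replaced by 𝓛² - 𝓡² on all of `U`, since 𝓛_A differentiates; 𝓡² then passes through 𝓛_A
  -- and drops out of the commutator.
  have h1 : L A (laplacian g e Sg 𝓐 φ) y =
      ∑ B, ∑ C, (gam n β)⁻¹ B C • L A (L B (L C φ)) y - holCasimir β E Sg X y *ᵥ L A φ y := by
    have c1 : ∀ B C, ContDiffAt ℝ ∞ (fun z => (gam n β)⁻¹ B C • L B (L C φ) z) y := fun B C =>
      cd_smul contDiffAt_const (cdL (cdL hφ C) B y hy)
    have c2 : ∀ B, ContDiffAt ℝ ∞ (fun z => ∑ C, (gam n β)⁻¹ B C • L B (L C φ) z) y := fun B =>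
      ContDiffAt.sum fun C _ => c1 B C
    have c3 := cd_mulVec (S.cd_holCasimir P hy hR hX hSg) (hφ y hy)
    have e1 : L A (fun z => holCasimir β E Sg X z *ᵥ φ z) y = holCasimir β E Sg X y *ᵥ L A φ y :=
      S.twistedLie_mulVec P hy hR hX hSg (S.cd_holCasimir P hy hR hX hSg) (hφ y hy)
        (fun μ => S.gaugeD_holCasimir P hy hR hX hSg μ)
        (fun c => S.holCasimir_comm P hy hR hX hSg c) A
    have e2 : L A (laplacian g e Sg 𝓐 φ) y = L A (fun z =>
        ∑ B, ∑ C, (gam n β)⁻¹ B C • L B (L C φ) z - holCasimir β E Sg X z *ᵥ φ z) y :=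
      twistedLie_congr S.isOpen hy (fun z hz => S.laplacian_eq P hz hR hX hSg (hφ z hz)) A
    rw [e2, ← e1]
    refine (twistedLie_sub (ContDiffAt.sum fun B _ => c2 B) c3 A).trans ?_
    congr 1
    refine (twistedLie_sum c2 A).trans (Finset.sum_congr rfl fun B _ => ?_)
    refine (twistedLie_sum (c1 B) A).trans (Finset.sum_congr rfl fun C _ => ?_)
    exact twistedLie_const_smul (cdL (cdL hφ C) B y hy) _ A
  have h2 : laplacian g e Sg 𝓐 (L A φ) y =
      ∑ B, ∑ C, (gam n β)⁻¹ B C • L B (L C (L A φ)) y - holCasimir β E Sg X y *ᵥ L A φ y :=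
    S.laplacian_eq P hy hR hX hSg (cdL hφ A y hy)
  -- 𝓛_A is moved to the right past 𝓛_B and then past 𝓛_C, each exchange leaving a
  -- structure-constant term and a 𝓑 term.
  have h3 : ∀ B C, L A (L B (L C φ)) y = L B (L C (L A φ)) y
      + ((∑ D, ∑ F, ((gam n β)⁻¹ D F * strConst g e β E A B D) • L F (L C φ) y
        + ∑ D, ∑ F, ((gam n β)⁻¹ D F * strConst g e β E A C D) • L B (L F φ) y)
      + (flatCurvKilling e β E 𝓐 A B y *ᵥ L C φ y
        + flatCurvKilling e β E 𝓐 A C y *ᵥ L B φ y)) := by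
    intro B C
    have c1 : ∀ D F, ContDiffAt ℝ ∞
        (fun z => ((gam n β)⁻¹ D F * strConst g e β E A C D) • L F φ z) y := fun D F =>
      cd_smul contDiffAt_const (cdL hφ F y hy)
    have c2 : ∀ D, ContDiffAt ℝ ∞
        (fun z => ∑ F, ((gam n β)⁻¹ D F * strConst g e β E A C D) • L F φ z) y := fun D =>
      ContDiffAt.sum fun F _ => c1 D F
    have e1 : L A (L B (L C φ)) y = L B (L A (L C φ)) y
        + (∑ D, ∑ F, ((gam n β)⁻¹ D F * strConst g e β E A B D) • L F (L C φ) y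
        + flatCurvKilling e β E 𝓐 A B y *ᵥ L C φ y) :=
      S.twistedLie_comm P hy hR hX hSg (cdL hφ C y hy) A B
    have e2 : L B (L A (L C φ)) y = L B (fun z => L C (L A φ) z
        + (∑ D, ∑ F, ((gam n β)⁻¹ D F * strConst g e β E A C D) • L F φ z
        + flatCurvKilling e β E 𝓐 A C z *ᵥ φ z)) y :=
      twistedLie_congr S.isOpen hy
        (fun z hz => S.twistedLie_comm P hz hR hX hSg (hφ z hz) A C) B
    have e3 : L B (fun z => ∑ D, ∑ F, ((gam n β)⁻¹ D F * strConst g e β E A C D) • L F φ z) y =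
        ∑ D, ∑ F, ((gam n β)⁻¹ D F * strConst g e β E A C D) • L B (L F φ) y := by
      refine (twistedLie_sum c2 B).trans (Finset.sum_congr rfl fun D _ => ?_)
      refine (twistedLie_sum (c1 D) B).trans (Finset.sum_congr rfl fun F _ => ?_)
      exact twistedLie_const_smul (cdL hφ F y hy) _ B
    have e4 : L B (fun z => flatCurvKilling e β E 𝓐 A C z *ᵥ φ z) y =
        flatCurvKilling e β E 𝓐 A C y *ᵥ L B φ y :=
      S.twistedLie_flatCurvKilling P hy hR hX hSg (hφ y hy) A C B
    have e5 : L B (fun z => L C (L A φ) z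
        + (∑ D, ∑ F, ((gam n β)⁻¹ D F * strConst g e β E A C D) • L F φ z
        + flatCurvKilling e β E 𝓐 A C z *ᵥ φ z)) y = L B (L C (L A φ)) y
        + (L B (fun z => ∑ D, ∑ F, ((gam n β)⁻¹ D F * strConst g e β E A C D) • L F φ z) y
        + L B (fun z => flatCurvKilling e β E 𝓐 A C z *ᵥ φ z) y) := by
      have c3 := ContDiffAt.sum (s := Finset.univ) fun D _ => c2 D
      refine (twistedLie_add (cdL (cdL hφ A) C y hy) (c3.add (cdF C)) B).trans ?_
      congr 1
      exact twistedLie_add c3 (cdF C) B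
    rw [e1, e2, e5, e3, e4]
    abel
  have h4 := sum_antisymm_cancel (gam_inv_symm hR.symm) (S.strConst_antisymm hR A)
    (fun F C => L F (L C φ) y)
  -- The two 𝓑 terms differ by exchanging B and C, under which γ^{BC} is symmetric; this is the
  -- source of the factor 2.
  have h5 : ∑ B, ∑ C, (gam n β)⁻¹ B C • (flatCurvKilling e β E 𝓐 A C y *ᵥ L B φ y) =
      ∑ B, ∑ C, (gam n β)⁻¹ B C • (flatCurvKilling e β E 𝓐 A B y *ᵥ L C φ y) := by
    rw [Finset.sum_comm]
    exact Finset.sum_congr rfl fun B _ => Finset.sum_congr rfl fun C _ => by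
      rw [gam_inv_symm hR.symm]
  change L A (laplacian g e Sg 𝓐 φ) y - laplacian g e Sg 𝓐 (L A φ) y = _
  rw [h1, h2, sub_sub_sub_cancel_right, ← Finset.sum_sub_distrib]
  simp only [← Finset.sum_sub_distrib, ← smul_sub, h3, add_sub_cancel_left]
  have h6 : ∀ (t : ℝ) (a b c d : ι × κ → 𝕜), t • ((a + b) + (c + d)) =
      t • (a + b) + (t • c + t • d) := fun t a b c d => by rw [smul_add t (a + b), smul_add t c]
  simp only [h6]
  rw [Finset.sum_congr rfl fun B _ => Finset.sum_add_distrib, Finset.sum_add_distrib, h4, zero_add,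
    Finset.sum_congr rfl fun B _ => Finset.sum_add_distrib, Finset.sum_add_distrib, h5, two_smul]

end IsSymFrame

end Main

end SymSpace

/-! ### From a normal chart of the manifold to the radial frame -/

namespace SymSpace

attribute [local instance] Matrix.normedAddCommGroup Matrix.normedSpace

theorem IsRadialFrame.isSymFrame {n : ℕ} {U : Set (Coord n)}
    {g e : Coord n → Matrix (Fin n) (Fin n) ℝ} (hU : IsOpen U) (hg : IsNormal g U)
    (he : IsRadialFrame g U e) (hs : ∀ y ∈ U, ∀ l α β μ ν, nablaRiemann g l α β μ ν y = 0) :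
    IsSymFrame U g e where
  isOpen := hU
  smooth y hy := cd_matrix fun μ a => (he.smooth μ a).contDiffAt (hU.mem_nhds hy)
  orthonormal := he.orthonormal
  zero_mem := hg.zero_mem
  starConvex := hg.starConvex
  geodesic := hg.geodesic
  frame_zero := he.frame_zero
  parallel := he.parallel
  nabla_riemann := hs

end SymSpace

end

theorem mainTheorem5 {n p : ℕ} {𝕜 ι κ : Type*} [RCLike 𝕜] [Fintype ι] [DecidableEq ι]
    [Fintype κ] [DecidableEq κ]
    {M : Type*} [TopologicalSpace M] [ChartedSpace (SymSpace.Coord n) M]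
    [IsManifold (𝓡 n) ∞ M]
    (g : Bundle.ContMDiffRiemannianMetric (𝓡 n) ∞ (SymSpace.Coord n)
      (fun x : M => TangentSpace (𝓡 n) x))
    (hsym : SymSpace.IsLocallySymmetric g)
    (x₀ : M) (Φ : OpenPartialHomeomorph M (SymSpace.Coord n))
    (hΦ : SymSpace.IsNormalChart g x₀ Φ)
    (e : SymSpace.Coord n → Matrix (Fin n) (Fin n) ℝ)
    (he : SymSpace.IsRadialFrame (SymSpace.chartMetric g Φ) Φ.target e)
    (β : Matrix (Fin p) (Fin p) ℝ) (E : Fin p → Matrix (Fin n) (Fin n) ℝ)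
    (hR : SymSpace.IsCurvatureFactorization β E
      (fun a b c d => SymSpace.frameRiemann (SymSpace.chartMetric g Φ) e a b c d 0))
    (Sg : Fin n → Fin n → Matrix ι ι 𝕜) (hSg : SymSpace.IsSpinRep Sg)
    (𝓐 : Fin n → SymSpace.Coord n → Matrix κ κ 𝕜)
    (hA : ∀ μ r s, ContDiffOn ℝ ∞ (fun y => 𝓐 μ y r s) Φ.target)
    (hF : ∀ y ∈ Φ.target, ∀ l μ ν,
      SymSpace.nablaGaugeCurv (SymSpace.chartMetric g Φ) 𝓐 l μ ν y = 0) :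
    (∃ X, SymSpace.IsGaugeGenerator e β E 𝓐 X Φ.target) ∧
    ∀ X, SymSpace.IsGaugeGenerator e β E 𝓐 X Φ.target →
      ∀ φ : SymSpace.Coord n → ι × κ → 𝕜, ContDiffOn ℝ ∞ φ Φ.target →
        ∀ y ∈ Φ.target,
          SymSpace.laplacian (SymSpace.chartMetric g Φ) e Sg 𝓐 φ y
            = SymSpace.lieCasimir (SymSpace.chartMetric g Φ) e β E Sg 𝓐 X φ y
              - SymSpace.holCasimir β E Sg X y *ᵥ φ y ∧
          ∀ A,
            SymSpace.twistedLie (SymSpace.chartMetric g Φ) e β E Sg 𝓐 X A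
                (SymSpace.laplacian (SymSpace.chartMetric g Φ) e Sg 𝓐 φ) y
              - SymSpace.laplacian (SymSpace.chartMetric g Φ) e Sg 𝓐
                (SymSpace.twistedLie (SymSpace.chartMetric g Φ) e β E Sg 𝓐 X A φ) y
            = (2 : ℝ) • ∑ B, ∑ C, (SymSpace.gam n β)⁻¹ B C •
                (SymSpace.flatCurvKilling e β E 𝓐 A B y *ᵥ
                  SymSpace.twistedLie (SymSpace.chartMetric g Φ) e β E Sg 𝓐 X C φ y) := by
  have S := he.isSymFrame Φ.open_target hΦ.normal (hsym Φ hΦ.mem_atlas)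
  have P : SymSpace.IsParallelGauge Φ.target (SymSpace.chartMetric g Φ) 𝓐 :=
    { smooth := fun y hy μ => SymSpace.cd_matrix fun r s =>
        (hA μ r s).contDiffAt (Φ.open_target.mem_nhds hy)
      parallel := hF }
  refine ⟨S.exists_gaugeGenerator P hR, fun X hX φ hφ y hy => ?_⟩
  have hφ' : ∀ z ∈ Φ.target, ContDiffAt ℝ ∞ φ z := fun z hz =>
    hφ.contDiffAt (Φ.open_target.mem_nhds hz)
  exact ⟨S.laplacian_eq P hy hR hX hSg (hφ' y hy),
    fun A => S.twistedLie_laplacian P hy hR hX hSg hφ' A⟩
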